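/- All graphs are finite. A multigraph may have parallel edges and loops, and $\Vert H\Vert=|E(H)|$ counts edges with multiplicity. A set of vertices of a (multi)graph is connected if it induces a connected subgraph; the empty set counts as connected. For a multigraph $H$, a non-crossing $H$-representation of a simple graph $G$ consists of a subdivision $H'$ of $H$ and a family $(X_v)_{v\in V(G)}$ of connected vertex subsets of $H'$ such that distinct vertices $u,v$ of $G$ are adjacent if and only if $X_u\cap X_v\neq\varnothing$, and such that $X_u\setminus X_v$ is connected for all $u,v\in V(G)$. If $G$ has such a representation, it is called a non-crossing $H$-graph. For an integer $k>0$, a proper $k$-mixed-thin representation of $G$ consists of a partition $(V^1,\dots,V^k)$ of $V(G)$ (classes may be empty) and, for all $1\le i\le j\le k$, a linear order $<_{ij}$ on $V^i\cup V^j$ and a set $E_{i,j}\in\{E(G[V^i,V^j]),E(\overline{G}[V^i,V^j])\}$ (the edges, respectively non-edges, of $G$ between $V^i$ and $V^j$) such that for all $i\le j$: - the restriction of $<_{ij}$ to $V^i$ (to $V^j$) equals $<_{ii}$ (equals $<_{jj}$) or its inverse; - if $u<_{ij}v<_{ij}w$, where $u,v$ lie in one of $V^i,V^j$ and $w$ lies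 in the other (in the same class if $i=j$), and $uw\in E_{i,j}$, then $vw\in E_{i,j}$; - if $u<_{ij}v<_{ij}w$, where $v,w$ lie in one of $V^i,V^j$ and $u$ lies in the other (in the same class if $i=j$), and $uw\in E_{i,j}$, then $uv\in E_{i,j}$. The proper mixed-thinness of $G$ is the least $k>0$ for which such a representation exists. **Theorem.** For every multigraph $H$ with at least one edge, every non-crossing $H$-graph $G$ has proper mixed-thinness at most $$t=2^{\Vert H\Vert}\,(4^{\Vert H\Vert}-1)\,(\Vert H\Vert^2+1)+\Vert H\Vert .$$ Moreover, there is an algorithm that, given a multigraph $H$ with at least one edge and a non-crossing $H$-representation of a graph $G$ (with its framework $H'$), computes a proper $t$-mixed-thin representation of $G$ in time polynomial in the size of the input; here orders and edge choices are written out only for pairs of non-empty classes. -/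

import Mathlib

/-! ### Subdivisions of multigraphs

Multigraphs (parallel edges and loops allowed) are Mathlib's `Graph α β`, with vertex set
`H.vertexSet : Set α` and edge set `H.edgeSet : Set β`. -/

/-- The size `‖H‖ = |E(H)|` of a multigraph, counted with multiplicities. -/
noncomputable def Graph.size {α β : Type*} (H : Graph α β) : ℕ := H.edgeSet.ncard

/-- A set `X` of vertices of a multigraph is connected if any two of its elements are joined by a
walk inside `X`. The empty set is connected. -/
def Graph.IsConnectedSet {α β : Type*} (H : Graph α β) (X : Set α) : Prop :=
  X ⊆ H.vertexSet ∧
    ∀ x ∈ X, ∀ y ∈ X, Relation.ReflTransGen (fun a b => a ∈ X ∧ b ∈ X ∧ H.Adj a b) x y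

/-- The data of a subdivision of `H`: the number `len e` of internal vertices on each edge `e`, and a
reference direction of each edge, from `src e` to `tgt e`, which is only used to number the internal
vertices. Values at elements of `β` that are not edges of `H` play no role. -/
structure Graph.Subdivision {α β : Type*} (H : Graph α β) where
  src : β → α
  tgt : β → α
  isLink : ∀ e ∈ H.edgeSet, H.IsLink e (src e) (tgt e)
  len : β → ℕ

namespace Graph.Subdivision

variable {α β : Type*} {H : Graph α β}

/-- The path `x, z₁, …, z_r, y` (`r = len e`) that replaces the edge `e = xy`: its `0`-th vertex is
`x`, its `i`-th vertex for `1 ≤ i ≤ r` is the internal vertex `(e, i)`, its last vertex is `y`. -/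
def pathVertex (S : H.Subdivision) (e : β) (i : ℕ) : α ⊕ β × ℕ :=
  if i = 0 then Sum.inl (S.src e)
  else if i ≤ S.len e then Sum.inr (e, i)
  else Sum.inl (S.tgt e)

/-- The subdivided multigraph `H'`. The edge `(e, i)`, for `0 ≤ i ≤ len e`, joins the `i`-th and the
`(i + 1)`-st vertex of the path that replaces `e`. -/
def graph (S : H.Subdivision) : Graph (α ⊕ β × ℕ) (β × ℕ) where
  vertexSet := {x | (∃ v ∈ H.vertexSet, x = Sum.inl v) ∨
    ∃ e ∈ H.edgeSet, ∃ i, 1 ≤ i ∧ i ≤ S.len e ∧ x = Sum.inr (e, i)}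
  IsLink f x y := f.1 ∈ H.edgeSet ∧ f.2 ≤ S.len f.1 ∧
    ((x = S.pathVertex f.1 f.2 ∧ y = S.pathVertex f.1 (f.2 + 1)) ∨
      (y = S.pathVertex f.1 f.2 ∧ x = S.pathVertex f.1 (f.2 + 1)))
  isLink_symm := fun _ _ => ⟨fun _ _ h => ⟨h.1, h.2.1, h.2.2.symm⟩⟩
  eq_or_eq_of_isLink_of_isLink := by
    rintro f x y v w ⟨-, -, h⟩ ⟨-, -, h'⟩
    rcases h with ⟨rfl, rfl⟩ | ⟨rfl, rfl⟩ <;> rcases h' with ⟨rfl, rfl⟩ | ⟨rfl, rfl⟩ <;> simp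
  left_mem_of_isLink := by
    have key : ∀ e ∈ H.edgeSet, ∀ i, (∃ v ∈ H.vertexSet, S.pathVertex e i = Sum.inl v) ∨
        ∃ e' ∈ H.edgeSet, ∃ j, 1 ≤ j ∧ j ≤ S.len e' ∧ S.pathVertex e i = Sum.inr (e', j) := by
      intro e he i
      unfold pathVertex
      split_ifs with h0 h1
      · exact Or.inl ⟨_, (S.isLink e he).left_mem, rfl⟩
      · exact Or.inr ⟨e, he, i, Nat.one_le_iff_ne_zero.2 h0, h1, rfl⟩
      · exact Or.inl ⟨_, (S.isLink e he).right_mem, rfl⟩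
    rintro f x y ⟨he, -, ⟨rfl, -⟩ | ⟨-, rfl⟩⟩
    · exact key _ he _
    · exact key _ he _

end Graph.Subdivision

/-! ### Non-crossing `H`-graphs -/

/-- An `H`-representation of a simple graph `G`: a subdivision of `H` (the framework) and a family of
connected vertex subsets of it, indexed by the vertices of `G`, of which `G` is the intersection
graph. -/
structure HRepresentation {α β V : Type*} (H : Graph α β) (G : SimpleGraph V) where
  framework : H.Subdivision
  rep : V → Set (α ⊕ β × ℕ)
  connected : ∀ v, framework.graph.IsConnectedSet (rep v)
  adj_iff : ∀ u v, u ≠ v → (G.Adj u v ↔ (rep u ∩ rep v).Nonempty)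

/-- The family is non-crossing: for any two members `A`, `B`, both `A \ B` and `B \ A` are
connected. -/
def HRepresentation.IsNonCrossing {α β V : Type*} {H : Graph α β} {G : SimpleGraph V}
    (S : HRepresentation H G) : Prop :=
  ∀ u v, S.framework.graph.IsConnectedSet (S.rep u \ S.rep v)

/-- `G` is a non-crossing `H`-graph. -/
def IsNonCrossingHGraph {α β V : Type*} (H : Graph α β) (G : SimpleGraph V) : Prop :=
  ∃ S : HRepresentation H G, S.IsNonCrossing

/-! ### Proper mixed-thinness -/

/-- `r` is a strict linear order on the set `s` (its values outside `s` play no role). -/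
def IsStrictLinearOrderOn {V : Type*} (s : Set V) (r : V → V → Prop) : Prop :=
  (∀ u ∈ s, ¬ r u u) ∧
  (∀ u ∈ s, ∀ v ∈ s, ∀ w ∈ s, r u v → r v w → r u w) ∧
  (∀ u ∈ s, ∀ v ∈ s, u ≠ v → r u v ∨ r v u)

/-- On the set `s`, the relations `r` and `r'` agree or are inverse to each other. -/
def AlignedOn {V : Type*} (s : Set V) (r r' : V → V → Prop) : Prop :=
  (∀ u ∈ s, ∀ v ∈ s, (r u v ↔ r' u v)) ∨ (∀ u ∈ s, ∀ v ∈ s, (r u v ↔ r' v u))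

/-- Adjacency in `G` (sign `true`, matrix entry `1`) or in the complement of `G` (sign `false`,
matrix entry `-1`). -/
def SignedAdj {V : Type*} (G : SimpleGraph V) (sign : Bool) (u v : V) : Prop :=
  if sign then G.Adj u v else Gᶜ.Adj u v

/-- A proper `k`-mixed-thin representation of `G`. The class `V^i` is `{v | cls v = i}` (classes may
be empty); `lt i j` and `sign i j` are only relevant for `i ≤ j`. -/
structure ProperMixedThinRep {V : Type*} (G : SimpleGraph V) (k : ℕ) where
  cls : V → Fin k
  lt : Fin k → Fin k → V → V → Prop
  sign : Fin k → Fin k → Bool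
  linear : ∀ i j, i ≤ j → IsStrictLinearOrderOn {v | cls v = i ∨ cls v = j} (lt i j)
  al_left : ∀ i j, i ≤ j → AlignedOn {v | cls v = i} (lt i j) (lt i i)
  al_right : ∀ i j, i ≤ j → AlignedOn {v | cls v = j} (lt i j) (lt j j)
  co : ∀ i j, i ≤ j → ∀ u v w,
    (cls u = i ∧ cls v = i ∧ cls w = j) ∨ (cls u = j ∧ cls v = j ∧ cls w = i) →
    lt i j u v → lt i j v w → SignedAdj G (sign i j) u w → SignedAdj G (sign i j) v w
  sc : ∀ i j, i ≤ j → ∀ u v w,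
    (cls v = i ∧ cls w = i ∧ cls u = j) ∨ (cls v = j ∧ cls w = j ∧ cls u = i) →
    lt i j u v → lt i j v w → SignedAdj G (sign i j) u w → SignedAdj G (sign i j) u v

/-- The proper mixed-thinness of `G`: the least `k > 0` such that `G` has a proper `k`-mixed-thin
representation (`⊤` if there is none, which does not happen for finite graphs). -/
noncomputable def properMixedThinness {V : Type*} (G : SimpleGraph V) : ℕ∞ :=
  ⨅ k ∈ {k : ℕ | 0 < k ∧ Nonempty (ProperMixedThinRep G k)}, (k : ℕ∞)

/-- The number `2^m (4^m - 1) (m^2 + 1) + m`. -/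
def thinnessBound (m : ℕ) : ℕ := 2 ^ m * (4 ^ m - 1) * (m ^ 2 + 1) + m

/-! ### A random access machine with a step count

Programs are structured programs over registers and finitely many random access arrays of natural
numbers, with random access to a read-only input list and with an append-only output list. The
arithmetic operations are addition and truncated subtraction, so that the unit cost measure is
polynomially related to the running time of Turing machines. -/

namespace RAM

/-- Expressions: numerals, registers, the number of input words, the input word with a computed
index, the entry with a computed index of a fixed array, sum, truncated difference. -/
inductive Expr where
  | const (c : ℕ)
  | reg (x : ℕ)
  | inputLength
  | input (i : Expr)
  | get (a : ℕ) (i : Expr)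
  | add (e₁ e₂ : Expr)
  | sub (e₁ e₂ : Expr)

/-- Programs. A condition holds when its value is nonzero; `loop e p` is the loop `while e do p`. -/
inductive Prog where
  | skip
  | assign (x : ℕ) (e : Expr)
  | store (a : ℕ) (i e : Expr)
  | emit (e : Expr)
  | seq (p q : Prog)
  | ite (e : Expr) (p q : Prog)
  | loop (e : Expr) (p : Prog)

/-- A state: the contents of registers and arrays, and the output written so far. -/
structure State where
  reg : ℕ → ℕ
  arr : ℕ → ℕ → ℕ
  out : List ℕ

/-- At the start, all registers and arrays hold `0` and the output is empty. -/
def State.init : State := ⟨fun _ => 0, fun _ _ => 0, []⟩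

/-- The value of an expression; input words beyond the end of the input are `0`. -/
def Expr.eval (inp : List ℕ) (s : State) : Expr → ℕ
  | const c => c
  | reg x => s.reg x
  | inputLength => inp.length
  | input i => inp.getD (i.eval inp s) 0
  | get a i => s.arr a (i.eval inp s)
  | add e₁ e₂ => e₁.eval inp s + e₂.eval inp s
  | sub e₁ e₂ => e₁.eval inp s - e₂.eval inp s

/-- Evaluating an expression costs one step for each of its nodes. -/
def Expr.cost : Expr → ℕ
  | const _ => 1
  | reg _ => 1
  | inputLength => 1
  | input i => i.cost + 1
  | get _ i => i.cost + 1
  | add e₁ e₂ => e₁.cost + e₂.cost + 1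
  | sub e₁ e₂ => e₁.cost + e₂.cost + 1

/-- `Exec inp p s s' T`: on the input `inp`, the program `p` started in the state `s` halts in the
state `s'` after exactly `T` steps. -/
inductive Exec (inp : List ℕ) : Prog → State → State → ℕ → Prop where
  | skip (s : State) : Exec inp .skip s s 1
  | assign (x : ℕ) (e : Expr) (s : State) :
      Exec inp (.assign x e) s
        ⟨Function.update s.reg x (e.eval inp s), s.arr, s.out⟩ (e.cost + 1)
  | store (a : ℕ) (i e : Expr) (s : State) :
      Exec inp (.store a i e) s
        ⟨s.reg, Function.update s.arr a
          (Function.update (s.arr a) (i.eval inp s) (e.eval inp s)), s.out⟩ (i.cost + e.cost + 1)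
  | emit (e : Expr) (s : State) :
      Exec inp (.emit e) s ⟨s.reg, s.arr, s.out ++ [e.eval inp s]⟩ (e.cost + 1)
  | seq {p q : Prog} {s s' s'' : State} {T T' : ℕ} (hp : Exec inp p s s' T)
      (hq : Exec inp q s' s'' T') : Exec inp (.seq p q) s s'' (T + T')
  | ite_true {e : Expr} {p q : Prog} {s s' : State} {T : ℕ} (he : e.eval inp s ≠ 0)
      (hp : Exec inp p s s' T) : Exec inp (.ite e p q) s s' (T + e.cost + 1)
  | ite_false {e : Expr} {p q : Prog} {s s' : State} {T : ℕ} (he : e.eval inp s = 0)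
      (hq : Exec inp q s s' T) : Exec inp (.ite e p q) s s' (T + e.cost + 1)
  | loop_true {e : Expr} {p : Prog} {s s' s'' : State} {T T' : ℕ} (he : e.eval inp s ≠ 0)
      (hp : Exec inp p s s' T) (hw : Exec inp (.loop e p) s' s'' T') :
      Exec inp (.loop e p) s s'' (T + T' + e.cost + 1)
  | loop_false {e : Expr} {p : Prog} {s : State} (he : e.eval inp s = 0) :
      Exec inp (.loop e p) s s (e.cost + 1)

/-- The size of a list of natural numbers: the total length of the binary expansions, with one
separator for each number. -/
def bitSize (l : List ℕ) : ℕ := (l.map fun a => a.size + 1).sum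

end RAM

/-! ### Encodings of inputs and outputs

Here the vertices and edges of `H` and the vertices of `G` are numbered. -/

open Classical in
/-- The input word list of an `H`-representation of `G`: the numbers of vertices of `G`, of vertices
of `H` and of edges of `H`; for each edge of `H` its two ends and its number of internal vertices in
the framework; and for each vertex of `G` the characteristic vector of its representative, over the
vertices of `H` first and then over the internal vertices of the edges, in order. -/
noncomputable def HRepresentation.encode {n p m : ℕ} {H : Graph (Fin p) (Fin m)}
    {G : SimpleGraph (Fin n)} (S : HRepresentation H G) : List ℕ :=
  [n, p, m] ++
  (List.finRange m).flatMap (fun e =>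
    [(S.framework.src e : ℕ), (S.framework.tgt e : ℕ), S.framework.len e]) ++
  (List.finRange n).flatMap (fun v =>
    (List.finRange p).map (fun x => if Sum.inl x ∈ S.rep v then 1 else 0) ++
    (List.finRange m).flatMap (fun e =>
      (List.range (S.framework.len e)).map
        (fun i => if Sum.inr (e, i + 1) ∈ S.rep v then 1 else 0)))

/-- The word list `out` describes the representation `R`: it lists the class of each vertex, followed,
for each pair `i ≤ j` of indices of nonempty classes, by a record that consists of `i`, `j`, the sign
(`1` for edges, `0` for non-edges) and the vertices of `V^i ∪ V^j` in increasing order with respect to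
`lt i j`. Nothing is written for empty classes: if one of `V^i`, `V^j` is empty, the order on
`V^i ∪ V^j` can be taken to be that of the other class and the sign does not matter. -/
def ProperMixedThinRep.IsEncodedBy {n k : ℕ} {G : SimpleGraph (Fin n)}
    (R : ProperMixedThinRep G k) (out : List ℕ) : Prop :=
  ∃ (pairs : List (Fin k × Fin k)) (ordered : Fin k × Fin k → List (Fin n)),
    pairs.Nodup ∧
    (∀ i j, (i, j) ∈ pairs ↔ i ≤ j ∧ (∃ v, R.cls v = i) ∧ (∃ v, R.cls v = j)) ∧
    (∀ i j, (i, j) ∈ pairs →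
      (∀ v, v ∈ ordered (i, j) ↔ R.cls v = i ∨ R.cls v = j) ∧
      (ordered (i, j)).Pairwise (R.lt i j)) ∧
    out = (List.finRange n).map (fun v => (R.cls v : ℕ)) ++
      pairs.flatMap (fun q =>
        [(q.1 : ℕ), (q.2 : ℕ), if R.sign q.1 q.2 then 1 else 0] ++
          (ordered q).map (fun v => (v : ℕ)))

/-! Each edge of `H` has two half-edges. A set that contains an end of an edge (a branch vertex of
`G`) meets every subdivided edge in pieces that start at its ends. Any other set is an interval
inside one path, a single isolated vertex of `H`, or empty. A set is therefore described by finitely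
many bits and its runs: for each half-edge, how far one can walk from the end inside the set (branch
vertices) or inside its complement (all others).

The type of a vertex says which ends its set contains and which paths are full. Let `u` and `v` be
branch vertices of the same type, and let `u` have the longer run at some half-edge. Then `X_u \
X_v` has a piece there, trapped between a position in `X_v` and a position outside `X_u`. Since the
difference is connected, it lies entirely in this piece, so this happens at only one half-edge
(`model_single_of_branch`; `model_single_of_not_branch` is the analogue with the roles exchanged).
Hence vertices of the same type differ in at most two runs, and if in two, then in opposite
directions.

Comparison with a reference vertex of the type gives at most two edges on which a branch vertex
differs from it. Type and differing edges together define a class, and in a class all but two runs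
are constant (`Represents.exists_axes`). Sorted by a suitable key, a class has one weakly rising
run, one weakly falling run, and no other change (`Represents.exists_monotone_axes`). The bound
counts classes: nonempty sets of ends, sets of full paths and sets of at most two edges give `(4^m -
1) * 2^m * (m^2 + 1)`, and intervals inside one edge give `m` more. The class of sets that meet no
edge takes a code that no branch vertex uses.

Inside a class the edges are used: the class is complete, or a disjoint union of cliques sorted by
tag, or an interval family whose two endpoints move in the same direction. Between classes the
non-edges are used: apart from trivial cases, two sets are disjoint if and only if `x h u + y h w ≤
c h` for all half-edges `h`, with one rising and one falling coordinate in each class. After a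
possible reversal of the second class these conditions split into two groups of opposite
monotonicity (`exists_flip_of_axes`). So `u` and `w` are disjoint as soon as some disjoint pair lies
above `u` and below `w` (`Cut`) and some disjoint pair lies below `u` and above `w` (`CoCut`).
Merging the classes by putting `u` before `w` exactly when `Cut` holds gives both conditions on the
order.

For the algorithm, every notion involved is built from arithmetic, bounded quantifiers and counting
over indices below the number of input words. It is thus a term with a fixed nesting depth of such
loops, and compiled terms run in polynomial time. -/

namespace RAM

/-! ### Sum terms and their compilation -/

/-- Terms over named variables whose only loops are sums over all indices below the number of input
words. -/
inductive Term where
  | const (c : ℕ)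
  | var (x : ℕ)
  | len
  | input (t : Term)
  | add (a b : Term)
  | sub (a b : Term)
  | ite (c a b : Term)
  | sum (x : ℕ) (t : Term)

/-- The value of a term. -/
def Term.eval (inp : List ℕ) : Term → (ℕ → ℕ) → ℕ
  | const c, _ => c
  | var x, env => env x
  | len, _ => inp.length
  | input t, env => inp.getD (t.eval inp env) 0
  | add a b, env => a.eval inp env + b.eval inp env
  | sub a b, env => a.eval inp env - b.eval inp env
  | ite c a b, env => if c.eval inp env ≠ 0 then a.eval inp env else b.eval inp env
  | sum x t, env => ∑ i ∈ Finset.range inp.length, t.eval inp (Function.update env x i)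

/-- The body of the loop that evaluates a sum. -/
def sumBody (x d : ℕ) (p : Prog) : Prog :=
  .seq p (.seq (.assign (2 * d + 1) (.add (.reg (2 * d + 1)) (.reg (2 * (d + 2) + 1))))
    (.assign (2 * x) (.add (.reg (2 * x)) (.const 1))))

/-- The compiled term: the variable `x` lives in the register `2 * x`, the registers `2 * c + 1` with
`d ≤ c` are used as scratch space, and the result is left in the register `2 * d + 1`. -/
def Term.code : Term → ℕ → Prog
  | const c, d => .assign (2 * d + 1) (.const c)
  | var x, d => .assign (2 * d + 1) (.reg (2 * x))
  | len, d => .assign (2 * d + 1) .inputLength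
  | input t, d => .seq (t.code d) (.assign (2 * d + 1) (.input (.reg (2 * d + 1))))
  | add a b, d => .seq (a.code d) (.seq (b.code (d + 1))
      (.assign (2 * d + 1) (.add (.reg (2 * d + 1)) (.reg (2 * (d + 1) + 1)))))
  | sub a b, d => .seq (a.code d) (.seq (b.code (d + 1))
      (.assign (2 * d + 1) (.sub (.reg (2 * d + 1)) (.reg (2 * (d + 1) + 1)))))
  | ite c a b, d => .seq (c.code d) (.ite (.reg (2 * d + 1)) (a.code d) (b.code d))
  -- Scratch `d` accumulates, scratch `d + 1` keeps the outer value of `x` for the final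
  -- restoration, and the summand works from scratch `d + 2` on. The loop condition is a truncated
  -- difference, nonzero exactly while `x` is below the input length.
  | sum x t, d =>
    .seq (.assign (2 * d + 1) (.const 0)) (.seq (.assign (2 * (d + 1) + 1) (.reg (2 * x)))
      (.seq (.assign (2 * x) (.const 0))
        (.seq (.loop (.sub .inputLength (.reg (2 * x))) (sumBody x d (t.code (d + 2))))
          (.assign (2 * x) (.reg (2 * (d + 1) + 1))))))

/-- A bound on the running time of the compiled term, as a polynomial in the number of input words. -/
noncomputable def Term.time : Term → Polynomial ℕ
  | const _ => 2
  | var _ => 2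
  | len => 2
  | input t => t.time + 3
  | add a b => a.time + b.time + 4
  | sub a b => a.time + b.time + 4
  | ite c a b => c.time + a.time + b.time + 2
  -- A round costs the summand, 8 steps for the two updates and 4 for the loop test; outside the
  -- rounds there are four assignments of cost 2 and the last test.
  | sum _ t => Polynomial.X * (t.time + 12) + 12

/-- The variables have the values given by `env`. -/
def Stores (s : State) (env : ℕ → ℕ) : Prop := ∀ x, s.reg (2 * x) = env x

/-- The state `s'` agrees with `s` on the scratch registers below `d`. -/
def SameBelow (d : ℕ) (s s' : State) : Prop := ∀ c < d, s'.reg (2 * c + 1) = s.reg (2 * c + 1)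

theorem SameBelow.trans {d : ℕ} {s s' s'' : State} (h : SameBelow d s s') (h' : SameBelow d s' s'') :
    SameBelow d s s'' := fun c hc => (h' c hc).trans (h c hc)

theorem SameBelow.mono {d d' : ℕ} {s s' : State} (h : SameBelow d' s s') (hd : d ≤ d') :
    SameBelow d s s' := fun c hc => h c (hc.trans_le hd)

theorem sameBelow_update (d : ℕ) (s : State) (a : ℕ) :
    SameBelow d s ⟨Function.update s.reg (2 * d + 1) a, s.arr, s.out⟩ := by
  intro c hc
  simp only
  rw [Function.update_of_ne (by omega)]

theorem Stores.update_scratch {s : State} {env : ℕ → ℕ} (h : Stores s env) (d a : ℕ) :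
    Stores ⟨Function.update s.reg (2 * d + 1) a, s.arr, s.out⟩ env := by
  intro x
  simp only
  rw [Function.update_of_ne (by omega)]
  exact h x

theorem Stores.update_var {s : State} {env : ℕ → ℕ} (h : Stores s env) (x a : ℕ) :
    Stores ⟨Function.update s.reg (2 * x) a, s.arr, s.out⟩ (Function.update env x a) := by
  intro y
  by_cases hy : y = x
  · subst hy; simp
  · simp only
    rw [Function.update_of_ne (by omega), Function.update_of_ne hy]
    exact h y

theorem sameBelow_update_var (d : ℕ) (s : State) (x a : ℕ) :
    SameBelow d s ⟨Function.update s.reg (2 * x) a, s.arr, s.out⟩ := by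
  intro c hc
  simp only
  rw [Function.update_of_ne (by omega)]

/-- A loop that increases the variable `x` up to the number of input words, whose body maintains an
invariant, terminates in the time of its rounds. -/
theorem exec_count_loop {inp : List ℕ} {x : ℕ} {p : Prog} {B : ℕ} (I : ℕ → State → Prop)
    (hx : ∀ i s, I i s → s.reg (2 * x) = i)
    (hstep : ∀ i s, i < inp.length → I i s → ∃ s' T, Exec inp p s s' T ∧ T ≤ B ∧ I (i + 1) s') :
    ∀ k i s, i + k = inp.length → I i s →
      ∃ s' T, Exec inp (.loop (.sub .inputLength (.reg (2 * x))) p) s s' T ∧ T ≤ k * (B + 4) + 4 ∧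
        I inp.length s' := by
  intro k
  induction k with
  | zero =>
    intro i s hi hI
    refine ⟨s, _, .loop_false ?_, ?_, ?_⟩
    · simp [Expr.eval, hx i s hI]; omega
    · simp [Expr.cost]
    · rwa [← hi]
  | succ k ih =>
    intro i s hi hI
    obtain ⟨s₁, T₁, h₁, hT₁, hI₁⟩ := hstep i s (by omega) hI
    obtain ⟨s₂, T₂, h₂, hT₂, hI₂⟩ := ih (i + 1) s₁ (by omega) hI₁
    refine ⟨s₂, _, .loop_true ?_ h₁ h₂, ?_, hI₂⟩
    · simp [Expr.eval, hx i s hI]; omega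
    · simp only [Expr.cost]
      have : (k + 1) * (B + 4) = k * (B + 4) + (B + 4) := by ring
      omega

/-- The compiled term computes the value of the term within the time bound, and changes nothing but
scratch registers. -/
theorem Term.exec_code (inp : List ℕ) (t : Term) : ∀ (d : ℕ) (s : State) (env : ℕ → ℕ), Stores s env →
    ∃ s' T, Exec inp (t.code d) s s' T ∧ T ≤ t.time.eval inp.length ∧ s'.out = s.out ∧
      s'.reg (2 * d + 1) = t.eval inp env ∧ Stores s' env ∧ SameBelow d s s' := by
  induction t with
  | const c =>
    intro d s env h
    exact ⟨_, _, .assign _ _ _, by simp [Expr.cost, Term.time], rfl, by simp [Expr.eval, Term.eval],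
      h.update_scratch _ _, sameBelow_update _ _ _⟩
  | var x =>
    intro d s env h
    exact ⟨_, _, .assign _ _ _, by simp [Expr.cost, Term.time], rfl,
      by simp [Expr.eval, Term.eval, h x], h.update_scratch _ _, sameBelow_update _ _ _⟩
  | len =>
    intro d s env h
    exact ⟨_, _, .assign _ _ _, by simp [Expr.cost, Term.time], rfl, by simp [Expr.eval, Term.eval],
      h.update_scratch _ _, sameBelow_update _ _ _⟩
  | input t ih =>
    intro d s env h
    obtain ⟨s₁, T₁, h₁, hT₁, ho₁, hr₁, hs₁, hb₁⟩ := ih d s env h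
    refine ⟨_, _, .seq h₁ (.assign _ _ _), ?_, ho₁, ?_, hs₁.update_scratch _ _,
      hb₁.trans (sameBelow_update _ _ _)⟩
    · simp [Expr.cost, Term.time]; omega
    · simp [Expr.eval, Term.eval, hr₁]
  | add a b iha ihb =>
    intro d s env h
    obtain ⟨s₁, T₁, h₁, hT₁, ho₁, hr₁, hs₁, hb₁⟩ := iha d s env h
    obtain ⟨s₂, T₂, h₂, hT₂, ho₂, hr₂, hs₂, hb₂⟩ := ihb (d + 1) s₁ env hs₁
    refine ⟨_, _, .seq h₁ (.seq h₂ (.assign _ _ _)), ?_, ho₂.trans ho₁, ?_, hs₂.update_scratch _ _,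
      (hb₁.trans (hb₂.mono (by omega))).trans (sameBelow_update _ _ _)⟩
    · simp [Expr.cost, Term.time]; omega
    · simp [Expr.eval, Term.eval, hr₂, hb₂ d (by omega), hr₁]
  | sub a b iha ihb =>
    intro d s env h
    obtain ⟨s₁, T₁, h₁, hT₁, ho₁, hr₁, hs₁, hb₁⟩ := iha d s env h
    obtain ⟨s₂, T₂, h₂, hT₂, ho₂, hr₂, hs₂, hb₂⟩ := ihb (d + 1) s₁ env hs₁
    refine ⟨_, _, .seq h₁ (.seq h₂ (.assign _ _ _)), ?_, ho₂.trans ho₁, ?_, hs₂.update_scratch _ _,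
      (hb₁.trans (hb₂.mono (by omega))).trans (sameBelow_update _ _ _)⟩
    · simp [Expr.cost, Term.time]; omega
    · simp [Expr.eval, Term.eval, hr₂, hb₂ d (by omega), hr₁]
  | ite c a b ihc iha ihb =>
    intro d s env h
    obtain ⟨s₁, T₁, h₁, hT₁, ho₁, hr₁, hs₁, hb₁⟩ := ihc d s env h
    by_cases hc : c.eval inp env = 0
    · obtain ⟨s₂, T₂, h₂, hT₂, ho₂, hr₂, hs₂, hb₂⟩ := ihb d s₁ env hs₁
      refine ⟨_, _, .seq h₁ (.ite_false (by simpa [Expr.eval, hr₁] using hc) h₂), ?_, ho₂.trans ho₁, ?_,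
        hs₂, hb₁.trans hb₂⟩
      · simp [Expr.cost, Term.time]; omega
      · simp [Term.eval, hc, hr₂]
    · obtain ⟨s₂, T₂, h₂, hT₂, ho₂, hr₂, hs₂, hb₂⟩ := iha d s₁ env hs₁
      refine ⟨_, _, .seq h₁ (.ite_true (by simpa [Expr.eval, hr₁] using hc) h₂), ?_, ho₂.trans ho₁, ?_,
        hs₂, hb₁.trans hb₂⟩
      · simp [Expr.cost, Term.time]; omega
      · simp [Term.eval, hc, hr₂]
  | sum x t ih =>
    intro d s env h
    -- The invariant at the start of round `i`: the accumulator holds the partial sum and the outer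
    -- value of `x` is still saved.
    let I : ℕ → State → Prop := fun i s' =>
      s'.out = s.out ∧ Stores s' (Function.update env x i) ∧ SameBelow d s s' ∧
      s'.reg (2 * (d + 1) + 1) = env x ∧
      s'.reg (2 * d + 1) = ∑ j ∈ Finset.range i, t.eval inp (Function.update env x j)
    have hx : ∀ i s', I i s' → s'.reg (2 * x) = i := by
      rintro i s' ⟨-, hs, -⟩
      simpa using hs x
    have hstep : ∀ i s', i < inp.length → I i s' → ∃ s'' T,
        Exec inp (sumBody x d (t.code (d + 2))) s' s'' T ∧ T ≤ t.time.eval inp.length + 8 ∧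
        I (i + 1) s'' := by
      rintro i s' hi ⟨ho, hs, hb, hsave, hacc⟩
      obtain ⟨s₁, T₁, h₁, hT₁, ho₁, hr₁, hs₁, hb₁⟩ := ih (d + 2) s' _ hs
      refine ⟨_, _, .seq h₁ (.seq (.assign _ _ _) (.assign _ _ _)), ?_, ho₁.trans ho, ?_, ?_, ?_, ?_⟩
      · simp only [Expr.cost]; omega
      · have h2 := (hs₁.update_scratch d
          (Expr.eval inp s₁ (.add (.reg (2 * d + 1)) (.reg (2 * (d + 2) + 1))))).update_var x (i + 1)
        have e1 : s₁.reg (2 * x) = i := by simpa using hs₁ x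
        have e2 : (2 * x = 2 * d + 1) = False := by simp; omega
        simpa [Expr.eval, Function.update_apply, e1, e2] using h2
      · exact ((hb.trans (hb₁.mono (by omega))).trans (sameBelow_update _ _ _)).trans
          (sameBelow_update_var _ _ _ _)
      · simp only
        rw [Function.update_of_ne (by omega), Function.update_of_ne (by omega), hb₁ _ (by omega), hsave]
      · simp only
        rw [Function.update_of_ne (by omega), Function.update_self]
        simp only [Expr.eval]
        rw [hb₁ _ (by omega), hacc, hr₁, Finset.sum_range_succ]
    let s₀ : State := ⟨Function.update (Function.update (Function.update s.reg (2 * d + 1) 0)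
      (2 * (d + 1) + 1) (env x)) (2 * x) 0, s.arr, s.out⟩
    have hI₀ : I 0 s₀ := by
      refine ⟨rfl, ((h.update_scratch d 0).update_scratch (d + 1) (env x)).update_var x 0, ?_, ?_, ?_⟩
      · exact ((sameBelow_update d s 0).trans ((sameBelow_update (d + 1) _ (env x)).mono
          (by omega))).trans (sameBelow_update_var _ _ _ _)
      · simp only [s₀]
        rw [Function.update_of_ne (by omega), Function.update_self]
      · simp only [s₀]
        rw [Function.update_of_ne (by omega), Function.update_of_ne (by omega), Function.update_self]
        simp
    obtain ⟨s₁, T₁, h₁, hT₁, ho₁, hs₁, hb₁, hsave₁, hacc₁⟩ :=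
      exec_count_loop I hx hstep inp.length 0 s₀ (by simp) hI₀
    have hs₂ := hs₁.update_var x (env x)
    refine ⟨⟨Function.update s₁.reg (2 * x) (env x), s₁.arr, s₁.out⟩, _,
      .seq (.assign _ _ _) (.seq (.assign _ _ _) (.seq (.assign _ _ _) (.seq (s' := s₁) (T := T₁) (T' := 2)
        ?_ ?_))), ?_,
      ho₁, ?_, ?_, hb₁.trans (sameBelow_update_var _ _ _ _)⟩
    · have : s.reg (2 * x) = env x := h x
      have e2 : (2 * x = 2 * d + 1) = False := by simp; omega
      simpa [Expr.eval, s₀, this, Function.update_apply, e2] using h₁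
    · have := Exec.assign (inp := inp) (2 * x) (.reg (2 * (d + 1) + 1)) s₁
      simpa [Expr.eval, hsave₁, Expr.cost] using this
    · simp only [Expr.cost, Term.time, Polynomial.eval_add, Polynomial.eval_mul, Polynomial.eval_X,
        Polynomial.eval_ofNat]
      have e : inp.length * (Polynomial.eval inp.length t.time + 8 + 4) =
        inp.length * (Polynomial.eval inp.length t.time + 12) := by ring
      omega
    · simp only
      rw [Function.update_of_ne (by omega), hacc₁]
      rfl
    · simpa using hs₂

/-! ### Writers -/

/-- Programs that write words: the only loops run through all indices below the number of input
words. -/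
inductive Writer where
  | emit (t : Term)
  | seq (p q : Writer)
  | guard (c : Term) (p : Writer)
  | each (x : ℕ) (p : Writer)

/-- The words written. -/
def Writer.output (inp : List ℕ) : Writer → (ℕ → ℕ) → List ℕ
  | emit t, env => [t.eval inp env]
  | seq p q, env => p.output inp env ++ q.output inp env
  | guard c p, env => if c.eval inp env ≠ 0 then p.output inp env else []
  | each x p, env => (List.range inp.length).flatMap fun i => p.output inp (Function.update env x i)

/-- The compiled writer; scratch registers are used as for terms. -/
def Writer.code : Writer → ℕ → Prog
  | emit t, d => .seq (t.code d) (.emit (.reg (2 * d + 1)))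
  | seq p q, d => .seq (p.code d) (q.code d)
  | guard c p, d => .seq (c.code d) (.ite (.reg (2 * d + 1)) (p.code d) .skip)
  | each x p, d => .seq (.assign (2 * d + 1) (.reg (2 * x))) (.seq (.assign (2 * x) (.const 0))
      (.seq (.loop (.sub .inputLength (.reg (2 * x))) (.seq (p.code (d + 1))
        (.assign (2 * x) (.add (.reg (2 * x)) (.const 1))))) (.assign (2 * x) (.reg (2 * d + 1)))))

/-- A bound on the running time of the compiled writer. -/
noncomputable def Writer.time : Writer → Polynomial ℕ
  | emit t => t.time + 2
  | seq p q => p.time + q.time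
  | guard c p => c.time + p.time + 3
  | each _ p => Polynomial.X * (p.time + 8) + 10

/-- The compiled writer appends the words of the writer to the output within the time bound. -/
theorem Writer.exec_code (inp : List ℕ) (p : Writer) : ∀ (d : ℕ) (s : State) (env : ℕ → ℕ),
    Stores s env → ∃ s' T, Exec inp (p.code d) s s' T ∧ T ≤ p.time.eval inp.length ∧
      s'.out = s.out ++ p.output inp env ∧ Stores s' env ∧ SameBelow d s s' := by
  induction p with
  | emit t =>
    intro d s env h
    obtain ⟨s₁, T₁, h₁, hT₁, ho₁, hr₁, hs₁, hb₁⟩ := t.exec_code inp d s env h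
    refine ⟨_, _, .seq h₁ (.emit _ _), ?_, ?_, hs₁, hb₁⟩
    · simp [Expr.cost, Writer.time]; omega
    · simp [Expr.eval, Writer.output, ho₁, hr₁]
  | seq p q ihp ihq =>
    intro d s env h
    obtain ⟨s₁, T₁, h₁, hT₁, ho₁, hs₁, hb₁⟩ := ihp d s env h
    obtain ⟨s₂, T₂, h₂, hT₂, ho₂, hs₂, hb₂⟩ := ihq d s₁ env hs₁
    refine ⟨_, _, .seq h₁ h₂, ?_, ?_, hs₂, hb₁.trans hb₂⟩
    · simp [Writer.time]; omega
    · simp [Writer.output, ho₂, ho₁]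
  | guard c p ih =>
    intro d s env h
    obtain ⟨s₁, T₁, h₁, hT₁, ho₁, hr₁, hs₁, hb₁⟩ := c.exec_code inp d s env h
    by_cases hc : c.eval inp env = 0
    · refine ⟨_, _, .seq h₁ (.ite_false (by simpa [Expr.eval, hr₁] using hc) (.skip _)), ?_, ?_, hs₁, hb₁⟩
      · simp [Expr.cost, Writer.time]; omega
      · simp [Writer.output, hc, ho₁]
    · obtain ⟨s₂, T₂, h₂, hT₂, ho₂, hs₂, hb₂⟩ := ih d s₁ env hs₁
      refine ⟨_, _, .seq h₁ (.ite_true (by simpa [Expr.eval, hr₁] using hc) h₂), ?_, ?_, hs₂,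
        hb₁.trans hb₂⟩
      · simp [Expr.cost, Writer.time]; omega
      · simp [Writer.output, hc, ho₂, ho₁]
  | each x p ih =>
    intro d s env h
    let I : ℕ → State → Prop := fun i s' =>
      s'.out = s.out ++ (List.range i).flatMap (fun j => p.output inp (Function.update env x j)) ∧
      Stores s' (Function.update env x i) ∧ SameBelow d s s' ∧ s'.reg (2 * d + 1) = env x
    have hx : ∀ i s', I i s' → s'.reg (2 * x) = i := by
      rintro i s' ⟨-, hs, -⟩
      simpa using hs x
    have hstep : ∀ i s', i < inp.length → I i s' → ∃ s'' T,
        Exec inp (.seq (p.code (d + 1)) (.assign (2 * x) (.add (.reg (2 * x)) (.const 1)))) s' s'' T ∧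
        T ≤ p.time.eval inp.length + 4 ∧ I (i + 1) s'' := by
      rintro i s' hi ⟨ho, hs, hb, hsave⟩
      obtain ⟨s₁, T₁, h₁, hT₁, ho₁, hs₁, hb₁⟩ := ih (d + 1) s' _ hs
      refine ⟨_, _, .seq h₁ (.assign _ _ _), ?_, ?_, ?_, ?_, ?_⟩
      · simp only [Expr.cost]; omega
      · simp [ho₁, ho, List.range_succ]
      · have h2 := hs₁.update_var x (i + 1)
        have e1 : s₁.reg (2 * x) = i := by simpa using hs₁ x
        simpa [Expr.eval, e1] using h2
      · exact (hb.trans (hb₁.mono (by omega))).trans (sameBelow_update_var _ _ _ _)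
      · simp only
        rw [Function.update_of_ne (by omega), hb₁ _ (by omega), hsave]
    let s₀ : State := ⟨Function.update (Function.update s.reg (2 * d + 1) (env x)) (2 * x) 0,
      s.arr, s.out⟩
    have hI₀ : I 0 s₀ := by
      refine ⟨by simp [s₀], (h.update_scratch d (env x)).update_var x 0, ?_, ?_⟩
      · exact (sameBelow_update d s (env x)).trans (sameBelow_update_var _ _ _ _)
      · simp only [s₀]
        rw [Function.update_of_ne (by omega), Function.update_self]
    obtain ⟨s₁, T₁, h₁, hT₁, ho₁, hs₁, hb₁, hsave₁⟩ :=
      exec_count_loop I hx hstep inp.length 0 s₀ (by simp) hI₀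
    have hs₂ := hs₁.update_var x (env x)
    refine ⟨⟨Function.update s₁.reg (2 * x) (env x), s₁.arr, s₁.out⟩, _,
      .seq (.assign _ _ _) (.seq (.assign _ _ _) (.seq (s' := s₁) (T := T₁) (T' := 2) ?_ ?_)), ?_,
      ho₁, ?_, hb₁.trans (sameBelow_update_var _ _ _ _)⟩
    · have : s.reg (2 * x) = env x := h x
      simpa [Expr.eval, s₀, this] using h₁
    · have := Exec.assign (inp := inp) (2 * x) (.reg (2 * d + 1)) s₁
      simpa [Expr.eval, hsave₁, Expr.cost] using this
    · simp only [Expr.cost, Writer.time, Polynomial.eval_add, Polynomial.eval_mul, Polynomial.eval_X,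
        Polynomial.eval_ofNat]
      have e : inp.length * (Polynomial.eval inp.length p.time + 4 + 4) =
        inp.length * (Polynomial.eval inp.length p.time + 8) := by ring
      omega
    · simpa using hs₂

theorem eval_mono (q : Polynomial ℕ) {a b : ℕ} (h : a ≤ b) : q.eval a ≤ q.eval b := by
  rw [Polynomial.eval_eq_sum, Polynomial.eval_eq_sum]
  exact Finset.sum_le_sum fun i _ => Nat.mul_le_mul_left _ (Nat.pow_le_pow_left h i)

/-- Loops are bounded by the number of words, whereas running time is measured in bits; each word
contributes at least its separator. -/
theorem length_le_bitSize (l : List ℕ) : l.length ≤ bitSize l := by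
  induction l with
  | nil => simp [bitSize]
  | cons a l ih =>
    simp only [bitSize, List.map_cons, List.sum_cons, List.length_cons] at ih ⊢
    omega

/-- From the initial state, the compiled writer produces its words in polynomial time. -/
theorem Writer.exec_init (p : Writer) (inp : List ℕ) :
    ∃ s T, Exec inp (p.code 0) State.init s T ∧ T ≤ p.time.eval (bitSize inp) ∧
      s.out = p.output inp (fun _ => 0) := by
  obtain ⟨s, T, h, hT, ho, -, -⟩ := p.exec_code inp 0 State.init (fun _ => 0) (fun _ => rfl)
  exact ⟨s, T, h, hT.trans (eval_mono _ (length_le_bitSize inp)), by simpa [State.init] using ho⟩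

/-! ### Terms with anonymous bound variables -/

/-- A term that may be used below any number `d` of binders; its own binders are numbered from `d`. -/
abbrev Tm := ℕ → Term

/-- An assignment of values to the first `w.2` variables. -/
abbrev World := (ℕ → ℕ) × ℕ

/-- The world `w'` extends `w`. -/
def World.Le (w w' : World) : Prop := w.2 ≤ w'.2 ∧ ∀ x < w.2, w'.1 x = w.1 x

theorem World.Le.refl (w : World) : w.Le w := ⟨le_rfl, fun _ _ => rfl⟩

theorem World.Le.trans {w w' w'' : World} (h : w.Le w') (h' : w'.Le w'') : w.Le w'' :=
  ⟨h.1.trans h'.1, fun x hx => (h'.2 x (hx.trans_le h.1)).trans (h.2 x hx)⟩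

/-- In all extensions of the world `w`, the term `t` has the value `a`. -/
def Val (inp : List ℕ) (w : World) (t : Tm) (a : ℕ) : Prop :=
  ∀ w' : World, w.Le w' → (t w'.2).eval inp w'.1 = a

/-- In all extensions of the world `w`, the term `t` is nonzero if and only if `P` holds. -/
def Holds (inp : List ℕ) (w : World) (t : Tm) (P : Prop) : Prop := ∃ a, Val inp w t a ∧ (a ≠ 0 ↔ P)

variable {inp : List ℕ} {w w' : World}

theorem Val.mono {t : Tm} {a : ℕ} (h : Val inp w t a) (hw : w.Le w') : Val inp w' t a :=
  fun w'' hw' => h w'' (hw.trans hw')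

theorem Holds.mono {t : Tm} {P : Prop} (h : Holds inp w t P) (hw : w.Le w') : Holds inp w' t P :=
  let ⟨a, ha, hP⟩ := h; ⟨a, ha.mono hw, hP⟩

theorem Holds.congr {t : Tm} {P Q : Prop} (h : Holds inp w t P) (hPQ : P ↔ Q) : Holds inp w t Q :=
  let ⟨a, ha, hP⟩ := h; ⟨a, ha, hP.trans hPQ⟩

theorem Val.congr {t : Tm} {a b : ℕ} (h : Val inp w t a) (hab : a = b) : Val inp w t b := hab ▸ h

namespace Tm

def const (c : ℕ) : Tm := fun _ => .const c
def input (t : Tm) : Tm := fun d => .input (t d)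
def add (a b : Tm) : Tm := fun d => .add (a d) (b d)
def sub (a b : Tm) : Tm := fun d => .sub (a d) (b d)
def ite (c a b : Tm) : Tm := fun d => .ite (c d) (a d) (b d)
-- The binder takes the current depth as its name and its body is placed one level deeper, so no
-- variable in use is captured.
def sum (f : Tm → Tm) : Tm := fun d => .sum d (f (fun _ => .var d) (d + 1))
def lt (a b : Tm) : Tm := sub b a
def not (a : Tm) : Tm := ite a (const 0) (const 1)
def and (a b : Tm) : Tm := ite a b (const 0)
def or (a b : Tm) : Tm := ite a (const 1) b
def iff (a b : Tm) : Tm := ite a b (not b)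
def imp (a b : Tm) : Tm := ite a b (const 1)
def le (a b : Tm) : Tm := not (lt b a)
def eq (a b : Tm) : Tm := and (le a b) (le b a)
-- The underlying loop always runs through the input length and a guard cuts it off at `n`.
-- Correctness therefore needs `n` to be at most the input length.
def sumLt (n : Tm) (f : Tm → Tm) : Tm := sum fun x => ite (lt x n) (f x) (const 0)
def exLt (n : Tm) (f : Tm → Tm) : Tm := sumLt n fun x => ite (f x) (const 1) (const 0)
def allLt (n : Tm) (f : Tm → Tm) : Tm := not (exLt n fun x => not (f x))

end Tm

/-! ### Evaluation of terms in extending worlds -/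

theorem val_const (c : ℕ) : Val inp w (Tm.const c) c := fun _ _ => rfl

theorem val_input {t : Tm} {a : ℕ} (h : Val inp w t a) : Val inp w (Tm.input t) (inp.getD a 0) :=
  fun w' hw => by simp only [Tm.input, Term.eval, h w' hw]

theorem val_add {t u : Tm} {a b : ℕ} (h : Val inp w t a) (h' : Val inp w u b) :
    Val inp w (Tm.add t u) (a + b) :=
  fun w' hw => by simp only [Tm.add, Term.eval, h w' hw, h' w' hw]

theorem val_sub {t u : Tm} {a b : ℕ} (h : Val inp w t a) (h' : Val inp w u b) :
    Val inp w (Tm.sub t u) (a - b) :=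
  fun w' hw => by simp only [Tm.sub, Term.eval, h w' hw, h' w' hw]

theorem val_ite {c t u : Tm} {P : Prop} {dP : Decidable P} {a b : ℕ} (hc : Holds inp w c P) (h : Val inp w t a)
    (h' : Val inp w u b) : Val inp w (Tm.ite c t u) (if P then a else b) := by
  intro w' hw
  obtain ⟨x, hx, hP⟩ := hc
  simp only [Tm.ite, Term.eval, h w' hw, h' w' hw, hx w' hw, hP]

/-- Stability under extension of worlds is what handles binders: giving the fresh variable the value
`i` extends the world, and in all further extensions the variable keeps this value. -/
theorem val_sum {f : Tm → Tm} {g : ℕ → ℕ}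
    (h : ∀ w', w.Le w' → ∀ q i, i < inp.length → Val inp w' q i → Val inp w' (f q) (g i)) :
    Val inp w (Tm.sum f) (∑ i ∈ Finset.range inp.length, g i) := by
  intro w' hw
  simp only [Tm.sum, Term.eval]
  refine Finset.sum_congr rfl fun i hi => ?_
  have hw' : w'.Le (Function.update w'.1 w'.2 i, w'.2 + 1) :=
    ⟨Nat.le_succ _, fun x hx => Function.update_of_ne hx.ne _ _⟩
  refine h (Function.update w'.1 w'.2 i, w'.2 + 1) (hw.trans hw') (fun _ => .var w'.2) i
    (Finset.mem_range.1 hi) ?_ _ (World.Le.refl _)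
  intro w'' hw''
  simpa [Term.eval] using hw''.2 w'.2 (Nat.lt_succ_self _)

theorem holds_of_val {t : Tm} {a : ℕ} (h : Val inp w t a) : Holds inp w t (a ≠ 0) := ⟨a, h, Iff.rfl⟩

theorem holds_lt {t u : Tm} {a b : ℕ} (h : Val inp w t a) (h' : Val inp w u b) :
    Holds inp w (Tm.lt t u) (a < b) := ⟨_, val_sub h' h, by omega⟩

open Classical in
theorem holds_ite {c t u : Tm} {P Q R : Prop} (hc : Holds inp w c P) (h : Holds inp w t Q)
    (h' : Holds inp w u R) : Holds inp w (Tm.ite c t u) (if P then Q else R) := by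
  obtain ⟨a, ha, hQ⟩ := h
  obtain ⟨b, hb, hR⟩ := h'
  refine ⟨_, val_ite (dP := Classical.dec P) hc ha hb, ?_⟩
  split_ifs <;> assumption

theorem holds_not {t : Tm} {P : Prop} (h : Holds inp w t P) : Holds inp w (Tm.not t) (¬ P) := by
  classical
  refine (holds_ite h (holds_of_val (val_const 0)) (holds_of_val (val_const 1))).congr ?_
  split_ifs <;> simp_all

theorem holds_and {t u : Tm} {P Q : Prop} (h : Holds inp w t P) (h' : Holds inp w u Q) :
    Holds inp w (Tm.and t u) (P ∧ Q) := by
  classical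
  refine (holds_ite h h' (holds_of_val (val_const 0))).congr ?_
  split_ifs <;> simp_all

theorem holds_or {t u : Tm} {P Q : Prop} (h : Holds inp w t P) (h' : Holds inp w u Q) :
    Holds inp w (Tm.or t u) (P ∨ Q) := by
  classical
  refine (holds_ite h (holds_of_val (val_const 1)) h').congr ?_
  split_ifs <;> simp_all

theorem holds_iff {t u : Tm} {P Q : Prop} (h : Holds inp w t P) (h' : Holds inp w u Q) :
    Holds inp w (Tm.iff t u) (P ↔ Q) := by
  classical
  refine (holds_ite h h' (holds_not h')).congr ?_
  split_ifs <;> simp_all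

theorem holds_imp {t u : Tm} {P Q : Prop} (h : Holds inp w t P) (h' : Holds inp w u Q) :
    Holds inp w (Tm.imp t u) (P → Q) := by
  classical
  refine (holds_ite h h' (holds_of_val (val_const 1))).congr ?_
  split_ifs <;> simp_all

theorem holds_le {t u : Tm} {a b : ℕ} (h : Val inp w t a) (h' : Val inp w u b) :
    Holds inp w (Tm.le t u) (a ≤ b) := (holds_not (holds_lt h' h)).congr not_lt

theorem holds_eq {t u : Tm} {a b : ℕ} (h : Val inp w t a) (h' : Val inp w u b) :
    Holds inp w (Tm.eq t u) (a = b) :=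
  (holds_and (holds_le h h') (holds_le h' h)).congr le_antisymm_iff.symm

theorem val_sumLt {n : Tm} {b : ℕ} {f : Tm → Tm} {g : ℕ → ℕ} (hn : Val inp w n b)
    (hb : b ≤ inp.length)
    (h : ∀ w', w.Le w' → ∀ q i, i < b → Val inp w' q i → Val inp w' (f q) (g i)) :
    Val inp w (Tm.sumLt n f) (∑ i ∈ Finset.range b, g i) := by
  classical
  have hs : Val inp w (Tm.sumLt n f)
      (∑ i ∈ Finset.range inp.length, if i < b then g i else 0) := by
    refine val_sum fun w' hw q i hi hq w'' hw' => ?_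
    by_cases hib : i < b
    · exact val_ite (holds_lt hq (hn.mono hw)) (h w' hw q i hib hq) (val_const 0) w'' hw'
    -- Beyond `b` nothing is known about `f q`, so `val_ite` is not available; the guard evaluates
    -- to zero and the summand is never read.
    · have h1 := hq w'' hw'
      have h2 := hn w'' (hw.trans hw')
      simp [Tm.ite, Tm.lt, Tm.sub, Tm.const, Term.eval, h1, h2, hib, Nat.sub_eq_zero_of_le (not_lt.1 hib)]
  refine hs.congr ?_
  rw [← Finset.sum_filter]
  congr 1
  ext i
  simp only [Finset.mem_filter, Finset.mem_range]
  omega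

theorem holds_exLt {n : Tm} {b : ℕ} {f : Tm → Tm} {P : ℕ → Prop} (hn : Val inp w n b)
    (hb : b ≤ inp.length)
    (h : ∀ w', w.Le w' → ∀ q i, i < b → Val inp w' q i → Holds inp w' (f q) (P i)) :
    Holds inp w (Tm.exLt n f) (∃ i < b, P i) := by
  classical
  refine (holds_of_val (val_sumLt hn hb fun w' hw q i hi hq =>
    val_ite (dP := Classical.dec _) (h w' hw q i hi hq) (val_const 1) (val_const 0))).congr ?_
  simp

theorem holds_allLt {n : Tm} {b : ℕ} {f : Tm → Tm} {P : ℕ → Prop} (hn : Val inp w n b)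
    (hb : b ≤ inp.length)
    (h : ∀ w', w.Le w' → ∀ q i, i < b → Val inp w' q i → Holds inp w' (f q) (P i)) :
    Holds inp w (Tm.allLt n f) (∀ i < b, P i) := by
  refine (holds_not (holds_exLt hn hb fun w' hw q i hi hq => holds_not (h w' hw q i hi hq))).congr ?_
  push Not
  rfl

theorem val_sumFin {n : Tm} {b : ℕ} {f : Tm → Tm} {g : Fin b → ℕ} (hn : Val inp w n b)
    (hb : b ≤ inp.length)
    (h : ∀ w', w.Le w' → ∀ q (i : Fin b), Val inp w' q i → Val inp w' (f q) (g i)) :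
    Val inp w (Tm.sumLt n f) (∑ i, g i) := by
  refine (val_sumLt (g := fun i => if hi : i < b then g ⟨i, hi⟩ else 0) hn hb
    fun w' hw q i hi hq => ?_).congr ?_
  · simpa [hi] using h w' hw q ⟨i, hi⟩ hq
  · rw [Finset.sum_range]
    simp

theorem holds_exFin {n : Tm} {b : ℕ} {f : Tm → Tm} {P : Fin b → Prop} (hn : Val inp w n b)
    (hb : b ≤ inp.length)
    (h : ∀ w', w.Le w' → ∀ q (i : Fin b), Val inp w' q i → Holds inp w' (f q) (P i)) :
    Holds inp w (Tm.exLt n f) (∃ i, P i) := by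
  refine (holds_exLt (P := fun i => ∃ hi : i < b, P ⟨i, hi⟩) hn hb fun w' hw q i hi hq => ?_).congr ?_
  · exact (h w' hw q ⟨i, hi⟩ hq).congr ⟨fun h => ⟨hi, h⟩, fun ⟨_, h⟩ => h⟩
  · exact ⟨fun ⟨i, _, hi, h⟩ => ⟨⟨i, hi⟩, h⟩, fun ⟨i, h⟩ => ⟨i, i.2, i.2, h⟩⟩

theorem holds_allFin {n : Tm} {b : ℕ} {f : Tm → Tm} {P : Fin b → Prop} (hn : Val inp w n b)
    (hb : b ≤ inp.length)
    (h : ∀ w', w.Le w' → ∀ q (i : Fin b), Val inp w' q i → Holds inp w' (f q) (P i)) :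
    Holds inp w (Tm.allLt n f) (∀ i, P i) := by
  refine (holds_not (holds_exFin hn hb fun w' hw q i hq => holds_not (h w' hw q i hq))).congr ?_
  push Not
  rfl

/-! ### Writers with anonymous bound variables -/

/-- A writer that may be used below any number of binders. -/
abbrev Wr := ℕ → Writer

/-- In all extensions of the world `w`, the writer `p` writes the words `l`. -/
def Writes (inp : List ℕ) (w : World) (p : Wr) (l : List ℕ) : Prop :=
  ∀ w' : World, w.Le w' → (p w'.2).output inp w'.1 = l

namespace Wr

def emit (t : Tm) : Wr := fun d => .emit (t d)
def seq (p q : Wr) : Wr := fun d => .seq (p d) (q d)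
def guard (c : Tm) (p : Wr) : Wr := fun d => .guard (c d) (p d)
def each (f : Tm → Wr) : Wr := fun d => .each d (f (fun _ => .var d) (d + 1))

end Wr

theorem writes_emit {t : Tm} {a : ℕ} (h : Val inp w t a) : Writes inp w (Wr.emit t) [a] :=
  fun w' hw => by simp only [Wr.emit, Writer.output, h w' hw]

theorem writes_seq {p q : Wr} {l l' : List ℕ} (h : Writes inp w p l) (h' : Writes inp w q l') :
    Writes inp w (Wr.seq p q) (l ++ l') :=
  fun w' hw => by simp only [Wr.seq, Writer.output, h w' hw, h' w' hw]

theorem writes_guard {c : Tm} {p : Wr} {P : Prop} {dP : Decidable P} {l : List ℕ} (hc : Holds inp w c P)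
    (h : P → Writes inp w p l) : Writes inp w (Wr.guard c p) (if P then l else []) := by
  intro w' hw
  obtain ⟨x, hx, hP⟩ := hc
  simp only [Wr.guard, Writer.output, hx w' hw, hP]
  split_ifs with h1
  · exact h h1 w' hw
  · rfl

theorem writes_each {f : Tm → Wr} {g : ℕ → List ℕ}
    (h : ∀ w', w.Le w' → ∀ q i, i < inp.length → Val inp w' q i → Writes inp w' (f q) (g i)) :
    Writes inp w (Wr.each f) ((List.range inp.length).flatMap g) := by
  intro w' hw
  simp only [Wr.each, Writer.output]
  refine List.flatMap_congr fun i hi => ?_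
  have hw' : w'.Le (Function.update w'.1 w'.2 i, w'.2 + 1) :=
    ⟨Nat.le_succ _, fun x hx => Function.update_of_ne hx.ne _ _⟩
  refine h (Function.update w'.1 w'.2 i, w'.2 + 1) (hw.trans hw') (fun _ => .var w'.2) i
    (List.mem_range.1 hi) ?_ _ (World.Le.refl _)
  intro w'' hw''
  simpa [Term.eval] using hw''.2 w'.2 (Nat.lt_succ_self _)

end RAM

/-! ### Path models -/

/-- The combinatorial content of a representation by vertex sets of a subdivision: there are `n` sets
and `m` subdivided edges, the path of the edge `e` has the positions `0, …, len e + 1`, and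
`mem v e i` says that the `i`-th vertex of the path of `e` belongs to the `v`-th set. Sets that meet
no edge are told apart by `tag`. -/
structure PathModel (n m : ℕ) where
  len : Fin m → ℕ
  mem : Fin n → Fin m → ℕ → Prop
  tag : Fin n → ℕ

namespace PathModel

variable {n m : ℕ} (D : PathModel n m)

/-- Membership with positions counted from one of the two ends of an edge. -/
def side (v : Fin n) (h : Fin m × Bool) (j : ℕ) : Prop :=
  D.mem v h.1 (if h.2 then D.len h.1 + 1 - j else j)

/-- The set of `v` contains an end of an edge. -/
def Branch (v : Fin n) : Prop := ∃ e, D.side v (e, false) 0 ∨ D.side v (e, true) 0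

open Classical in
/-- The number of internal positions that can be reached from an end of an edge within the set of `v`
if `v` is a branch vertex, and within its complement otherwise. -/
noncomputable def run (v : Fin n) (h : Fin m × Bool) : ℕ :=
  ((Finset.range (D.len h.1)).filter fun i => ∀ j < i + 2, (D.side v h j ↔ D.Branch v)).card

/-- The path of `e` lies in the set of `v` if `v` is a branch vertex, and avoids it otherwise. -/
def Full (v : Fin n) (e : Fin m) : Prop := ∀ j < D.len e + 2, (D.mem v e j ↔ D.Branch v)

/-- Finitely many types exist, and inside a type the runs are comparable: common ends and common
full paths are what the trapping argument behind `Represents.single` needs. -/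
def SameType (u v : Fin n) : Prop :=
  ∀ e, (D.side u (e, false) 0 ↔ D.side v (e, false) 0) ∧ (D.side u (e, true) 0 ↔ D.side v (e, true) 0) ∧
    (D.Full u e ↔ D.Full v e)

/-- `r` is the first vertex of the type of `v`. -/
def IsFirst (r v : Fin n) : Prop := D.SameType r v ∧ ∀ x, x < r → ¬ D.SameType x v

/-- On the edge `e`, the vertex `v` differs from the first vertex of its type. -/
def Differs (v : Fin n) (e : Fin m) : Prop :=
  ∃ r, D.IsFirst r v ∧ (D.run v (e, false) ≠ D.run r (e, false) ∨ D.run v (e, true) ≠ D.run r (e, true))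

/-- The refinement by differing edges leaves only two varying runs. Vertices that are not branch
vertices need none, since their sets meet at most one edge. -/
def SameClass (u v : Fin n) : Prop :=
  D.SameType u v ∧ (D.Branch u → ∀ e, D.Differs u e ↔ D.Differs v e)

/-- `r` is the first vertex of its class. -/
def Leads (r : Fin n) : Prop := ∀ x, x < r → ¬ D.SameClass x r

open Classical in
/-- The number of the class of `v`. -/
noncomputable def cls (v : Fin n) : ℕ :=
  (Finset.univ.filter fun r => D.Leads r ∧ ∀ r', r' ≤ r → ¬ D.SameClass r' v).card

/-- The run at `h` is not constant on the class of `v`. -/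
def Varies (v : Fin n) (h : Fin m × Bool) : Prop := ∃ v', D.SameClass v' v ∧ D.run v' h ≠ D.run v h

/-- A numbering of the half-edges. -/
def rank (h : Fin m × Bool) : ℕ := (h.1 + h.1 : ℕ) + if h.2 then 1 else 0

/-- `h` is the first half-edge that varies on the class of `v`. -/
def Leading (v : Fin n) (h : Fin m × Bool) : Prop :=
  D.Varies v h ∧ ∀ e, (rank (e, false) < rank h → ¬ D.Varies v (e, false)) ∧
    (rank (e, true) < rank h → ¬ D.Varies v (e, true))

/-- The set of `v` meets no edge. -/
def Degenerate (v : Fin n) : Prop := ¬ D.Branch v ∧ ∀ e, D.Full v e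

open Classical in
/-- The contribution of a half-edge to the sorting key. -/
noncomputable def weight (v : Fin n) (h : Fin m × Bool) : ℕ :=
  if D.Leading v h then D.run v h else D.len h.1 - D.run v h

open Classical in
/-- The key by which the vertices of a class are sorted. -/
noncomputable def key (v : Fin n) : ℕ :=
  if D.Degenerate v then D.tag v else ∑ e, (D.weight v (e, false) + D.weight v (e, true))

/-- The sorting order of the classes. -/
def Lo (u v : Fin n) : Prop := D.key u < D.key v ∨ D.key u = D.key v ∧ u < v

/-- The sets of `u` and `v` meet on some edge. -/
def Meets (u v : Fin n) : Prop := ∃ e, ∃ i < D.len e + 2, D.mem u e i ∧ D.mem v e i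

/-- The properties of a path model that come from a non-crossing representation of `G`. -/
structure Represents (G : SimpleGraph (Fin n)) : Prop where
  adj_iff : ∀ u v, u ≠ v → (G.Adj u v ↔
    D.Meets u v ∨ D.Degenerate u ∧ D.Degenerate v ∧ D.tag u = D.tag v ∧ D.tag u ≠ 0)
  prefix_or_suffix : ∀ v e i, D.Branch v → i < D.len e + 2 → D.mem v e i →
    (∀ j ≤ i, D.mem v e j) ∨ ∀ j, i ≤ j → j < D.len e + 2 → D.mem v e j
  edge_unique : ∀ v e i e' i', ¬ D.Branch v → i < D.len e + 2 → i' < D.len e' + 2 →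
    D.mem v e i → D.mem v e' i' → e = e'
  convex : ∀ v e i j k, ¬ D.Branch v → i ≤ j → j ≤ k → k < D.len e + 2 →
    D.mem v e i → D.mem v e k → D.mem v e j
  single : ∀ u v h h', D.SameType u v → D.run v h < D.run u h → D.run v h' < D.run u h' → h = h'

variable {D}

/-! ### Runs and positions -/

theorem run_le (v : Fin n) (h : Fin m × Bool) : D.run v h ≤ D.len h.1 := by
  classical
  exact (Finset.card_filter_le _ _).trans (by simp)

/-- The run is the size of a downward closed set of indices, in which the index `a` stands for the
internal position `a + 1` together with everything before it, the end included. For `i = 0` the left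
side would hold trivially while the right side speaks about the end. -/
theorem le_run_iff {v : Fin n} {h : Fin m × Bool} {i : ℕ} (h1 : 1 ≤ i) (hi : i ≤ D.len h.1) :
    i ≤ D.run v h ↔ ∀ j ≤ i, (D.side v h j ↔ D.Branch v) := by
  classical
  have hdown : ∀ a b, a ≤ b → (∀ j < b + 2, (D.side v h j ↔ D.Branch v)) →
    ∀ j < a + 2, (D.side v h j ↔ D.Branch v) := fun a b hab hb j hj => hb j (by omega)
  constructor
  · intro hr
    by_contra hcon
    have : D.run v h ≤ i - 1 := by
      unfold run
      calc _ ≤ (Finset.range (i - 1)).card := by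
            refine Finset.card_le_card fun a ha => ?_
            simp only [Finset.mem_filter, Finset.mem_range] at ha ⊢
            by_contra hai
            exact hcon fun j hj => ha.2 j (by omega)
        _ = i - 1 := by simp
    omega
  · intro hr
    unfold run
    calc i = (Finset.range i).card := by simp
      _ ≤ _ := by
        refine Finset.card_le_card fun a ha => ?_
        simp only [Finset.mem_filter, Finset.mem_range] at ha ⊢
        exact ⟨by omega, fun j hj => hr j (by omega)⟩

/-- Just beyond the run, membership changes. -/
theorem not_side_run {v : Fin n} {h : Fin m × Bool} (h0 : D.side v h 0 ↔ D.Branch v)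
    (hl : D.run v h < D.len h.1) : ¬ (D.side v h (D.run v h + 1) ↔ D.Branch v) := by
  intro hc
  have : D.run v h + 1 ≤ D.run v h := by
    rw [le_run_iff (by omega) (by omega)]
    intro j hj
    rcases Nat.eq_zero_or_pos j with rfl | hj0
    · exact h0
    · rcases Nat.lt_or_ge j (D.run v h + 1) with hlt | hge
      · exact (le_run_iff (v := v) (h := h) (i := j) hj0 (by omega)).1 (by omega) j le_rfl
      · obtain rfl : j = D.run v h + 1 := by omega
        exact hc
  omega

theorem side_zero_false {v : Fin n} (hv : ¬ D.Branch v) (h : Fin m × Bool) : ¬ D.side v h 0 := by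
  rcases h with ⟨e, _ | _⟩
  · exact fun h => hv ⟨e, Or.inl h⟩
  · exact fun h => hv ⟨e, Or.inr h⟩

theorem side_mirror {v : Fin n} {e : Fin m} {s : Bool} {j : ℕ} (hj : j < D.len e + 2) :
    D.side v (e, !s) (D.len e + 1 - j) ↔ D.side v (e, s) j := by
  cases s <;> simp [side]
  rw [show D.len e + 1 - (D.len e + 1 - j) = j by omega]

theorem exists_side {v : Fin n} {e : Fin m} (s : Bool) {i : ℕ} (hi : i < D.len e + 2)
    (hv : D.mem v e i) : D.side v (e, s) (if s then D.len e + 1 - i else i) := by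
  cases s
  · simpa [side] using hv
  · simpa [side, show D.len e + 1 - (D.len e + 1 - i) = i by omega] using hv

theorem Full.run_eq {v : Fin n} {e : Fin m} (h : D.Full v e) (s : Bool) : D.run v (e, s) = D.len e := by
  refine le_antisymm (run_le _ _) ?_
  rcases Nat.eq_zero_or_pos (D.len e) with h0 | h0
  · omega
  · rw [le_run_iff h0 le_rfl]
    intro j hj
    change D.mem _ _ _ ↔ _
    apply h
    cases s <;> simp <;> omega

/-! #### Types and classes -/

theorem SameType.symm {u v : Fin n} (h : D.SameType u v) : D.SameType v u :=
  fun e => ⟨(h e).1.symm, (h e).2.1.symm, (h e).2.2.symm⟩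

theorem SameType.refl (v : Fin n) : D.SameType v v := fun _ => ⟨Iff.rfl, Iff.rfl, Iff.rfl⟩

theorem SameType.trans {u v w : Fin n} (h : D.SameType u v) (h' : D.SameType v w) : D.SameType u w :=
  fun e => ⟨(h e).1.trans (h' e).1, (h e).2.1.trans (h' e).2.1, (h e).2.2.trans (h' e).2.2⟩

theorem SameType.branch_iff {u v : Fin n} (h : D.SameType u v) : D.Branch u ↔ D.Branch v :=
  exists_congr fun e => or_congr (h e).1 (h e).2.1

theorem SameType.side_zero_iff {u v : Fin n} (h : D.SameType u v) (g : Fin m × Bool) :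
    D.side u g 0 ↔ D.side v g 0 := by
  rcases g with ⟨e, _ | _⟩
  · exact (h e).1
  · exact (h e).2.1

theorem SameClass.refl (v : Fin n) : D.SameClass v v := ⟨.refl v, fun _ _ => Iff.rfl⟩

theorem SameClass.symm {u v : Fin n} (h : D.SameClass u v) : D.SameClass v u :=
  ⟨h.1.symm, fun hv e => (h.2 (h.1.branch_iff.2 hv) e).symm⟩

theorem SameClass.trans {u v w : Fin n} (h : D.SameClass u v) (h' : D.SameClass v w) : D.SameClass u w :=
  ⟨h.1.trans h'.1, fun hu e => (h.2 hu e).trans (h'.2 (h.1.branch_iff.1 hu) e)⟩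

theorem exists_isFirst (v : Fin n) : ∃ r, D.IsFirst r v := by
  have := wellFounded_lt.has_min {r : Fin n | D.SameType r v} ⟨v, .refl v⟩
  obtain ⟨r, hr, hmin⟩ := this
  exact ⟨r, hr, fun r' hr' h => hmin r' h hr'⟩

theorem IsFirst.unique {r r' v : Fin n} (h : D.IsFirst r v) (h' : D.IsFirst r' v) : r = r' := by
  rcases lt_trichotomy r r' with hl | he | hl
  · exact absurd h.1 (h'.2 r hl)
  · exact he
  · exact absurd h'.1 (h.2 r' hl)

theorem IsFirst.congr {r u v : Fin n} (h : D.IsFirst r v) (huv : D.SameType u v) : D.IsFirst r u :=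
  ⟨h.1.trans huv.symm, fun r' hr' h' => h.2 r' hr' (h'.trans huv)⟩

theorem differs_iff {r v : Fin n} (h : D.IsFirst r v) (e : Fin m) :
    D.Differs v e ↔ ∃ s, D.run v (e, s) ≠ D.run r (e, s) := by
  constructor
  · rintro ⟨r', hr', hd⟩
    obtain rfl := h.unique hr'
    rcases hd with hd | hd
    · exact ⟨_, hd⟩
    · exact ⟨_, hd⟩
  · rintro ⟨_ | _, hd⟩
    · exact ⟨r, h, Or.inl hd⟩
    · exact ⟨r, h, Or.inr hd⟩

theorem exists_leads (v : Fin n) :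
    ∃ r, D.SameClass r v ∧ D.Leads r ∧ ∀ r', D.SameClass r' v → r ≤ r' := by
  obtain ⟨r, hr, hmin⟩ := wellFounded_lt.has_min {r : Fin n | D.SameClass r v} ⟨v, .refl v⟩
  exact ⟨r, hr, fun r' hr' h => hmin r' (h.trans hr) hr', fun r' h => not_lt.1 (hmin r' h)⟩

-- A leader is counted for `v` exactly when no member of the class of `v` comes before or at it,
-- that is, when it precedes the first member `r`.
open Classical in
theorem cls_eq {r v : Fin n} (hr : D.SameClass r v) (hmin : ∀ r', D.SameClass r' v → r ≤ r') :
    D.cls v = (Finset.univ.filter fun x => D.Leads x ∧ x < r).card := by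
  unfold cls
  congr 1
  ext x
  simp only [Finset.mem_filter, Finset.mem_univ, true_and]
  refine and_congr_right fun _ => ⟨fun h => ?_, fun h r' hr' hc => ?_⟩
  · by_contra hx
    exact h r (not_lt.1 hx) hr
  · exact absurd (hmin r' hc) (by omega)

/-- The class number is the rank of the class leader among all leaders: of two distinct leaders, the
earlier one is counted for the later class but not for its own. -/
theorem cls_eq_iff {u v : Fin n} : D.cls u = D.cls v ↔ D.SameClass u v := by
  classical
  have key : ∀ {u v ru rv : Fin n}, D.SameClass ru u → D.Leads ru →
      (∀ r', D.SameClass r' u → ru ≤ r') → D.SameClass rv v → (∀ r', D.SameClass r' v → rv ≤ r') →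
      ru < rv → D.cls u ≠ D.cls v := by
    intro u v ru rv hu hl hum hv hvm hlt
    rw [cls_eq hu hum, cls_eq hv hvm]
    refine ne_of_lt (Finset.card_lt_card ?_)
    rw [Finset.ssubset_iff_of_subset]
    · exact ⟨ru, by simp [hl, hlt], by simp⟩
    · intro x
      simp only [Finset.mem_filter, Finset.mem_univ, true_and]
      exact fun h => ⟨h.1, h.2.trans hlt⟩
  obtain ⟨ru, hu, hul, hum⟩ := exists_leads (D := D) u
  obtain ⟨rv, hv, hvl, hvm⟩ := exists_leads (D := D) v
  constructor
  · intro h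
    rcases lt_trichotomy ru rv with hlt | rfl | hlt
    · exact absurd h (key hu hul hum hv hvm hlt)
    · exact hu.symm.trans hv
    · exact absurd h.symm (key hv hvl hvm hu hum hlt)
  · intro h
    rw [cls_eq hu hum, cls_eq (hu.trans h) fun r' hr' => hum r' (hr'.trans h.symm)]

open Classical in
theorem cls_lt (v : Fin n) : D.cls v < (Finset.univ.filter fun x => D.Leads x).card := by
  obtain ⟨r, hr, hl, hmin⟩ := exists_leads (D := D) v
  rw [cls_eq hr hmin]
  refine Finset.card_lt_card ?_
  rw [Finset.ssubset_iff_of_subset]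
  · exact ⟨r, by simp [hl], by simp⟩
  · intro x
    simp only [Finset.mem_filter, Finset.mem_univ, true_and]
    exact fun h => h.1

theorem cls_lt_card (v : Fin n) : D.cls v < n := by
  classical
  exact (cls_lt v).trans_le ((Finset.card_filter_le _ _).trans (by simp))

/-! #### Runs of vertices of the same type and class -/

variable {G : SimpleGraph (Fin n)}

/-- Vertices of the same type differ in at most two runs. -/
theorem Represents.run_eq_of_two (hD : D.Represents G) {u v : Fin n} (huv : D.SameType u v)
    {h₁ h₂ h₃ : Fin m × Bool} (h12 : h₁ ≠ h₂) (h13 : h₁ ≠ h₃) (h23 : h₂ ≠ h₃)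
    (hd₁ : D.run u h₁ ≠ D.run v h₁) (hd₂ : D.run u h₂ ≠ D.run v h₂) : D.run u h₃ = D.run v h₃ := by
  by_contra hd₃
  -- Among three differing runs, two differ in the same direction, which `single` forbids.
  have a := fun h h' => hD.single u v h h' huv
  have b := fun h h' => hD.single v u h h' huv.symm
  rcases lt_or_gt_of_ne hd₁ with l₁ | l₁ <;> rcases lt_or_gt_of_ne hd₂ with l₂ | l₂ <;>
    rcases lt_or_gt_of_ne hd₃ with l₃ | l₃ <;> grind

/-- A vertex that meets a single edge. -/
theorem Represents.exists_edge (hD : D.Represents G) {v : Fin n} (hv : ¬ D.Branch v) {e : Fin m}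
    (he : ¬ D.Full v e) : ∀ e' ≠ e, D.Full v e' := by
  intro e' hne j hj
  simp only [hv, iff_false]
  intro hm
  apply he
  intro i hi
  simp only [hv, iff_false]
  intro hm'
  exact hne (hD.edge_unique v e' j e i hv hj hi hm hm')

/-- At most two runs differ from those of the first vertex of the type, so at most two edges are
affected. The case `a = b` also covers a vertex that differs on no edge. -/
theorem Represents.exists_two_edges (hD : D.Represents G) (hm : 0 < m) (v : Fin n) :
    ∃ a b, (∀ e, D.Differs v e → e = a ∨ e = b) ∧ (a ≠ b → D.Differs v a ∧ D.Differs v b) := by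
  obtain ⟨r, hr⟩ := exists_isFirst (D := D) v
  by_cases h0 : ∃ a, D.Differs v a
  · obtain ⟨a, ha⟩ := h0
    by_cases h1 : ∃ b, b ≠ a ∧ D.Differs v b
    · obtain ⟨b, hba, hb⟩ := h1
      refine ⟨a, b, fun e he => ?_, fun _ => ⟨ha, hb⟩⟩
      by_contra hne
      push Not at hne
      obtain ⟨s, hs⟩ := (differs_iff hr a).1 ha
      obtain ⟨t, ht⟩ := (differs_iff hr b).1 hb
      obtain ⟨q, hq⟩ := (differs_iff hr e).1 he
      exact hq (hD.run_eq_of_two hr.1.symm (h₁ := (a, s)) (h₂ := (b, t)) (by grind) (by grind)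
        (by grind) hs ht)
    · push Not at h1
      exact ⟨a, a, fun e he => Or.inl (by by_contra hne; exact h1 e hne he), fun h => absurd rfl h⟩
  · push Not at h0
    exact ⟨⟨0, hm⟩, ⟨0, hm⟩, fun e he => absurd he (h0 e), fun h => absurd rfl h⟩

/-- If members of a class differ from the first vertex of their type on both sides of `a`, then the
class is constant on the second edge `b`. -/
theorem Represents.constant_of_two_sides (hD : D.Represents G) {r v a b} (hr : D.IsFirst r v)
    (hv : D.Branch v) (hab : a ≠ b) (ha : D.Differs v a) (hb : D.Differs v b) {x y : Fin n}
    (hx : D.SameClass x v) (hy : D.SameClass y v) {s : Bool} (hxs : D.run x (a, s) ≠ D.run r (a, s))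
    (hys : D.run y (a, !s) ≠ D.run r (a, !s)) {z : Fin n} (hz : D.SameClass z v) (t : Bool) :
    D.run z (b, t) = D.run x (b, t) := by
  have agree : ∀ {x y : Fin n} {s : Bool}, D.SameClass x v → D.SameClass y v →
      D.run x (a, s) ≠ D.run r (a, s) → D.run y (a, !s) ≠ D.run r (a, !s) →
      D.run x (b, t) = D.run y (b, t) := by
    intro x y s hx hy hxs hys
    -- One of the two permitted differences from `r` is spent on `b`, so only one is left on `a`.
    have one : ∀ {x : Fin n} {s : Bool}, D.SameClass x v → D.run x (a, s) ≠ D.run r (a, s) →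
        D.run x (a, !s) = D.run r (a, !s) := by
      intro x s hx hxs
      obtain ⟨q, hq⟩ := (differs_iff (hr.congr hx.1) b).1 ((hx.2 (hx.1.branch_iff.2 hv) b).2 hb)
      exact hD.run_eq_of_two (hx.1.trans hr.1.symm) (h₁ := (a, s)) (h₂ := (b, q)) (by grind)
        (by cases s <;> simp) (by grind) hxs hq
    have h1 := one hx hxs
    have h2 := one hy hys
    simp only [Bool.not_not] at h2
    -- Now `x` and `y` differ from each other in both runs on `a`, which exhausts the two permitted
    -- differences, so they agree on `b`.
    exact hD.run_eq_of_two (hx.1.trans hy.1.symm) (h₁ := (a, s)) (h₂ := (a, !s)) (by cases s <;> simp)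
      (by grind) (by grind) (by rw [h2]; exact hxs) (by rw [h1]; exact hys.symm)
  -- Whichever side of `a` is used by `z`, one of `x` and `y` uses the opposite side.
  obtain ⟨q, hq⟩ := (differs_iff (hr.congr hz.1) a).1 ((hz.2 (hz.1.branch_iff.2 hv) a).2 ha)
  by_cases hqs : q = s
  · subst hqs
    exact (agree hz hy hq hys).trans (agree hx hy hxs hys).symm
  · have : q = !s := Bool.eq_not_iff.2 hqs
    subst this
    exact (agree hx hz hxs hq).symm

/-- In each class, all but two runs are constant. -/
theorem Represents.exists_axes (hD : D.Represents G) (hm : 0 < m) (v : Fin n) :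
    ∃ h₁ h₂ : Fin m × Bool, h₁ ≠ h₂ ∧ ∀ u w, D.SameClass u v → D.SameClass w v →
      ∀ h, h ≠ h₁ → h ≠ h₂ → D.run u h = D.run w h := by
  by_cases hv : D.Branch v
  · obtain ⟨r, hr⟩ := exists_isFirst (D := D) v
    obtain ⟨a, b, hab, hne⟩ := hD.exists_two_edges hm v
    have const : ∀ u, D.SameClass u v → ∀ h : Fin m × Bool, h.1 ≠ a → h.1 ≠ b → D.run u h = D.run r h := by
      intro u hu h ha hb
      by_contra hd
      rcases hab h.1 ((hu.2 (hu.1.branch_iff.2 hv) h.1).1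
        ((differs_iff (hr.congr hu.1) h.1).2 ⟨h.2, hd⟩)) with h1 | h1
      · exact ha h1
      · exact hb h1
    -- If the class is constant on `d`, only the two runs on `c` remain.
    have both : ∀ {c d : Fin m}, (∀ u, D.SameClass u v → ∀ h : Fin m × Bool, h.1 ≠ c → h.1 ≠ d →
        D.run u h = D.run r h) → (∃ x, D.SameClass x v ∧ ∀ z, D.SameClass z v → ∀ t,
        D.run z (d, t) = D.run x (d, t)) → ∃ h₁ h₂ : Fin m × Bool, h₁ ≠ h₂ ∧ ∀ u w, D.SameClass u v →
        D.SameClass w v → ∀ h, h ≠ h₁ → h ≠ h₂ → D.run u h = D.run w h := by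
      rintro c d hcd ⟨x, hx, hxz⟩
      refine ⟨(c, false), (c, true), by simp, fun u w hu hw h h1 h2 => ?_⟩
      have hc : h.1 ≠ c := by
        rintro rfl
        rcases h with ⟨e, _ | _⟩ <;> simp at h1 h2
      by_cases hd : h.1 = d
      · subst hd
        exact (hxz u hu h.2).trans (hxz w hw h.2).symm
      · exact (hcd u hu h hc hd).trans (hcd w hw h hc hd).symm
    by_cases heq : a = b
    · subst heq
      refine ⟨(a, false), (a, true), by simp, fun u w hu hw h h1 h2 => ?_⟩
      have hc : h.1 ≠ a := by
        rintro rfl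
        rcases h with ⟨e, _ | _⟩ <;> simp at h1 h2
      exact (const u hu h hc hc).trans (const w hw h hc hc).symm
    obtain ⟨hda, hdb⟩ := hne heq
    -- Either one side of `c` agrees with `r` throughout the class, which leaves one axis on `c`, or
    -- both sides are used and `constant_of_two_sides` makes the other edge constant.
    have choice : ∀ c : Fin m, (∃ s, ∀ u, D.SameClass u v → D.run u (c, !s) = D.run r (c, !s)) ∨
        ∃ x y, D.SameClass x v ∧ D.SameClass y v ∧ D.run x (c, false) ≠ D.run r (c, false) ∧
          D.run y (c, !false) ≠ D.run r (c, !false) := by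
      intro c
      by_cases hx : ∃ x, D.SameClass x v ∧ D.run x (c, false) ≠ D.run r (c, false)
      · by_cases hy : ∃ y, D.SameClass y v ∧ D.run y (c, !false) ≠ D.run r (c, !false)
        · obtain ⟨x, hx, hx'⟩ := hx
          obtain ⟨y, hy, hy'⟩ := hy
          exact Or.inr ⟨x, y, hx, hy, hx', hy'⟩
        · push Not at hy
          exact Or.inl ⟨false, hy⟩
      · push Not at hx
        exact Or.inl ⟨true, hx⟩
    rcases choice a with ⟨s, hs⟩ | ⟨x, y, hx, hy, hxs, hys⟩
    · rcases choice b with ⟨t, ht⟩ | ⟨x, y, hx, hy, hxs, hys⟩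
      · refine ⟨(a, s), (b, t), by grind, fun u w hu hw h h1 h2 => ?_⟩
        suffices ∀ u, D.SameClass u v → D.run u h = D.run r h from (this u hu).trans (this w hw).symm
        intro u hu
        rcases h with ⟨e, q⟩
        by_cases hea : e = a
        · subst hea
          have : q = !s := Bool.eq_not_iff.2 fun h => h1 (by rw [h])
          rw [this]; exact hs u hu
        · by_cases heb : e = b
          · subst heb
            have : q = !t := Bool.eq_not_iff.2 fun h => h2 (by rw [h])
            rw [this]; exact ht u hu
          · exact const u hu _ hea heb
      · exact both (c := b) (d := a) (fun u hu h h1 h2 => const u hu h h2 h1)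
          ⟨x, hx, fun z hz t => hD.constant_of_two_sides hr hv (Ne.symm heq) hdb hda hx hy hxs hys hz t⟩
    · exact both (c := a) (d := b) const
        ⟨x, hx, fun z hz t => hD.constant_of_two_sides hr hv heq hda hdb hx hy hxs hys hz t⟩
  · have hfull : ∃ e : Fin m, ∀ e' ≠ e, D.Full v e' := by
      by_cases h : ∃ e, ¬ D.Full v e
      · exact h.imp fun e he => hD.exists_edge hv he
      · push Not at h
        exact ⟨⟨0, hm⟩, fun e _ => h e⟩
    obtain ⟨e, he⟩ := hfull
    refine ⟨(e, false), (e, true), by simp, fun u w hu hw h h1 h2 => ?_⟩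
    have hne : h.1 ≠ e := by
      rintro rfl
      rcases h with ⟨e, _ | _⟩ <;> simp at h1 h2
    have hl : ∀ u, D.SameClass u v → D.run u h = D.len h.1 :=
      fun u hu => Full.run_eq ((hu.1 h.1).2.2.2 (he _ hne)) h.2
    rw [hl u hu, hl w hw]

/-! ### The sorting key of a class -/

theorem rank_injective : Function.Injective (rank (m := m)) := by
  rintro ⟨a, s⟩ ⟨b, t⟩ h
  simp only [rank] at h
  cases s <;> cases t <;> simp at h ⊢ <;> omega

theorem Leading.not_varies {v : Fin n} {h h' : Fin m × Bool} (hl : D.Leading v h)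
    (hr : rank h' < rank h) : ¬ D.Varies v h' := by
  rcases h' with ⟨e, _ | _⟩
  · exact (hl.2 e).1 hr
  · exact (hl.2 e).2 hr

theorem Leading.unique {v : Fin n} {h h' : Fin m × Bool} (hl : D.Leading v h) (hl' : D.Leading v h') :
    h = h' := by
  rcases lt_trichotomy (rank h) (rank h') with hlt | heq | hlt
  · exact absurd hl.1 (hl'.not_varies hlt)
  · exact rank_injective heq
  · exact absurd hl'.1 (hl.not_varies hlt)

theorem Varies.exists_leading {v : Fin n} {h : Fin m × Bool} (hv : D.Varies v h) :
    ∃ h', D.Leading v h' := by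
  obtain ⟨h', hh', hmin⟩ := (measure (rank (m := m))).wf.has_min {h | D.Varies v h} ⟨h, hv⟩
  exact ⟨h', hh', fun e => ⟨fun hr hc => hmin _ hc hr, fun hr hc => hmin _ hc hr⟩⟩

theorem SameClass.varies_iff {u v : Fin n} (huv : D.SameClass u v) (h : Fin m × Bool) :
    D.Varies u h ↔ D.Varies v h := by
  have : ∀ {u v}, D.SameClass u v → D.Varies u h → D.Varies v h := by
    rintro u v huv ⟨w, hw, hne⟩
    by_cases hu : D.run u h = D.run v h
    · exact ⟨w, hw.trans huv, hu ▸ hne⟩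
    · exact ⟨u, huv, hu⟩
  exact ⟨this huv, this huv.symm⟩

theorem SameClass.leading_iff {u v : Fin n} (huv : D.SameClass u v) (h : Fin m × Bool) :
    D.Leading u h ↔ D.Leading v h := by
  simp only [Leading, huv.varies_iff]

theorem SameType.degenerate_iff {u v : Fin n} (huv : D.SameType u v) :
    D.Degenerate u ↔ D.Degenerate v := by
  simp only [Degenerate, huv.branch_iff, fun e => (huv e).2.2]

theorem Degenerate.run_eq {v : Fin n} (hv : D.Degenerate v) (h : Fin m × Bool) :
    D.run v h = D.len h.1 := Full.run_eq (hv.2 h.1) h.2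

theorem key_eq_sum {v : Fin n} (hv : ¬ D.Degenerate v) : D.key v = ∑ h, D.weight v h := by
  rw [key, if_neg hv, Fintype.sum_prod_type]
  refine Finset.sum_congr rfl fun e _ => ?_
  simp [add_comm]

/-- Along the sorting order of a class, one run is nondecreasing, one is nonincreasing, and all others
are constant. -/
theorem Represents.exists_monotone_axes (hD : D.Represents G) (hm : 0 < m) (v : Fin n) :
    ∃ h₁ h₂ : Fin m × Bool, h₁ ≠ h₂ ∧ ∀ u w, D.SameClass u v → D.SameClass w v → D.key u ≤ D.key w →
      (∀ h, h ≠ h₂ → D.run u h ≤ D.run w h) ∧ ∀ h, h ≠ h₁ → D.run w h ≤ D.run u h := by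
  obtain ⟨a, b, hab, hconst⟩ := hD.exists_axes hm v
  by_cases hdeg : D.Degenerate v
  · refine ⟨a, b, hab, fun u w hu hw _ => ?_⟩
    have h1 := fun h => (hu.1.degenerate_iff.2 hdeg).run_eq h
    have h2 := fun h => (hw.1.degenerate_iff.2 hdeg).run_eq h
    exact ⟨fun h _ => by rw [h1, h2], fun h _ => by rw [h1, h2]⟩
  by_cases hvar : ∃ h, D.Varies v h
  · obtain ⟨_, hvar⟩ := hvar
    obtain ⟨h₁, hlead⟩ := hvar.exists_leading
    obtain ⟨h₂, h12, hc⟩ : ∃ h₂, h₁ ≠ h₂ ∧ ∀ u w, D.SameClass u v → D.SameClass w v →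
        ∀ h, h ≠ h₁ → h ≠ h₂ → D.run u h = D.run w h := by
      obtain ⟨v', hv', hne⟩ := hlead.1
      by_cases h1a : h₁ = a
      · subst h1a
        exact ⟨b, hab, hconst⟩
      · by_cases h1b : h₁ = b
        · subst h1b
          exact ⟨a, Ne.symm hab, fun u w hu hw h h1 h2 => hconst u w hu hw h h2 h1⟩
        · exact absurd (hconst v' v hv' (.refl v) h₁ h1a h1b) hne
    have hw1 : ∀ u, D.SameClass u v → D.weight u h₁ = D.run u h₁ := fun u hu => by
      rw [weight, if_pos ((hu.leading_iff _).2 hlead)]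
    have hw2 : ∀ u, D.SameClass u v → ∀ h, h ≠ h₁ → D.weight u h = D.len h.1 - D.run u h := by
      intro u hu h hne
      rw [weight, if_neg fun hl => hne (((hu.leading_iff _).1 hl).unique hlead)]
    -- On the class the key is a constant plus the run at `h₁` minus the run at `h₂`; the complement
    -- `len - run` keeps it a natural number.
    have strict : ∀ u w, D.SameClass u v → D.SameClass w v → D.run w h₁ ≤ D.run u h₁ →
        D.run u h₂ ≤ D.run w h₂ → (D.run w h₁ < D.run u h₁ ∨ D.run u h₂ < D.run w h₂) →
        D.key w < D.key u := by
      intro u w hu hw h1 h2 h3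
      rw [key_eq_sum fun h => hdeg (hu.1.degenerate_iff.1 h),
        key_eq_sum fun h => hdeg (hw.1.degenerate_iff.1 h)]
      refine Finset.sum_lt_sum (fun h _ => ?_) ?_
      · by_cases hh1 : h = h₁
        · subst hh1; rw [hw1 u hu, hw1 w hw]; exact h1
        · rw [hw2 u hu h hh1, hw2 w hw h hh1]
          by_cases hh2 : h = h₂
          · subst hh2; omega
          · rw [hc u w hu hw h hh1 hh2]
      · rcases h3 with h3 | h3
        · exact ⟨h₁, Finset.mem_univ _, by rw [hw1 u hu, hw1 w hw]; exact h3⟩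
        · refine ⟨h₂, Finset.mem_univ _, ?_⟩
          rw [hw2 u hu _ (Ne.symm h12), hw2 w hw _ (Ne.symm h12)]
          have := D.run_le w h₂
          omega
    refine ⟨h₁, h₂, h12, fun u w hu hw hle => ?_⟩
    have htyp := hu.1.trans hw.1.symm
    -- By `single`, `u` cannot exceed `w` at both axes, so an excess at `h₁` alone would give `w`
    -- the smaller key.
    have e1 : D.run u h₁ ≤ D.run w h₁ := by
      by_contra hlt
      push Not at hlt
      have : D.run u h₂ ≤ D.run w h₂ := by
        by_contra hlt'
        exact h12 (hD.single u w _ _ htyp hlt (not_le.1 hlt'))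
      exact absurd (strict u w hu hw hlt.le this (Or.inl hlt)) (not_lt.2 hle)
    have e2 : D.run w h₂ ≤ D.run u h₂ := by
      by_contra hlt
      push Not at hlt
      have : D.run w h₁ ≤ D.run u h₁ := by
        by_contra hlt'
        exact h12 (hD.single w u _ _ htyp.symm (not_le.1 hlt') hlt)
      exact absurd (strict u w hu hw this hlt.le (Or.inr hlt)) (not_lt.2 hle)
    refine ⟨fun h hh => ?_, fun h hh => ?_⟩
    · by_cases hh1 : h = h₁
      · subst hh1; exact e1
      · exact (hc u w hu hw h hh1 hh).le
    · by_cases hh2 : h = h₂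
      · subst hh2; exact e2
      · exact (hc u w hu hw h hh hh2).ge
  · push Not at hvar
    refine ⟨a, b, hab, fun u w hu hw _ => ?_⟩
    have hall : ∀ h, D.run u h = D.run w h := by
      intro h
      have : ∀ x, D.SameClass x v → D.run x h = D.run v h := fun x hx => by
        by_contra hne
        exact hvar h ⟨x, hx, hne⟩
      rw [this u hu, this w hw]
    exact ⟨fun h _ => (hall h).le, fun h _ => (hall h).ge⟩

end PathModel

namespace PathModel

variable {n m : ℕ} {D : PathModel n m} {G : SimpleGraph (Fin n)}

/-! #### The number of classes -/

open Classical in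
/-- A code for sets with at most two elements. -/
noncomputable def pairCode (A : Finset (Fin m)) : Option (Fin m × Fin m) :=
  if h : A.Nonempty then some (A.min' h, A.max' h) else none

theorem eq_pair_of_card_le_two {A : Finset (Fin m)} (hA : A.card ≤ 2) (h : A.Nonempty) :
    A = {A.min' h, A.max' h} := by
  ext x
  simp only [Finset.mem_insert, Finset.mem_singleton]
  constructor
  · intro hx
    by_contra hne
    push Not at hne
    have h1 : A.min' h < x := lt_of_le_of_ne (A.min'_le x hx) (Ne.symm hne.1)
    have h2 : x < A.max' h := lt_of_le_of_ne (A.le_max' x hx) hne.2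
    have := Finset.two_lt_card.2 ⟨_, A.min'_mem h, x, hx, _, A.max'_mem h, h1.ne, (h1.trans h2).ne, h2.ne⟩
    omega
  · rintro (rfl | rfl)
    · exact A.min'_mem h
    · exact A.max'_mem h

theorem pairCode_inj {A B : Finset (Fin m)} (hA : A.card ≤ 2) (hB : B.card ≤ 2)
    (h : pairCode A = pairCode B) : A = B := by
  unfold pairCode at h
  split_ifs at h with h1 h2 h2
  · simp only [Option.some.injEq, Prod.mk.injEq] at h
    rw [eq_pair_of_card_le_two hA h1, eq_pair_of_card_le_two hB h2, h.1, h.2]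
  · rw [Finset.not_nonempty_iff_eq_empty] at h1 h2
    rw [h1, h2]

/-- Codes of classes: the ends of edges and the paths that a branch vertex contains and the edges where
it differs from the first vertex of its type, or a single edge. -/
abbrev ClassCode (m : ℕ) : Type :=
  ({B : Finset (Fin m × Bool) // B ≠ ∅} × Finset (Fin m) × Option (Fin m × Fin m)) ⊕ Fin m

/-- The factors are `2^(2m) - 1` nonempty sets of ends, `2^m` sets of full paths and `m^2 + 1` codes
of pairs; the summand `m` stands for the single edges. -/
theorem card_classCode : Fintype.card (ClassCode m) = thinnessBound m := by
  have h : Fintype.card {B : Finset (Fin m × Bool) // B ≠ ∅} = 4 ^ m - 1 := by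
    rw [Fintype.card_subtype_compl, Fintype.card_finset]
    simp [pow_mul, mul_comm m 2]
  rw [Fintype.card_sum, Fintype.card_prod, h, Fintype.card_prod]
  simp only [Fintype.card_finset, Fintype.card_option, Fintype.card_prod, Fintype.card_fin,
    thinnessBound]
  ring

theorem Represents.card_differs_le (hD : D.Represents G) (hm : 0 < m) (v : Fin n)
    (A : Finset (Fin m)) (hA : ∀ e, e ∈ A ↔ D.Differs v e) : A.card ≤ 2 := by
  obtain ⟨a, b, hab, -⟩ := hD.exists_two_edges hm v
  calc A.card ≤ ({a, b} : Finset (Fin m)).card := Finset.card_le_card fun e he => by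
        simpa using hab e ((hA e).1 he)
    _ ≤ 2 := Finset.card_le_two

open Classical in
/-- The code of the class of `v`. -/
noncomputable def code (D : PathModel n m) (hm : 0 < m) (v : Fin n) : ClassCode m :=
  if hb : D.Branch v then
    Sum.inl (⟨Finset.univ.filter fun h => D.side v h 0, by
      obtain ⟨e, h | h⟩ := hb
      · exact Finset.Nonempty.ne_empty ⟨(e, false), by simpa using h⟩
      · exact Finset.Nonempty.ne_empty ⟨(e, true), by simpa using h⟩⟩,
      Finset.univ.filter (D.Full v), pairCode (Finset.univ.filter (D.Differs v)))
  else if hd : ∃ e, ¬ D.Full v e then Sum.inr hd.choose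
  -- The class of sets that meet no edge gets a code with a full path of which only one end is
  -- present.
  else Sum.inl (⟨{(⟨0, hm⟩, false)}, by simp⟩, {⟨0, hm⟩}, none)

/-- A branch vertex that contains a full path contains both of its ends, whereas this code lists
only one end. -/
theorem code_branch_ne {v : Fin n} (hm : 0 < m) (hb : D.Branch v) (A) :
    D.code hm v ≠ Sum.inl (⟨{(⟨0, hm⟩, false)}, by simp⟩, {⟨0, hm⟩}, A) := by
  classical
  intro h
  rw [code, dif_pos hb] at h
  simp only [Sum.inl.injEq, Prod.mk.injEq, Subtype.mk.injEq] at h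
  have h1 : D.Full v ⟨0, hm⟩ := by
    have : (⟨0, hm⟩ : Fin m) ∈ Finset.univ.filter (D.Full v) := by rw [h.2.1]; simp
    simpa using this
  have h2 : D.side v (⟨0, hm⟩, true) 0 := (h1 _ (by simp)).2 hb
  have : ((⟨0, hm⟩, true) : Fin m × Bool) ∈ Finset.univ.filter fun h => D.side v h 0 := by simpa using h2
  rw [h.1] at this
  simp at this

/-- For branch vertices, minimum and maximum determine the set of differing edges, as it has at most
two elements. For the others, the type is determined by the edge that is met, if there is one. -/
theorem Represents.sameClass_of_code_eq (hD : D.Represents G) (hm : 0 < m) {u v : Fin n}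
    (h : D.code hm u = D.code hm v) : D.SameClass u v := by
  classical
  have nonbranch : ∀ {u v : Fin n}, ¬ D.Branch u → ¬ D.Branch v → (∀ e, D.Full u e ↔ D.Full v e) →
      D.SameClass u v := fun hu hv hf =>
    ⟨fun e => ⟨by simp [side_zero_false hu, side_zero_false hv],
      by simp [side_zero_false hu, side_zero_false hv], hf e⟩, fun hb => absurd hb hu⟩
  have mixed : ∀ {u v : Fin n}, D.Branch u → ¬ D.Branch v → D.code hm u ≠ D.code hm v := by
    intro u v hu hv h
    by_cases hd : ∃ e, ¬ D.Full v e
    · simp [code, hu, hv, hd] at h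
    · exact code_branch_ne hm hu none (by rw [h, code, dif_neg hv, dif_neg hd])
  by_cases hu : D.Branch u
  · by_cases hv : D.Branch v
    · rw [code, code, dif_pos hu, dif_pos hv] at h
      simp only [Sum.inl.injEq, Prod.mk.injEq, Subtype.mk.injEq] at h
      obtain ⟨h1, h2, h3⟩ := h
      have h3 := pairCode_inj (hD.card_differs_le hm u _ (by simp)) (hD.card_differs_le hm v _ (by simp)) h3
      simp only [Finset.ext_iff, Finset.mem_filter, Finset.mem_univ, true_and] at h1 h2 h3
      exact ⟨fun e => ⟨h1 _, h1 _, h2 e⟩, fun _ => h3⟩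
    · exact absurd h (mixed hu hv)
  · by_cases hv : D.Branch v
    · exact absurd h.symm (mixed hv hu)
    · refine nonbranch hu hv ?_
      by_cases hdu : ∃ e, ¬ D.Full u e
      · by_cases hdv : ∃ e, ¬ D.Full v e
        · rw [code, code, dif_neg hu, dif_neg hv, dif_pos hdu, dif_pos hdv] at h
          have h : hdu.choose = hdv.choose := Sum.inr_injective h
          intro e
          by_cases he : e = hdu.choose
          · subst he
            exact iff_of_false hdu.choose_spec (h ▸ hdv.choose_spec)
          · exact iff_of_true (hD.exists_edge hu hdu.choose_spec e he)
              (hD.exists_edge hv hdv.choose_spec e (h ▸ he))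
        · simp [code, hu, hv, hdu, hdv] at h
      · by_cases hdv : ∃ e, ¬ D.Full v e
        · simp [code, hu, hv, hdu, hdv] at h
        · push Not at hdu hdv
          exact fun e => iff_of_true (hdu e) (hdv e)

theorem Represents.cls_lt_thinnessBound (hD : D.Represents G) (hm : 0 < m) (v : Fin n) :
    D.cls v < thinnessBound m := by
  classical
  refine (cls_lt v).trans_le ?_
  rw [← card_classCode, ← Finset.card_univ]
  refine Finset.card_le_card_of_injOn (D.code hm) (fun _ _ => Finset.mem_coe.2 (Finset.mem_univ _)) ?_
  intro x hx y hy hxy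
  have hx : D.Leads x := by simpa using hx
  have hy : D.Leads y := by simpa using hy
  have hc := hD.sameClass_of_code_eq hm hxy
  rcases lt_trichotomy x y with hl | he | hl
  · exact absurd hc (hy x hl)
  · exact he
  · exact absurd hc.symm (hx y hl)

/-! #### Adjacency in terms of runs -/

theorem Meets.symm {u v : Fin n} (h : D.Meets u v) : D.Meets v u :=
  let ⟨e, i, hi, h1, h2⟩ := h; ⟨e, i, hi, h2, h1⟩

theorem meets_of_side {u v : Fin n} {h : Fin m × Bool} {j : ℕ} (hj : j < D.len h.1 + 2)
    (hu : D.side u h j) (hv : D.side v h j) : D.Meets u v := by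
  refine ⟨h.1, _, ?_, hu, hv⟩
  split_ifs <;> omega

theorem interior_of_mem {v : Fin n} (hv : ¬ D.Branch v) {e : Fin m} {i : ℕ} (hi : i < D.len e + 2)
    (h : D.mem v e i) : 1 ≤ i ∧ i ≤ D.len e := by
  constructor
  · by_contra h0
    obtain rfl : i = 0 := by omega
    exact side_zero_false hv (e, false) h
  · by_contra h0
    obtain rfl : i = D.len e + 1 := by omega
    exact side_zero_false hv (e, true) h

/-- The position `i` counted from the end `s` of the edge `e`. -/
def coord (D : PathModel n m) (e : Fin m) (s : Bool) (i : ℕ) : ℕ := if s then D.len e + 1 - i else i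

/-- By `prefix_or_suffix`, every internal position of a branch vertex is reached inside the set from
one of the two ends. -/
theorem Represents.exists_le_run (hD : D.Represents G) {v : Fin n} (hv : D.Branch v) {e : Fin m}
    {i : ℕ} (h1 : 1 ≤ i) (hi : i ≤ D.len e) (h : D.mem v e i) :
    ∃ s, D.coord e s i ≤ D.run v (e, s) ∧ D.side v (e, s) 0 := by
  rcases hD.prefix_or_suffix v e i hv (by omega) h with hp | hs
  · refine ⟨false, ?_, hp 0 (by omega)⟩
    simp only [coord, Bool.false_eq_true, if_false]
    rw [le_run_iff h1 hi]
    exact fun j hj => iff_of_true (hp j hj) hv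
  · refine ⟨true, ?_, hs (D.len e + 1) (by omega) (by omega)⟩
    simp only [coord, if_true]
    rw [le_run_iff (by omega) (by dsimp; omega)]
    intro j hj
    exact iff_of_true (hs (D.len e + 1 - j) (by omega) (by omega)) hv

theorem run_lt_coord {v : Fin n} (hv : ¬ D.Branch v) {e : Fin m} {i : ℕ} (hi : i < D.len e + 2)
    (h : D.mem v e i) (s : Bool) : D.run v (e, s) < D.coord e s i := by
  obtain ⟨h1, h2⟩ := interior_of_mem hv hi h
  by_contra hc
  have hs := exists_side s hi h
  have hc := not_lt.1 hc
  have h3 : 1 ≤ D.coord e s i ∧ D.coord e s i ≤ D.len e := by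
    unfold coord; split_ifs <;> omega
  rw [le_run_iff h3.1 h3.2] at hc
  exact hv ((hc _ le_rfl).1 hs)

theorem side_of_le_run {v : Fin n} (hv : D.Branch v) {h : Fin m × Bool} {j : ℕ} (h1 : 1 ≤ j)
    (hj : j ≤ D.run v h) : D.side v h j :=
  ((le_run_iff h1 (hj.trans (run_le v h))).1 hj j le_rfl).2 hv

theorem side_run_succ {v : Fin n} (hv : ¬ D.Branch v) {h : Fin m × Bool} (hl : D.run v h < D.len h.1) :
    D.side v h (D.run v h + 1) := by
  by_contra hc
  exact not_side_run (iff_of_false (side_zero_false hv h) hv) hl (iff_of_false hc hv)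

/-- A branch vertex meets another vertex if and only if it extends further from some end of an edge
than the complement of the other. -/
theorem Represents.meets_iff_of_branch_of_not (hD : D.Represents G) {u v : Fin n} (hu : D.Branch u)
    (hv : ¬ D.Branch v) : ¬ D.Meets u v ↔ ∀ h, D.run u h ≤ D.run v h := by
  rw [← not_iff_not]
  push Not
  constructor
  · rintro ⟨e, i, hi, h1, h2⟩
    obtain ⟨i1, i2⟩ := interior_of_mem hv hi h2
    obtain ⟨s, hs, -⟩ := hD.exists_le_run hu i1 i2 h1
    exact ⟨(e, s), (run_lt_coord hv hi h2 s).trans_le hs⟩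
  · rintro ⟨h, hlt⟩
    have := D.run_le u h
    exact meets_of_side (j := D.run v h + 1) (by omega) (side_of_le_run hu (by omega) hlt)
      (side_run_succ hv (by omega))

/-- Branch vertices without a common end of an edge meet if and only if their runs on some edge
overlap. -/
theorem Represents.meets_iff_of_branch (hD : D.Represents G) {u v : Fin n} (hu : D.Branch u)
    (hv : D.Branch v) (hno : ∀ h, ¬ (D.side u h 0 ∧ D.side v h 0)) :
    ¬ D.Meets u v ↔ ∀ h : Fin m × Bool, D.run u h + D.run v (h.1, !h.2) ≤ D.len h.1 := by
  rw [← not_iff_not]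
  push Not
  constructor
  · rintro ⟨e, i, hi, h1, h2⟩
    have i1 : 1 ≤ i := by
      by_contra h0
      obtain rfl : i = 0 := by omega
      exact hno (e, false) ⟨h1, h2⟩
    have i2 : i ≤ D.len e := by
      by_contra h0
      obtain rfl : i = D.len e + 1 := by omega
      exact hno (e, true) ⟨h1, h2⟩
    obtain ⟨s, hs, hs0⟩ := hD.exists_le_run hu i1 i2 h1
    obtain ⟨t, ht, ht0⟩ := hD.exists_le_run hv i1 i2 h2
    -- Reaching the common position from the same end would make that end common.
    have hst : t = !s := Bool.eq_not_iff.2 fun h => hno (e, s) ⟨hs0, h ▸ ht0⟩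
    subst hst
    refine ⟨(e, s), ?_⟩
    simp only
    cases s <;> simp [coord] at hs ht ⊢ <;> omega
  · rintro ⟨⟨e, s⟩, hlt⟩
    simp only at hlt
    have h1 := D.run_le u (e, s)
    have h2 := D.run_le v (e, !s)
    simp only at h1 h2
    -- The last position of the run of `u` also lies in the opposite run of `v`. Neither run exceeds
    -- `len`, so both are positive here.
    refine meets_of_side (h := (e, s)) (j := D.run u (e, s)) (by dsimp; omega)
      (side_of_le_run hu (by omega) le_rfl) ?_
    rw [← side_mirror (by omega)]
    exact side_of_le_run hv (by omega) (by omega)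

/-- Two vertices that are intervals of the same path. -/
theorem Represents.meets_iff_of_not_branch (hD : D.Represents G) {u v : Fin n} (hu : ¬ D.Branch u)
    (hv : ¬ D.Branch v) {e : Fin m} (hue : ¬ D.Full u e) (hve : ¬ D.Full v e) :
    D.Meets u v ↔ D.run u (e, false) + D.run v (e, true) < D.len e ∧
      D.run v (e, false) + D.run u (e, true) < D.len e := by
  -- The two runs are the gaps before and after the interval, so they determine its first and last
  -- positions.
  have ends : ∀ {u : Fin n}, ¬ D.Branch u → ¬ D.Full u e → D.run u (e, false) + D.run u (e, true) < D.len e ∧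
      D.mem u e (D.run u (e, false) + 1) ∧ D.mem u e (D.len e - D.run u (e, true)) := by
    intro u hu hue
    simp only [Full, hu, iff_false] at hue
    push Not at hue
    obtain ⟨i, hi, hm⟩ := hue
    have h1 := run_lt_coord hu hi hm false
    have h2 := run_lt_coord hu hi hm true
    obtain ⟨i1, i2⟩ := interior_of_mem hu hi hm
    simp only [coord, Bool.false_eq_true, if_false, if_true] at h1 h2
    refine ⟨by omega, side_run_succ (h := (e, false)) hu (by dsimp; omega), ?_⟩
    have := side_run_succ (h := (e, true)) hu (by dsimp; omega)
    simp only [side, if_true] at this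
    rwa [Nat.add_sub_add_right] at this
  constructor
  · rintro ⟨e', i, hi, h1, h2⟩
    obtain rfl : e' = e := by
      by_contra hne
      have := hD.exists_edge hu hue e' hne i hi
      exact hu (this.1 h1)
    obtain ⟨i1, i2⟩ := interior_of_mem hu hi h1
    have a1 := run_lt_coord hu hi h1 false
    have a2 := run_lt_coord hu hi h1 true
    have b1 := run_lt_coord hv hi h2 false
    have b2 := run_lt_coord hv hi h2 true
    simp only [coord, Bool.false_eq_true, if_false, if_true] at a1 a2 b1 b2
    omega
  · rintro ⟨h1, h2⟩
    obtain ⟨u0, u1, u2⟩ := ends hu hue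
    obtain ⟨v0, v1, v2⟩ := ends hv hve
    rcases le_total (D.run u (e, false)) (D.run v (e, false)) with hle | hle
    · exact ⟨e, _, by omega, hD.convex u e _ _ _ hu (by omega) (by omega) (by omega) u1 u2, v1⟩
    · exact ⟨e, _, by omega, u1, hD.convex v e _ _ _ hv (by omega) (by omega) (by omega) v1 v2⟩

/-- Along the sorting order, each class is the vertex set of a proper interval graph. -/
theorem Represents.adj_of_between (hD : D.Represents G) (hm : 0 < m) {u v w : Fin n}
    (huv : D.SameClass u v) (hwv : D.SameClass w v) (h1 : D.key u ≤ D.key v) (h2 : D.key v ≤ D.key w)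
    (nuv : u ≠ v) (nvw : v ≠ w) (nuw : u ≠ w) (h : G.Adj u w) : G.Adj u v ∧ G.Adj v w := by
  rw [hD.adj_iff _ _ nuv, hD.adj_iff _ _ nvw]
  rw [hD.adj_iff _ _ nuw] at h
  by_cases hv : D.Branch v
  -- Members of a branch class share an end of an edge, so the class is complete.
  · have common : ∀ {x y : Fin n}, D.SameClass x v → D.SameClass y v → D.Meets x y := by
      intro x y hx hy
      obtain ⟨g, hg⟩ : ∃ g, D.side v g 0 := by
        obtain ⟨e, h | h⟩ := hv
        · exact ⟨_, h⟩
        · exact ⟨_, h⟩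
      exact meets_of_side (j := 0) (by omega) ((hx.1.side_zero_iff g).2 hg) ((hy.1.side_zero_iff g).2 hg)
    exact ⟨Or.inl (common huv (.refl v)), Or.inl (common (.refl v) hwv)⟩
  by_cases hd : D.Degenerate v
  · have hdu := huv.1.degenerate_iff.2 hd
    have hdw := hwv.1.degenerate_iff.2 hd
    rcases h with ⟨e, i, hi, hm1, -⟩ | ⟨-, -, ht, h0⟩
    · exact absurd ((hdu.2 e i hi).1 hm1) hdu.1
    · simp only [key, if_pos hd, if_pos hdu, if_pos hdw] at h1 h2
      exact ⟨Or.inr ⟨hdu, hd, by omega, h0⟩, Or.inr ⟨hd, hdw, by omega, by omega⟩⟩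
  obtain ⟨e, he⟩ : ∃ e, ¬ D.Full v e := by
    by_contra hc
    push Not at hc
    exact hd ⟨hv, hc⟩
  have hu' : ¬ D.Branch u := fun hb => hv (huv.1.branch_iff.1 hb)
  have hw' : ¬ D.Branch w := fun hb => hv (hwv.1.branch_iff.1 hb)
  have hue : ¬ D.Full u e := fun hf => he ((huv.1 e).2.2.1 hf)
  have hwe : ¬ D.Full w e := fun hf => he ((hwv.1 e).2.2.1 hf)
  have h : D.Meets u w := by
    rcases h with h | h
    · exact h
    · exact absurd (huv.1.degenerate_iff.1 h.1) hd
  rw [hD.meets_iff_of_not_branch hu' hw' hue hwe] at h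
  rw [hD.meets_iff_of_not_branch hu' hv hue he, hD.meets_iff_of_not_branch hv hw' he hwe]
  -- One gap grows while the other shrinks: along the order both endpoints of the intervals move in
  -- the same direction.
  have dir : (∀ x y, D.SameClass x v → D.SameClass y v → D.key x ≤ D.key y →
      D.run x (e, false) ≤ D.run y (e, false) ∧ D.run y (e, true) ≤ D.run x (e, true)) ∨
      ∀ x y, D.SameClass x v → D.SameClass y v → D.key x ≤ D.key y →
      D.run y (e, false) ≤ D.run x (e, false) ∧ D.run x (e, true) ≤ D.run y (e, true) := by
    obtain ⟨a, b, hab, hmon⟩ := hD.exists_monotone_axes hm v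
    by_cases hc : (e, false) ≠ b ∧ (e, true) ≠ a
    · exact Or.inl fun x y hx hy hle => ⟨(hmon x y hx hy hle).1 _ hc.1, (hmon x y hx hy hle).2 _ hc.2⟩
    · exact Or.inr fun x y hx hy hle =>
        ⟨(hmon x y hx hy hle).2 _ (by grind), (hmon x y hx hy hle).1 _ (by grind)⟩
  rcases dir with dir | dir
  · have d1 := dir u v huv (.refl v) h1
    have d2 := dir v w (.refl v) hwv h2
    exact ⟨Or.inl (by omega), Or.inl (by omega)⟩
  · have d1 := dir u v huv (.refl v) h1
    have d2 := dir v w (.refl v) hwv h2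
    exact ⟨Or.inl (by omega), Or.inl (by omega)⟩

/-! #### Merging two classes -/

/-- The order on numbers, reversed if `b` holds. -/
def FlipLe (b : Prop) (x y : ℕ) : Prop := b ∧ y ≤ x ∨ ¬ b ∧ x ≤ y

/-- A conjunction of conditions that bound sums of runs of a vertex in one class and a vertex in another
class splits into conditions that move in opposite directions, possibly after a reversal of the second
class. -/
theorem exists_flip_of_axes {U W I : Type*} (x : I → U → ℕ) (y : I → W → ℕ) (c : I → ℕ)
    (k : U → ℕ) (l : W → ℕ) {h₁ h₂ g₁ g₂ : I} (hh : h₁ ≠ h₂) (hg : g₁ ≠ g₂)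
    (hx : ∀ u u', k u ≤ k u' → (∀ h, h ≠ h₂ → x h u ≤ x h u') ∧ ∀ h, h ≠ h₁ → x h u' ≤ x h u)
    (hy : ∀ w w', l w ≤ l w' → (∀ h, h ≠ g₂ → y h w ≤ y h w') ∧ ∀ h, h ≠ g₁ → y h w' ≤ y h w) :
    ∃ b : Prop, ∀ u w u₁ w₁ u₂ w₂, k u ≤ k u₁ → FlipLe b (l w₁) (l w) →
      (∀ h, x h u₁ + y h w₁ ≤ c h) → k u₂ ≤ k u → FlipLe b (l w) (l w₂) →
      (∀ h, x h u₂ + y h w₂ ≤ c h) → ∀ h, x h u + y h w ≤ c h := by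
  -- Without a common rising or falling index, the bounds at `h₁` and `g₂` are inherited from the
  -- pair `u₁`, `w₁`, and all others from `u₂`, `w₂`.
  by_cases hc : h₁ ≠ g₁ ∧ h₂ ≠ g₂
  · refine ⟨False, fun u w u₁ w₁ u₂ w₂ a1 a2 a3 b1 b2 b3 h => ?_⟩
    simp only [FlipLe, false_and, not_false_eq_true, true_and, false_or] at a2 b2
    by_cases hP : h = h₁ ∨ h = g₂
    · have e1 := (hx u u₁ a1).1 h (by grind)
      have e2 := (hy w₁ w a2).2 h (by grind)
      have := a3 h
      omega
    · have e1 := (hx u₂ u b1).2 h (by grind)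
      have e2 := (hy w w₂ b2).1 h (by grind)
      have := b3 h
      omega
  -- Reversing `W` exchanges `g₁` and `g₂`. Since `h₁ = g₁` or `h₂ = g₂`, now `h₁ ≠ g₂` and `h₂ ≠
  -- g₁`, as needed.
  · refine ⟨True, fun u w u₁ w₁ u₂ w₂ a1 a2 a3 b1 b2 b3 h => ?_⟩
    simp only [FlipLe, true_and, not_true_eq_false, false_and, or_false] at a2 b2
    by_cases hP : h = h₁ ∨ h = g₁
    · have e1 := (hx u u₁ a1).1 h (by grind)
      have e2 := (hy w w₁ a2).1 h (by grind)
      have := a3 h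
      omega
    · have e1 := (hx u₂ u b1).2 h (by grind)
      have e2 := (hy w₂ w b2).2 h (by grind)
      have := b3 h
      omega

variable (D) in
/-- Some pair of members of the classes of `u` and `v` that do not meet lies above `u` and below `v`. -/
def Cut (b : Prop) (u v : Fin n) : Prop :=
  ∃ u', D.cls u' = D.cls u ∧ D.key u ≤ D.key u' ∧ ∃ v', D.cls v' = D.cls v ∧
    FlipLe b (D.key v') (D.key v) ∧ ¬ D.Meets u' v'

variable (D) in
/-- Some pair of members of the classes of `u` and `v` that do not meet lies below `u` and above `v`. -/
def CoCut (b : Prop) (u v : Fin n) : Prop :=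
  ∃ u', D.cls u' = D.cls u ∧ D.key u' ≤ D.key u ∧ ∃ v', D.cls v' = D.cls v ∧
    FlipLe b (D.key v) (D.key v') ∧ ¬ D.Meets u' v'

/-- In the nontrivial cases disjointness is a conjunction of bounds on sums of runs or of
complementary runs, each class having two axes, so `exists_flip_of_axes` applies. -/
theorem Represents.exists_flip (hD : D.Represents G) (hm : 0 < m) {a c : Fin n}
    (hac : ¬ D.SameClass a c) : ∃ b : Prop, ∀ u v, D.SameClass u a → D.SameClass v c →
      D.Cut b u v → D.CoCut b u v → ¬ D.Meets u v := by
  obtain ⟨h₁, h₂, hh, hmon⟩ := hD.exists_monotone_axes hm a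
  obtain ⟨g₁, g₂, hg, gmon⟩ := hD.exists_monotone_axes hm c
  let U := {u // D.SameClass u a}
  let W := {v // D.SameClass v c}
  have finish : ∀ (x : Fin m × Bool → U → ℕ) (y : Fin m × Bool → W → ℕ) (k : Fin m × Bool → ℕ)
      (h₁ h₂ g₁ g₂ : Fin m × Bool), h₁ ≠ h₂ → g₁ ≠ g₂ →
      (∀ u u' : U, D.key u ≤ D.key u' →
        (∀ h, h ≠ h₂ → x h u ≤ x h u') ∧ ∀ h, h ≠ h₁ → x h u' ≤ x h u) →
      (∀ w w' : W, D.key w ≤ D.key w' →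
        (∀ h, h ≠ g₂ → y h w ≤ y h w') ∧ ∀ h, h ≠ g₁ → y h w' ≤ y h w) →
      (∀ (u : U) (w : W), ¬ D.Meets u w ↔ ∀ h, x h u + y h w ≤ k h) →
      ∃ b : Prop, ∀ u v, D.SameClass u a → D.SameClass v c →
        D.Cut b u v → D.CoCut b u v → ¬ D.Meets u v := by
    intro x y k h₁ h₂ g₁ g₂ hh hg hx hy hE
    obtain ⟨b, hb⟩ := exists_flip_of_axes x y k (fun u : U => D.key u) (fun w : W => D.key w) hh hg hx hy
    refine ⟨b, ?_⟩
    rintro u v hu hv ⟨u₁, hu₁, ku₁, v₁, hv₁, kv₁, hE₁⟩ ⟨u₂, hu₂, ku₂, v₂, hv₂, kv₂, hE₂⟩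
    rw [cls_eq_iff] at hu₁ hv₁ hu₂ hv₂
    exact (hE ⟨u, hu⟩ ⟨v, hv⟩).2 (hb ⟨u, hu⟩ ⟨v, hv⟩ ⟨u₁, hu₁.trans hu⟩ ⟨v₁, hv₁.trans hv⟩
      ⟨u₂, hu₂.trans hu⟩ ⟨v₂, hv₂.trans hv⟩ ku₁ kv₁ ((hE ⟨u₁, hu₁.trans hu⟩ ⟨v₁, hv₁.trans hv⟩).1 hE₁)
      ku₂ kv₂ ((hE ⟨u₂, hu₂.trans hu⟩ ⟨v₂, hv₂.trans hv⟩).1 hE₂))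
  have hle : ∀ (v : Fin n) (h : Fin m × Bool), D.run v h ≤ D.len h.1 := D.run_le
  by_cases ha : D.Branch a
  · have hau : ∀ u : U, D.Branch u := fun u => u.2.1.branch_iff.2 ha
    by_cases hc : D.Branch c
    · have hcw : ∀ w : W, D.Branch w := fun w => w.2.1.branch_iff.2 hc
      by_cases hno : ∃ h, D.side a h 0 ∧ D.side c h 0
      · obtain ⟨h, h1, h2⟩ := hno
        refine ⟨False, ?_⟩
        rintro u v hu hv ⟨u₁, hu₁, -, v₁, hv₁, -, hE₁⟩ -
        rw [cls_eq_iff] at hu₁ hv₁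
        exact absurd (meets_of_side (j := 0) (by omega) (((hu₁.trans hu).1.side_zero_iff h).2 h1)
          (((hv₁.trans hv).1.side_zero_iff h).2 h2)) hE₁
      · push Not at hno
        -- Overlap compares runs from opposite ends, so the runs of the second class are indexed by
        -- the opposite half-edge.
        let bar : Fin m × Bool → Fin m × Bool := fun h => (h.1, !h.2)
        have hbar : ∀ h, bar (bar h) = h := fun h => by simp [bar]
        have hne : ∀ {h g}, h ≠ bar g → bar h ≠ g := fun {h g} hn he => hn (by rw [← he, hbar])
        refine finish (fun h u => D.run u h) (fun h w => D.run w (bar h)) (fun h => D.len h.1) h₁ h₂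
          (bar g₁) (bar g₂) hh (fun he => hg (by rw [← hbar g₁, he, hbar]))
          (fun u u' hk => hmon u u' u.2 u'.2 hk)
          (fun w w' hk => ⟨fun h hn => (gmon w w' w.2 w'.2 hk).1 _ (hne hn),
            fun h hn => (gmon w w' w.2 w'.2 hk).2 _ (hne hn)⟩)
          fun u w => hD.meets_iff_of_branch (hau u) (hcw w) fun h hh => ?_
        exact hno h ((u.2.1.side_zero_iff h).1 hh.1) ((w.2.1.side_zero_iff h).1 hh.2)
    · have hcw : ∀ w : W, ¬ D.Branch w := fun w hb => hc (w.2.1.branch_iff.1 hb)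
      -- Disjointness is now `run u h ≤ run w h`. Passing to `len - run` reverses monotonicity, so
      -- the axes of the second class change places.
      refine finish (fun h u => D.run u h) (fun h w => D.len h.1 - D.run w h) (fun h => D.len h.1) h₁ h₂
        g₂ g₁ hh (Ne.symm hg) (fun u u' hk => hmon u u' u.2 u'.2 hk) (fun w w' hk => ⟨?_, ?_⟩) ?_
      · exact fun h hn => Nat.sub_le_sub_left ((gmon w w' w.2 w'.2 hk).2 h hn) _
      · exact fun h hn => Nat.sub_le_sub_left ((gmon w w' w.2 w'.2 hk).1 h hn) _
      · intro u w
        rw [hD.meets_iff_of_branch_of_not (hau u) (hcw w)]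
        refine forall_congr' fun h => ?_
        have h1 := hle u h
        have h2 := hle w h
        omega
  · have hau : ∀ u : U, ¬ D.Branch u := fun u hb => ha (u.2.1.branch_iff.1 hb)
    by_cases hc : D.Branch c
    · have hcw : ∀ w : W, D.Branch w := fun w => w.2.1.branch_iff.2 hc
      refine finish (fun h u => D.len h.1 - D.run u h) (fun h w => D.run w h) (fun h => D.len h.1) h₂ h₁
        g₁ g₂ (Ne.symm hh) hg (fun u u' hk => ⟨?_, ?_⟩) (fun w w' hk => gmon w w' w.2 w'.2 hk) ?_
      · exact fun h hn => Nat.sub_le_sub_left ((hmon u u' u.2 u'.2 hk).2 h hn) _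
      · exact fun h hn => Nat.sub_le_sub_left ((hmon u u' u.2 u'.2 hk).1 h hn) _
      · intro u w
        have hcomm : D.Meets u w ↔ D.Meets w u := ⟨Meets.symm, Meets.symm⟩
        rw [hcomm, hD.meets_iff_of_branch_of_not (hcw w) (hau u)]
        refine forall_congr' fun h => ?_
        have h1 := hle u h
        have h2 := hle w h
        omega
    -- Two vertices that are not branch vertices and meet on an edge would be in the same class.
    · refine ⟨False, ?_⟩
      rintro u v hu hv - - ⟨e, i, hi, h1, h2⟩
      have hub : ¬ D.Branch u := fun hb => ha (hu.1.branch_iff.1 hb)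
      have hvb : ¬ D.Branch v := fun hb => hc (hv.1.branch_iff.1 hb)
      have hue : ¬ D.Full u e := fun hf => hub ((hf i hi).1 h1)
      have hve : ¬ D.Full v e := fun hf => hvb ((hf i hi).1 h2)
      refine hac (hu.symm.trans (SameClass.trans ⟨fun e' => ⟨?_, ?_, ?_⟩, fun hb => absurd hb hub⟩ hv))
      · simp [side_zero_false hub, side_zero_false hvb]
      · simp [side_zero_false hub, side_zero_false hvb]
      · by_cases he : e' = e
        · subst he
          exact iff_of_false hue hve
        · exact iff_of_true (hD.exists_edge hub hue e' he) (hD.exists_edge hvb hve e' he)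

variable (D) in
/-- The second of the classes `i` and `j` has to be reversed. -/
def Flip (i j : ℕ) : Prop :=
  ∃ u, D.cls u = i ∧ ∃ v, D.cls v = j ∧ D.Cut False u v ∧ D.CoCut False u v ∧ D.Meets u v

variable (D) in
/-- The order on the union of the classes `i` and `j`. -/
def Before (i j : ℕ) (u v : Fin n) : Prop :=
  (D.cls u = i ∧ D.cls v = i ∧ D.Lo u v) ∨
  (D.cls u = i ∧ D.cls v ≠ i ∧ D.Cut (D.Flip i j) u v) ∨
  (D.cls u ≠ i ∧ D.cls v = i ∧ ¬ D.Cut (D.Flip i j) v u) ∨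
  (D.cls u ≠ i ∧ D.cls v ≠ i ∧ (D.Flip i j ∧ D.Lo v u ∨ ¬ D.Flip i j ∧ D.Lo u v))

/-! ### The merged order on two classes -/

theorem Lo.key_le {u v : Fin n} (h : D.Lo u v) : D.key u ≤ D.key v := by
  rcases h with h | h
  · exact h.le
  · exact h.1.le

theorem Lo.trans {u v w : Fin n} (h : D.Lo u v) (h' : D.Lo v w) : D.Lo u w := by
  unfold Lo at *; omega

theorem Lo.ne {u v : Fin n} (h : D.Lo u v) : u ≠ v := by
  rintro rfl; unfold Lo at h; omega

theorem lo_total {u v : Fin n} (h : u ≠ v) : D.Lo u v ∨ D.Lo v u := by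
  unfold Lo; omega

theorem Cut.of_le {b : Prop} {u u' v v' : Fin n} (h : D.Cut b u v) (hu : D.cls u' = D.cls u)
    (hv : D.cls v' = D.cls v) (ku : D.key u' ≤ D.key u) (kv : FlipLe b (D.key v) (D.key v')) :
    D.Cut b u' v' := by
  obtain ⟨x, hx, kx, y, hy, ky, hE⟩ := h
  refine ⟨x, hx.trans hu.symm, ku.trans kx, y, hy.trans hv.symm, ?_, hE⟩
  unfold FlipLe at *
  rcases ky with ky | ky <;> rcases kv with kv | kv
  · exact Or.inl ⟨ky.1, kv.2.trans ky.2⟩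
  · exact absurd ky.1 kv.1
  · exact absurd kv.1 ky.1
  · exact Or.inr ⟨ky.1, ky.2.trans kv.2⟩

/-- `Flip` asserts a counterexample to the unreversed merge, and if there is one, `exists_flip`
leaves only the reversed merge. Thus the right orientation can be found by search. -/
theorem Represents.not_meets_of_cuts (hD : D.Represents G) (hm : 0 < m) {u v : Fin n}
    (huv : D.cls u ≠ D.cls v) (h1 : D.Cut (D.Flip (D.cls u) (D.cls v)) u v)
    (h2 : D.CoCut (D.Flip (D.cls u) (D.cls v)) u v) : ¬ D.Meets u v := by
  obtain ⟨b, hb⟩ := hD.exists_flip hm (fun h => huv (cls_eq_iff.2 h))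
  by_cases hf : D.Flip (D.cls u) (D.cls v)
  · have hbt : b = True := by
      by_contra hne
      have hbf : b = False := by simpa using hne
      subst hbf
      obtain ⟨x, hx, y, hy, hc1, hc2, hM⟩ := hf
      exact hb x y (cls_eq_iff.1 hx) (cls_eq_iff.1 hy) hc1 hc2 hM
    subst hbt
    rw [eq_true hf] at h1 h2
    exact hb u v (.refl u) (.refl v) h1 h2
  · rw [eq_false hf] at h1 h2
    intro hM
    exact hf ⟨u, rfl, v, rfl, h1, h2, hM⟩

/-- Adjacency at an isolated vertex of `H` occurs only among degenerate vertices, and these form a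
single class. -/
theorem Represents.adj_iff_meets (hD : D.Represents G) {u v : Fin n} (h : D.cls u ≠ D.cls v) :
    G.Adj u v ↔ D.Meets u v := by
  rw [hD.adj_iff u v (by rintro rfl; exact h rfl)]
  refine ⟨fun hh => hh.resolve_right ?_, Or.inl⟩
  rintro ⟨hu, hv, -⟩
  refine h (cls_eq_iff.2 ⟨fun e => ⟨?_, ?_, ?_⟩, fun hb => absurd hb hu.1⟩)
  · simp [side_zero_false hu.1, side_zero_false hv.1]
  · simp [side_zero_false hu.1, side_zero_false hv.1]
  · exact iff_of_true (hu.2 e) (hv.2 e)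

theorem before_self {i : ℕ} {u v : Fin n} (hu : D.cls u = i) (hv : D.cls v = i) (j : ℕ) :
    D.Before i j u v ↔ D.Lo u v := by
  simp [Before, hu, hv]

theorem before_second {i j : ℕ} (hij : i ≠ j) {u v : Fin n} (hu : D.cls u = j) (hv : D.cls v = j) :
    D.Before i j u v ↔ (D.Flip i j ∧ D.Lo v u ∨ ¬ D.Flip i j ∧ D.Lo u v) := by
  simp [Before, hu, hv, Ne.symm hij]

theorem before_mixed {i j : ℕ} (hij : i ≠ j) {u v : Fin n} (hu : D.cls u = i) (hv : D.cls v = j) :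
    D.Before i j u v ↔ D.Cut (D.Flip i j) u v := by
  simp [Before, hu, hv, Ne.symm hij]

theorem before_mixed' {i j : ℕ} (hij : i ≠ j) {u v : Fin n} (hu : D.cls u = j) (hv : D.cls v = i) :
    D.Before i j u v ↔ ¬ D.Cut (D.Flip i j) v u := by
  simp [Before, hu, hv, Ne.symm hij]

theorem flipLe_of_before {i j : ℕ} (hij : i ≠ j) {u v : Fin n} (hu : D.cls u = j) (hv : D.cls v = j)
    (h : D.Before i j u v) : FlipLe (D.Flip i j) (D.key u) (D.key v) := by
  rw [before_second hij hu hv] at h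
  exact h.imp (And.imp_right Lo.key_le) (And.imp_right Lo.key_le)

/-- Both classes are chains, and `Cut` passes to smaller first and larger second arguments, so the
relation merges two chains. -/
theorem isStrictLinearOrderOn_before (i j : ℕ) :
    IsStrictLinearOrderOn {v | D.cls v = i ∨ D.cls v = j} (D.Before i j) := by
  by_cases hij : i = j
  · subst hij
    simp only [or_self, IsStrictLinearOrderOn, Set.mem_ofPred_eq]
    refine ⟨fun u hu h => ?_, fun u hu v hv w hw h1 h2 => ?_, fun u hu v hv hne => ?_⟩
    · exact ((before_self hu hu i).1 h).ne rfl
    · rw [before_self hu hv] at h1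
      rw [before_self hv hw] at h2
      exact (before_self hu hw i).2 (h1.trans h2)
    · rw [before_self hu hv, before_self hv hu]
      exact lo_total hne
  have kle : ∀ {u v : Fin n}, D.cls u = i → D.cls v = i → D.Before i j u v → D.key u ≤ D.key v :=
    fun hu hv h => ((before_self hu hv j).1 h).key_le
  have cut_left : ∀ {u u' v : Fin n}, D.cls u = i → D.cls u' = i → D.cls v = j → D.Before i j u u' →
      D.Cut (D.Flip i j) u' v → D.Cut (D.Flip i j) u v := fun hu hu' _ h hc =>
    hc.of_le (hu.trans hu'.symm) rfl (kle hu hu' h) (by unfold FlipLe; tauto)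
  have cut_right : ∀ {u v v' : Fin n}, D.cls u = i → D.cls v = j → D.cls v' = j → D.Before i j v v' →
      D.Cut (D.Flip i j) u v → D.Cut (D.Flip i j) u v' := fun _ hv hv' h hc =>
    hc.of_le rfl (hv'.trans hv.symm) le_rfl (flipLe_of_before hij hv hv' h)
  refine ⟨fun u hu h => ?_, fun u hu v hv w hw h1 h2 => ?_, fun u hu v hv hne => ?_⟩
  · rcases hu with hu | hu
    · exact ((before_self hu hu j).1 h).ne rfl
    · rw [before_second hij hu hu] at h
      rcases h with h | h
      · exact h.2.ne rfl
      · exact h.2.ne rfl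
  · rcases hu with hu | hu <;> rcases hv with hv | hv <;> rcases hw with hw | hw
    · rw [before_self hu hv] at h1
      rw [before_self hv hw] at h2
      exact (before_self hu hw j).2 (h1.trans h2)
    · rw [before_mixed hij hv hw] at h2
      exact (before_mixed hij hu hw).2 (cut_left hu hv hw h1 h2)
    · rw [before_mixed hij hu hv] at h1
      rw [before_mixed' hij hv hw] at h2
      rw [before_self hu hw]
      by_contra hc
      rcases eq_or_ne u w with rfl | hne
      · exact h2 h1
      · exact h2 (cut_left hw hu hv ((before_self hw hu j).2 ((lo_total hne).resolve_left hc)) h1)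
    · rw [before_mixed hij hu hv] at h1
      exact (before_mixed hij hu hw).2 (cut_right hu hv hw h2 h1)
    · rw [before_mixed' hij hu hv] at h1
      exact (before_mixed' hij hu hw).2 fun hc => h1 (cut_left hv hw hu h2 hc)
    · rw [before_mixed' hij hu hv] at h1
      rw [before_mixed hij hv hw] at h2
      by_contra hc
      rcases eq_or_ne u w with rfl | hne
      · exact h1 h2
      · refine h1 (cut_right hv hw hu ?_ h2)
        rw [before_second hij hu hw] at hc
        rw [before_second hij hw hu]
        have := lo_total (D := D) hne
        tauto
    · rw [before_mixed' hij hv hw] at h2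
      exact (before_mixed' hij hu hw).2 fun hc => h2 (cut_right hw hu hv h1 hc)
    · rw [before_second hij hu hv] at h1
      rw [before_second hij hv hw] at h2
      rw [before_second hij hu hw]
      rcases h1 with h1 | h1 <;> rcases h2 with h2 | h2
      · exact Or.inl ⟨h1.1, h2.2.trans h1.2⟩
      · exact absurd h1.1 h2.1
      · exact absurd h2.1 h1.1
      · exact Or.inr ⟨h1.1, h1.2.trans h2.2⟩
  · rcases hu with hu | hu <;> rcases hv with hv | hv
    · rw [before_self hu hv, before_self hv hu]
      exact lo_total hne
    · rw [before_mixed hij hu hv, before_mixed' hij hv hu]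
      exact em _
    · rw [before_mixed' hij hu hv, before_mixed hij hv hu]
      exact (em _).symm
    · rw [before_second hij hu hv, before_second hij hv hu]
      have := lo_total (D := D) hne
      tauto

/-- The proper mixed-thin representation given by a path model. -/
noncomputable def Represents.rep (hD : D.Represents G) (hm : 0 < m) :
    ProperMixedThinRep G (thinnessBound m) where
  cls v := ⟨D.cls v, hD.cls_lt_thinnessBound hm v⟩
  lt i j := D.Before i j
  sign i j := decide (i = j)
  linear i j _ := by
    simpa [Fin.ext_iff] using isStrictLinearOrderOn_before (D := D) i j
  al_left i j _ := by
    refine Or.inl fun u hu v hv => ?_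
    simp only [Set.mem_ofPred_eq, Fin.ext_iff] at hu hv
    rw [before_self hu hv, before_self hu hv]
  al_right i j _ := by
    by_cases hij : (i : ℕ) = j
    · refine Or.inl fun u hu v hv => ?_
      rw [hij]
    by_cases hf : D.Flip i j
    · refine Or.inr fun u hu v hv => ?_
      simp only [Set.mem_ofPred_eq, Fin.ext_iff] at hu hv
      rw [before_second hij hu hv, before_self hv hu]
      simp [hf]
    · refine Or.inl fun u hu v hv => ?_
      simp only [Set.mem_ofPred_eq, Fin.ext_iff] at hu hv
      rw [before_second hij hu hv, before_self hu hv]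
      simp [hf]
  co i j _ u v w h h1 h2 h3 := by
    simp only [Fin.ext_iff] at h
    by_cases hij : (i : ℕ) = j
    · have hij' : i = j := Fin.ext hij
      subst hij'
      simp only [decide_true, SignedAdj, if_true, or_self] at h h3 ⊢
      obtain ⟨hu, hv, hw⟩ := h
      rw [before_self hu hv] at h1
      rw [before_self hv hw] at h2
      exact (hD.adj_of_between hm (cls_eq_iff.1 (hu.trans hv.symm)) (cls_eq_iff.1 (hw.trans hv.symm))
        h1.key_le h2.key_le h1.ne h2.ne (h1.trans h2).ne h3).2
    have hij' : i ≠ j := fun h => hij (congrArg _ h)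
    simp only [SignedAdj, hij', decide_false, Bool.false_eq_true, if_false, SimpleGraph.compl_adj] at h3 ⊢
    rcases h with ⟨hu, hv, hw⟩ | ⟨hu, hv, hw⟩
    · have hvw : D.cls v ≠ D.cls w := by rw [hv, hw]; exact hij
      have huw : D.cls u ≠ D.cls w := by rw [hu, hw]; exact hij
      refine ⟨fun he => hvw (by rw [he]), ?_⟩
      rw [hD.adj_iff_meets huw] at h3
      rw [before_mixed hij hv hw] at h2
      rw [before_self hu hv] at h1
      rw [hD.adj_iff_meets hvw]
      -- The order of `v` and `w` supplies the cut, and the non-edge `uw` itself witnesses the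
      -- cocut.
      refine hD.not_meets_of_cuts hm hvw (by rwa [hv, hw]) ⟨u, hu.trans hv.symm, h1.key_le, w, rfl, ?_, h3.2⟩
      unfold FlipLe; tauto
    -- The non-edge `uw` would witness a cut for `w` and `v`, which puts `w` before `v`.
    · exfalso
      have huw : D.cls w ≠ D.cls u := by rw [hu, hw]; exact hij
      rw [SimpleGraph.adj_comm, hD.adj_iff_meets huw] at h3
      rw [before_mixed' hij hv hw] at h2
      exact h2 ⟨w, rfl, le_rfl, u, hu.trans hv.symm, flipLe_of_before hij hu hv h1, h3.2⟩
  sc i j _ u v w h h1 h2 h3 := by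
    simp only [Fin.ext_iff] at h
    by_cases hij : (i : ℕ) = j
    · have hij' : i = j := Fin.ext hij
      subst hij'
      simp only [decide_true, SignedAdj, if_true, or_self] at h h3 ⊢
      obtain ⟨hv, hw, hu⟩ := h
      rw [before_self hu hv] at h1
      rw [before_self hv hw] at h2
      exact (hD.adj_of_between hm (cls_eq_iff.1 (hu.trans hv.symm)) (cls_eq_iff.1 (hw.trans hv.symm))
        h1.key_le h2.key_le h1.ne h2.ne (h1.trans h2).ne h3).1
    have hij' : i ≠ j := fun h => hij (congrArg _ h)
    simp only [SignedAdj, hij', decide_false, Bool.false_eq_true, if_false, SimpleGraph.compl_adj] at h3 ⊢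
    rcases h with ⟨hv, hw, hu⟩ | ⟨hv, hw, hu⟩
    · exfalso
      have huw : D.cls w ≠ D.cls u := by rw [hu, hw]; exact hij
      rw [SimpleGraph.adj_comm, hD.adj_iff_meets huw] at h3
      rw [before_mixed' hij hu hv] at h1
      rw [before_self hv hw] at h2
      exact h1 ⟨w, hw.trans hv.symm, h2.key_le, u, rfl, by unfold FlipLe; tauto, h3.2⟩
    · have huv : D.cls u ≠ D.cls v := by rw [hu, hv]; exact hij
      have huw : D.cls u ≠ D.cls w := by rw [hu, hw]; exact hij
      refine ⟨fun he => huv (by rw [he]), ?_⟩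
      rw [hD.adj_iff_meets huw] at h3
      rw [before_mixed hij hu hv] at h1
      rw [hD.adj_iff_meets huv]
      have hfl := flipLe_of_before hij hv hw h2
      exact hD.not_meets_of_cuts hm huv (by rwa [hu, hv])
        ⟨u, rfl, le_rfl, w, hw.trans hv.symm, by rwa [hu, hv], h3.2⟩

end PathModel

/-! ### The path model of a representation -/

namespace Graph.Subdivision

variable {α β : Type*} {H : Graph α β} (T : H.Subdivision)

theorem pathVertex_eq_inr_iff {b c : β} {i l : ℕ} :
    T.pathVertex b i = Sum.inr (c, l) ↔ b = c ∧ i = l ∧ 1 ≤ l ∧ l ≤ T.len b := by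
  unfold pathVertex
  split_ifs with h0 h1
  · simp only [false_iff]; omega
  · simp only [Sum.inr.injEq, Prod.mk.injEq]
    constructor
    · rintro ⟨rfl, rfl⟩; exact ⟨rfl, rfl, by omega, h1⟩
    · rintro ⟨rfl, rfl, -, -⟩; exact ⟨rfl, rfl⟩
  · simp only [false_iff]; omega

theorem pathVertex_interior {b : β} {i : ℕ} (h1 : 1 ≤ i) (h2 : i ≤ T.len b) :
    T.pathVertex b i = Sum.inr (b, i) := T.pathVertex_eq_inr_iff.2 ⟨rfl, rfl, h1, h2⟩

/-- A connected set that contains a vertex of a path, but not the vertices at some positions before and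
after it, is contained in the path between these positions. -/
theorem subset_of_trapped {Y : Set (α ⊕ β × ℕ)} (hY : T.graph.IsConnectedSet Y) {b : β} {i j k : ℕ}
    (hji : j < i) (hik : i < k) (hk : k ≤ T.len b + 1) (hj : T.pathVertex b j ∉ Y)
    (hk' : T.pathVertex b k ∉ Y) (hi : T.pathVertex b i ∈ Y) :
    ∀ y ∈ Y, ∃ l, j < l ∧ l < k ∧ y = T.pathVertex b l := by
  intro y hy
  -- A walk inside `Y` stays between the barriers, since an internal vertex has only the
  -- neighbouring positions of its own path as neighbours.
  induction hY.2 _ hi y hy with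
  | refl => exact ⟨i, hji, hik, rfl⟩
  | @tail a c _ hac ih =>
    obtain ⟨l, hl1, hl2, rfl⟩ := ih hac.1
    obtain ⟨-, hc, f, -, hf, hlink⟩ := hac
    rw [T.pathVertex_interior (by omega) (by omega)] at hlink
    rcases hlink with ⟨h1, rfl⟩ | ⟨rfl, h1⟩
    · obtain ⟨hb, hf2, -⟩ := T.pathVertex_eq_inr_iff.1 h1.symm
      rw [hb, hf2] at hc ⊢
      refine ⟨l + 1, by omega, ?_, rfl⟩
      by_contra hcon
      obtain rfl : l + 1 = k := by omega
      exact hk' hc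
    · obtain ⟨hb, hf2, -⟩ := T.pathVertex_eq_inr_iff.1 h1.symm
      obtain rfl : l = f.2 + 1 := hf2.symm
      rw [hb] at hc ⊢
      refine ⟨f.2, ?_, by omega, rfl⟩
      by_contra hcon
      obtain rfl : f.2 = j := by omega
      exact hj hc

/-- A connected set that contains a vertex on no path is a singleton. -/
theorem eq_singleton_of_isolated {Y : Set (α ⊕ β × ℕ)} (hY : T.graph.IsConnectedSet Y)
    {x : α ⊕ β × ℕ} (hx : x ∈ Y) (hiso : ∀ b ∈ H.edgeSet, ∀ i < T.len b + 2, T.pathVertex b i ≠ x) :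
    Y = {x} := by
  refine Set.eq_singleton_iff_unique_mem.2 ⟨hx, fun y hy => ?_⟩
  rcases (hY.2 x hx y hy).cases_head with rfl | ⟨c, ⟨-, -, f, hf, hf2, hl⟩, -⟩
  · rfl
  · exfalso
    rcases hl with ⟨rfl, -⟩ | ⟨-, rfl⟩
    · exact hiso _ hf _ (by omega) rfl
    · exact hiso _ hf _ (by omega) rfl

end Graph.Subdivision

namespace HRepresentation

variable {α β : Type*} {n m : ℕ} {H : Graph α β} {G : SimpleGraph (Fin n)} (S : HRepresentation H G)
  (ε : Fin m → β) (tag : Fin n → ℕ)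

/-- The path model of a representation, for an enumeration `ε` of the edges. -/
def model : PathModel n m where
  len e := S.framework.len (ε e)
  mem v e i := S.framework.pathVertex (ε e) i ∈ S.rep v
  tag := tag

open PathModel

variable {S ε tag}

theorem model_side_iff {v : Fin n} {e : Fin m} {s : Bool} {j : ℕ} :
    (S.model ε tag).side v (e, s) j ↔
      S.framework.pathVertex (ε e) ((S.model ε tag).coord e s j) ∈ S.rep v := Iff.rfl

/-! ### Consequences of connectedness and non-crossing -/

theorem subset_of_trapped_side {Y : Set (α ⊕ β × ℕ)} (hY : S.framework.graph.IsConnectedSet Y)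
    {e : Fin m} {s : Bool} {i j k : ℕ} (hji : j < i) (hik : i < k) (hk : k ≤ (S.model ε tag).len e + 1)
    (hj : S.framework.pathVertex (ε e) ((S.model ε tag).coord e s j) ∉ Y)
    (hk' : S.framework.pathVertex (ε e) ((S.model ε tag).coord e s k) ∉ Y)
    (hi : S.framework.pathVertex (ε e) ((S.model ε tag).coord e s i) ∈ Y) :
    ∀ y ∈ Y, ∃ l, j < l ∧ l < k ∧
      y = S.framework.pathVertex (ε e) ((S.model ε tag).coord e s l) := by
  have hlen : S.framework.len (ε e) = (S.model ε tag).len e := rfl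
  cases s
  · exact S.framework.subset_of_trapped hY hji hik hk hj hk' hi
  · simp only [coord, if_true] at hj hk' hi ⊢
    intro y hy
    obtain ⟨l, h1, h2, rfl⟩ := S.framework.subset_of_trapped hY (by omega) (by omega) (by omega) hk' hj hi y hy
    refine ⟨(S.model ε tag).len e + 1 - l, by omega, by omega, ?_⟩
    congr 1
    omega

theorem coord_lt {D : PathModel n m} {e : Fin m} {s : Bool} {j : ℕ} (hj : j < D.len e + 2) :
    D.coord e s j < D.len e + 2 := by
  unfold coord; split_ifs <;> omega

theorem coord_coord {D : PathModel n m} {e : Fin m} {s : Bool} {j : ℕ} (hj : j < D.len e + 2) :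
    D.coord e s (D.coord e s j) = j := by
  unfold coord; split_ifs <;> omega

theorem full_of_side {D : PathModel n m} {v : Fin n} {e : Fin m} {s : Bool} (hv : D.Branch v)
    (h : ∀ j < D.len e + 2, D.side v (e, s) j) : D.Full v e := by
  intro j hj
  refine iff_of_true ?_ hv
  have h1 : D.mem v e (D.coord e s (D.coord e s j)) := h (D.coord e s j) (coord_lt hj)
  rwa [coord_coord hj] at h1

/-- Each excess of `u` over `v` confines the connected set `X_u \ X_v` to a segment at its
half-edge. Two excesses therefore share an edge, and if they came from opposite ends, the two runs
of `u` would cover the whole path, which is then full for both vertices. -/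
theorem model_single_of_branch (hconn : S.IsNonCrossing) (hinj : Function.Injective ε) {u v : Fin n} {h h' : Fin m × Bool}
    (huv : (S.model ε tag).SameType u v) (hu : (S.model ε tag).Branch u)
    (h1 : (S.model ε tag).run v h < (S.model ε tag).run u h)
    (h2 : (S.model ε tag).run v h' < (S.model ε tag).run u h') : h = h' := by
  set D := S.model ε tag with hDdef
  have hv : D.Branch v := huv.branch_iff.1 hu
  have notfull : ∀ {e s}, D.run v (e, s) < D.run u (e, s) → ¬ D.Full u e := by
    intro e s hlt hf
    have h1 := ((huv e).2.2.1 hf).run_eq s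
    have h2 := hf.run_eq s
    omega
  have trap : ∀ {e s}, D.run v (e, s) < D.run u (e, s) →
      (S.framework.pathVertex (ε e) (D.coord e s (D.run v (e, s) + 1)) ∈ S.rep u \ S.rep v) ∧
      ∀ y ∈ S.rep u \ S.rep v, ∃ l, D.run v (e, s) < l ∧ l < D.run u (e, s) + 1 ∧
        y = S.framework.pathVertex (ε e) (D.coord e s l) := by
    intro e s hlt
    have hub : D.run u (e, s) ≤ D.len e := D.run_le u (e, s)
    have hu0 : D.side u (e, s) 0 :=
      ((le_run_iff (v := u) (h := (e, s)) (i := 1) le_rfl (by dsimp; omega)).1 (by omega) 0 (by omega)).2 hu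
    have hv0 : D.side v (e, s) 0 := (huv.side_zero_iff _).1 hu0
    have hA : D.side v (e, s) (D.run v (e, s)) := by
      rcases Nat.eq_zero_or_pos (D.run v (e, s)) with h0 | h0
      · rw [h0]; exact hv0
      · exact side_of_le_run hv h0 le_rfl
    have hB : D.side u (e, s) (D.run v (e, s) + 1) := side_of_le_run hu (by omega) hlt
    have hC : ¬ D.side v (e, s) (D.run v (e, s) + 1) := fun hc =>
      not_side_run (iff_of_true hv0 hv) (by dsimp; omega) (iff_of_true hc hv)
    have hK : ¬ D.side u (e, s) (D.run u (e, s) + 1) := by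
      intro hc
      rcases hub.lt_or_eq with hl | hl
      · exact not_side_run (iff_of_true hu0 hu) hl (iff_of_true hc hu)
      · refine notfull hlt (full_of_side (s := s) hu fun j hj => ?_)
        rcases Nat.eq_zero_or_pos j with rfl | hj0
        · exact hu0
        · rcases Nat.lt_or_ge j (D.len e + 1) with hj1 | hj1
          · exact side_of_le_run hu hj0 (by omega)
          · obtain rfl : j = D.run u (e, s) + 1 := by omega
            exact hc
    have hmem : S.framework.pathVertex (ε e) (D.coord e s (D.run v (e, s) + 1)) ∈ S.rep u \ S.rep v :=
      ⟨hB, hC⟩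
    exact ⟨hmem, subset_of_trapped_side (ε := ε) (tag := tag) (hconn u v) (Nat.lt_succ_self _) (by omega)
      (by change _ ≤ D.len e + 1; omega) (fun hc => hc.2 hA) (fun hc => hK hc.1) hmem⟩
  rcases h with ⟨e, s⟩
  rcases h' with ⟨e', s'⟩
  obtain ⟨hy, -⟩ := trap h1
  obtain ⟨l, hl1, hl2, heq⟩ := (trap h2).2 _ hy
  have r1 : D.run u (e, s) ≤ D.len e := D.run_le u (e, s)
  have r2 : D.run u (e', s') ≤ D.len e' := D.run_le u (e', s')
  have c1 : 1 ≤ D.coord e s (D.run v (e, s) + 1) ∧ D.coord e s (D.run v (e, s) + 1) ≤ D.len e := by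
    unfold coord; split_ifs <;> omega
  rw [S.framework.pathVertex_interior c1.1 c1.2] at heq
  obtain ⟨hee, hc, -⟩ := S.framework.pathVertex_eq_inr_iff.1 heq.symm
  obtain rfl := hinj hee
  by_cases hs : s = s'
  · rw [hs]
  exfalso
  have hs' : s' = !s := Bool.eq_not_iff.2 (Ne.symm hs)
  subst hs'
  have hl : l = D.len e' - D.run v (e', s) := by
    unfold coord at hc
    cases s <;> simp at hc <;> omega
  refine notfull h1 (full_of_side (s := s) hu fun j hj => ?_)
  have side_le : ∀ {s j}, D.run v (e', s) < D.run u (e', s) → j ≤ D.run u (e', s) → D.side u (e', s) j := by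
    intro s j hlt hj
    have hle : D.run u (e', s) ≤ D.len e' := D.run_le u (e', s)
    exact ((le_run_iff (v := u) (h := (e', s)) (by omega) (by dsimp; omega)).1 le_rfl j hj).2 hu
  by_cases hj' : j ≤ D.run u (e', s)
  · exact side_le h1 hj'
  · rw [← side_mirror hj]
    exact side_le h2 (by omega)

/-- A longer run of `u` means that the interval of `v` sticks out towards that end. If it did so on
both sides, a position of `X_u` would separate `X_v \ X_u`. -/
theorem model_single_of_not_branch (hconn : S.IsNonCrossing) {u v : Fin n} {h h' : Fin m × Bool}
    (huniq : ∀ v e i e' i', ¬ (S.model ε tag).Branch v → i < (S.model ε tag).len e + 2 →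
      i' < (S.model ε tag).len e' + 2 → (S.model ε tag).mem v e i → (S.model ε tag).mem v e' i' → e = e')
    (huv : (S.model ε tag).SameType u v) (hu : ¬ (S.model ε tag).Branch u)
    (h1 : (S.model ε tag).run v h < (S.model ε tag).run u h)
    (h2 : (S.model ε tag).run v h' < (S.model ε tag).run u h') : h = h' := by
  set D := S.model ε tag with hDdef
  have hv : ¬ D.Branch v := fun hb => hu (huv.branch_iff.2 hb)
  have point : ∀ {e s}, D.run v (e, s) < D.run u (e, s) → D.side v (e, s) (D.run v (e, s) + 1) ∧
      ¬ D.side u (e, s) (D.run v (e, s) + 1) := by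
    intro e s hlt
    have hub : D.run u (e, s) ≤ D.len e := D.run_le u (e, s)
    refine ⟨side_run_succ hv (by dsimp; omega), fun hc => hu ?_⟩
    exact ((le_run_iff (v := u) (h := (e, s)) (i := D.run v (e, s) + 1) (by omega)
      (by dsimp; omega)).1 hlt _ le_rfl).1 hc
  rcases h with ⟨e, s⟩
  rcases h' with ⟨e', s'⟩
  have r1 : D.run u (e, s) ≤ D.len e := D.run_le u (e, s)
  have r2 : D.run u (e', s') ≤ D.len e' := D.run_le u (e', s')
  obtain rfl : e = e' := huniq v e _ e' _ hv (coord_lt (D := D) (s := s) (by omega))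
    (coord_lt (D := D) (s := s') (by omega)) (point h1).1 (point h2).1
  by_cases hs : s = s'
  · rw [hs]
  exfalso
  have hs' : s' = !s := Bool.eq_not_iff.2 (Ne.symm hs)
  subst hs'
  have hnf : ¬ D.Full u e := by
    intro hf
    have hf' := ((huv e).2.2.1 hf _ (coord_lt (D := D) (s := s) (j := D.run v (e, s) + 1) (by omega)))
    exact hv (hf'.1 (point h1).1)
  simp only [Full, hu, iff_false] at hnf
  push Not at hnf
  obtain ⟨k, hk, hmk⟩ := hnf
  have hk1 := run_lt_coord hu hk hmk s
  have hk2 := run_lt_coord hu hk hmk (!s)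
  obtain ⟨k1, k2⟩ := interior_of_mem hu hk hmk
  have hcc : D.coord e (!s) k = D.len e + 1 - D.coord e s k := by
    unfold coord; cases s <;> simp; omega
  have hcl : D.coord e s k < D.len e + 2 := coord_lt hk
  have trap := subset_of_trapped_side (ε := ε) (tag := tag) (e := e) (s := s) (hconn v u) (j := 0)
    (i := D.run v (e, s) + 1) (k := D.coord e s k) (by omega) (by omega)
    (by change _ ≤ D.len e + 1; omega)
    (fun hc => side_zero_false hv (e, s) hc.1) (fun hc => hc.2 ?_) ⟨(point h1).1, (point h1).2⟩
  · obtain ⟨l, l1, l2, heq⟩ := trap _ ⟨(point h2).1, (point h2).2⟩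
    have c1 : 1 ≤ D.coord e s l ∧ D.coord e s l ≤ D.len e := by
      unfold coord; split_ifs <;> omega
    rw [← hDdef, S.framework.pathVertex_interior c1.1 c1.2] at heq
    obtain ⟨-, hc, -⟩ := S.framework.pathVertex_eq_inr_iff.1 heq
    unfold coord at hc hk1 hk2 l2 hcl
    cases s <;> simp at hc hk1 hk2 l2 h2 hcl <;> omega
  · rw [coord_coord hk]
    exact hmk

/-- A missing position `j` would trap the set between the start of the path and `j`. -/
theorem model_convex {v : Fin n} (hv : ¬ (S.model ε tag).Branch v) {e : Fin m} {i j k : ℕ}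
    (hij : i ≤ j) (hjk : j ≤ k) (hk : k < (S.model ε tag).len e + 2) (hi : (S.model ε tag).mem v e i)
    (hk' : (S.model ε tag).mem v e k) : (S.model ε tag).mem v e j := by
  by_contra hj
  have hne1 : i ≠ j := by rintro rfl; exact hj hi
  have hne2 : j ≠ k := by rintro rfl; exact hj hk'
  obtain ⟨i1, i2⟩ := interior_of_mem hv (by omega) hi
  obtain ⟨k1, k2⟩ := interior_of_mem hv hk hk'
  obtain ⟨l, l1, l2, heq⟩ := S.framework.subset_of_trapped (S.connected v) (b := ε e) (j := 0) (i := i) (k := j)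
    (by omega) (by omega) (by change _ ≤ (S.model ε tag).len e + 1; omega)
    (side_zero_false hv (e, false)) hj hi _ hk'
  rw [S.framework.pathVertex_interior k1 k2] at heq
  obtain ⟨-, hc, -⟩ := S.framework.pathVertex_eq_inr_iff.1 heq.symm
  omega

/-- Both ends of the path are missing, so the set is trapped inside it. -/
theorem model_edge_unique (hinj : Function.Injective ε) {v : Fin n} (hv : ¬ (S.model ε tag).Branch v)
    {e e' : Fin m} {i i' : ℕ} (hi : i < (S.model ε tag).len e + 2) (hi' : i' < (S.model ε tag).len e' + 2)
    (h : (S.model ε tag).mem v e i) (h' : (S.model ε tag).mem v e' i') : e = e' := by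
  obtain ⟨i1, i2⟩ := interior_of_mem hv hi h
  obtain ⟨k1, k2⟩ := interior_of_mem hv hi' h'
  obtain ⟨l, l1, l2, heq⟩ := S.framework.subset_of_trapped (S.connected v) (b := ε e) (j := 0) (i := i)
    (k := (S.model ε tag).len e + 1) (by omega) (by omega) le_rfl
    (side_zero_false hv (e, false)) (side_zero_false hv (e, true)) h _ h'
  rw [S.framework.pathVertex_interior k1 k2] at heq
  obtain ⟨hc, -⟩ := S.framework.pathVertex_eq_inr_iff.1 heq.symm
  exact hinj hc

/-- A gap on both sides of `i` would trap the set among internal vertices, but a branch vertex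
contains a vertex of `H`. -/
theorem model_prefix_or_suffix {v : Fin n} (hv : (S.model ε tag).Branch v) {e : Fin m} {i : ℕ}
    (hm : (S.model ε tag).mem v e i) :
    (∀ j ≤ i, (S.model ε tag).mem v e j) ∨
      ∀ j, i ≤ j → j < (S.model ε tag).len e + 2 → (S.model ε tag).mem v e j := by
  by_contra hc
  push Not at hc
  obtain ⟨⟨j, hj, hj'⟩, k, hk, hk', hk''⟩ := hc
  have hne1 : j ≠ i := by rintro rfl; exact hj' hm
  have hne2 : i ≠ k := by rintro rfl; exact hk'' hm
  have trap := S.framework.subset_of_trapped (S.connected v) (b := ε e) (j := j) (i := i) (k := k)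
    (by omega) (by omega) (by change _ ≤ (S.model ε tag).len e + 1; omega) hj' hk'' hm
  have noend : ∀ x, Sum.inl x ∉ S.rep v := by
    intro x hx
    obtain ⟨l, l1, l2, heq⟩ := trap _ hx
    have : l ≤ S.framework.len (ε e) := by
      have : k < S.framework.len (ε e) + 2 := hk'
      omega
    rw [S.framework.pathVertex_interior (by omega) this] at heq
    simp at heq
  obtain ⟨e', he' | he'⟩ := hv
  · simp [model_side_iff, coord, Graph.Subdivision.pathVertex] at he'
    exact noend _ he'
  · have hl : (S.model ε tag).len e' = S.framework.len (ε e') := rfl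
    simp [model_side_iff, coord, Graph.Subdivision.pathVertex, hl] at he'
    exact noend _ he'

theorem degenerate_iff {v : Fin n} : (S.model ε tag).Degenerate v ↔
    ∀ e, ∀ i < (S.model ε tag).len e + 2, ¬ (S.model ε tag).mem v e i := by
  constructor
  · rintro ⟨h1, h2⟩ e i hi hm
    exact h1 ((h2 e i hi).1 hm)
  · intro h
    have hb : ¬ (S.model ε tag).Branch v := by
      rintro ⟨e, he | he⟩
      · exact h e 0 (by omega) he
      · exact h e ((S.model ε tag).len e + 1) (by omega) he
    exact ⟨hb, fun e i hi => iff_of_false (h e i hi) hb⟩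

/-- The path model of a non-crossing representation has the required properties, if the tags number
the isolated vertices. -/
theorem model_represents (hS : S.IsNonCrossing) (hinj : Function.Injective ε)
    (hε : ∀ b ∈ H.edgeSet, ∃ e, ε e = b) {g : α → ℕ}
    (hg : Set.InjOn g H.vertexSet) (htag0 : ∀ v, S.rep v = ∅ → tag v = 0)
    (htag1 : ∀ v x, S.rep v = {Sum.inl x} → tag v = g x + 1) : (S.model ε tag).Represents G where
  prefix_or_suffix v e i hv _ hm := model_prefix_or_suffix hv hm
  edge_unique v e i e' i' hv hi hi' h h' := model_edge_unique hinj hv hi hi' h h'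
  convex v e i j k hv hij hjk hk hi hk' := model_convex hv hij hjk hk hi hk'
  single u v h h' huv h1 h2 := by
    by_cases hu : (S.model ε tag).Branch u
    · exact model_single_of_branch hS hinj huv hu h1 h2
    · exact model_single_of_not_branch hS
        (fun v e i e' i' hv hi hi' h h' => model_edge_unique hinj hv hi hi' h h') huv hu h1 h2
  adj_iff u v huv := by
    have single : ∀ {v x}, x ∈ S.rep v → (∀ e, ∀ i < (S.model ε tag).len e + 2,
        S.framework.pathVertex (ε e) i ≠ x) → S.rep v = {x} := by
      intro v x hx hiso
      refine S.framework.eq_singleton_of_isolated (S.connected v) hx fun b hb i hi => ?_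
      obtain ⟨e, rfl⟩ := hε b hb
      exact hiso e i hi
    have isInl : ∀ {v x}, x ∈ S.rep v → (∀ e, ∀ i < (S.model ε tag).len e + 2,
        S.framework.pathVertex (ε e) i ≠ x) → ∃ y ∈ H.vertexSet, x = Sum.inl y := by
      intro v x hx hiso
      rcases (S.connected v).1 hx with h | ⟨b, hb, i, h1, h2, rfl⟩
      · exact h
      · obtain ⟨e, rfl⟩ := hε b hb
        have hi : i < (S.model ε tag).len e + 2 := by
          change i < S.framework.len (ε e) + 2
          omega
        exact absurd (S.framework.pathVertex_interior h1 h2) (hiso e i hi)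
    rw [S.adj_iff u v huv]
    constructor
    · rintro ⟨x, hxu, hxv⟩
      by_cases hiso : ∀ e, ∀ i < (S.model ε tag).len e + 2, S.framework.pathVertex (ε e) i ≠ x
      · right
        have hu := single hxu hiso
        have hv := single hxv hiso
        obtain ⟨y, -, rfl⟩ := isInl hxu hiso
        refine ⟨degenerate_iff.2 fun e i hi hm => hiso e i hi ?_,
          degenerate_iff.2 fun e i hi hm => hiso e i hi ?_, ?_, ?_⟩
        · change _ ∈ S.rep u at hm
          rw [hu] at hm
          exact hm
        · change _ ∈ S.rep v at hm
          rw [hv] at hm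
          exact hm
        · exact (htag1 u y hu).trans (htag1 v y hv).symm
        · change tag u ≠ 0
          rw [htag1 u y hu]
          omega
      · left
        push Not at hiso
        obtain ⟨e, i, hi, rfl⟩ := hiso
        exact ⟨e, i, hi, hxu, hxv⟩
    · rintro (⟨e, i, hi, h1, h2⟩ | ⟨hu, hv, ht, h0⟩)
      · exact ⟨_, h1, h2⟩
      · have ex : ∀ {w}, (S.model ε tag).Degenerate w → tag w ≠ 0 →
            ∃ y ∈ H.vertexSet, S.rep w = {Sum.inl y} := by
          intro w hw h0
          obtain ⟨x, hx⟩ : (S.rep w).Nonempty := by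
            rw [Set.nonempty_iff_ne_empty]
            exact fun he => h0 (htag0 w he)
          have hiso : ∀ e, ∀ i < (S.model ε tag).len e + 2, S.framework.pathVertex (ε e) i ≠ x := by
            rintro e i hi rfl
            exact degenerate_iff.1 hw e i hi hx
          obtain ⟨y, hy, rfl⟩ := isInl hx hiso
          exact ⟨y, hy, single hx hiso⟩
        change tag u = tag v at ht
        obtain ⟨y, hy, hyu⟩ := ex hu h0
        obtain ⟨z, hz, hzv⟩ := ex hv (ht ▸ h0)
        have hyz : y = z := by
          rw [htag1 u y hyu, htag1 v z hzv] at ht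
          exact hg hy hz (by omega)
        subst hyz
        exact ⟨Sum.inl y, by rw [hyu]; rfl, by rw [hzv]; rfl⟩

end HRepresentation

/-! ### Reading the input -/

theorem length_flatMap_finRange {k : ℕ} (f : Fin k → List ℕ) :
    ((List.finRange k).flatMap f).length = ∑ i, (f i).length := by
  rw [List.length_flatMap, Fin.sum_univ_def]

/-- The words of a concatenation of blocks. -/
theorem getD_flatMap_finRange {k : ℕ} (f : Fin k → List ℕ) (i : Fin k) {j : ℕ}
    (hj : j < (f i).length) :
    ((List.finRange k).flatMap f).getD ((∑ i' : Fin k, if (i' : ℕ) < i then (f i').length else 0) + j) 0 =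
      (f i).getD j 0 := by
  induction k with
  | zero => exact i.elim0
  | succ k ih =>
    rw [List.finRange_succ, List.flatMap_cons, List.flatMap_map, Fin.sum_univ_succ]
    induction i using Fin.cases with
    | zero =>
      simp only [Fin.val_zero, Nat.not_lt_zero, if_false, Finset.sum_const_zero, zero_add]
      rw [List.getD_append _ _ _ _ hj]
    | succ i =>
      have := ih (fun i => f i.succ) i hj
      rw [← this, List.getD_append_right _ _ _ _ (by simp; omega)]
      congr 1
      simp only [Fin.val_zero, Fin.val_succ, Nat.zero_lt_succ, if_true, Nat.add_lt_add_iff_right]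
      omega

namespace HRepresentation

variable {n p m : ℕ} {H : Graph (Fin p) (Fin m)} {G : SimpleGraph (Fin n)} (S : HRepresentation H G)

open Classical in
/-- The characteristic vector of the representative of `v`. -/
noncomputable def vector (v : Fin n) : List ℕ :=
  (List.finRange p).map (fun x => if Sum.inl x ∈ S.rep v then 1 else 0) ++
    (List.finRange m).flatMap fun e => (List.range (S.framework.len e)).map
      fun i => if Sum.inr (e, i + 1) ∈ S.rep v then 1 else 0

/-- The words for the edge `e`. -/
def edgeWords (e : Fin m) : List ℕ := [(S.framework.src e : ℕ), (S.framework.tgt e : ℕ), S.framework.len e]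

theorem encode_eq : S.encode = [n, p, m] ++ ((List.finRange m).flatMap S.edgeWords ++
    (List.finRange n).flatMap S.vector) := by
  rw [encode, List.append_assoc]
  rfl

theorem length_vector (v : Fin n) : (S.vector v).length = p + ∑ e, S.framework.len e := by
  rw [vector, List.length_append, length_flatMap_finRange]
  simp

theorem length_encode : S.encode.length = 3 + (∑ _e : Fin m, 3 + ∑ _v : Fin n, (p + ∑ e, S.framework.len e)) := by
  rw [encode_eq, List.length_append, List.length_append, length_flatMap_finRange, length_flatMap_finRange]
  simp [length_vector, edgeWords]

theorem sum_before_lt {k : ℕ} (f : Fin k → ℕ) (e : Fin k) {i : ℕ} (hi : i < f e) :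
    (∑ e' : Fin k, if (e' : ℕ) < e then f e' else 0) + i < ∑ e, f e := by
  have : (∑ e' : Fin k, if (e' : ℕ) < e then f e' else 0) + f e ≤ ∑ e, f e := by
    rw [← Finset.add_sum_erase _ _ (Finset.mem_univ e), ← Finset.add_sum_erase (a := e) (f := f) _ (Finset.mem_univ e)]
    simp only [lt_irrefl, if_false, zero_add]
    rw [add_comm]
    exact Nat.add_le_add_left (Finset.sum_le_sum fun i _ => by split_ifs <;> omega) _
  omega

theorem getD_edge (e : Fin m) {j : ℕ} (hj : j < 3) :
    S.encode.getD (3 + ((∑ e' : Fin m, if (e' : ℕ) < e then 3 else 0) + j)) 0 = (S.edgeWords e).getD j 0 := by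
  have h := getD_flatMap_finRange S.edgeWords e (j := j) (by simpa [edgeWords] using hj)
  have hlen : ∀ e', (S.edgeWords e').length = 3 := fun _ => rfl
  simp only [hlen] at h
  rw [encode_eq, List.getD_append_right _ _ _ _ (by simp), ← h, List.getD_append]
  · simp
  · rw [length_flatMap_finRange]
    have hs := sum_before_lt (fun _ : Fin m => 3) e hj
    simp only [hlen, List.length_cons, List.length_nil]
    omega

theorem getD_vector (v : Fin n) {j : ℕ} (hj : j < p + ∑ e, S.framework.len e) :
    S.encode.getD (3 + (∑ _e : Fin m, 3 +
      ((∑ v' : Fin n, if (v' : ℕ) < v then p + ∑ e, S.framework.len e else 0) + j))) 0 =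
      (S.vector v).getD j 0 := by
  have h := getD_flatMap_finRange S.vector v (j := j) (by rwa [length_vector])
  simp only [length_vector] at h
  have hl : ((List.finRange m).flatMap S.edgeWords).length = ∑ _e : Fin m, 3 := by
    rw [length_flatMap_finRange]; rfl
  rw [encode_eq, List.getD_append_right _ _ _ _ (by simp), List.getD_append_right _ _ _ _ (by rw [hl]; simp), ← h,
    hl]
  congr 1
  simp only [List.length_cons, List.length_nil]
  omega

open Classical in
theorem getD_vector_vertex (v : Fin n) (x : Fin p) :
    (S.vector v).getD x 0 = if Sum.inl x ∈ S.rep v then 1 else 0 := by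
  rw [vector, List.getD_append _ _ _ _ (by simp)]
  simp [List.getD_eq_getElem?_getD]

open Classical in
theorem getD_vector_internal (v : Fin n) (e : Fin m) {i : ℕ} (hi : i < S.framework.len e) :
    (S.vector v).getD (p + ((∑ e' : Fin m, if (e' : ℕ) < e then S.framework.len e' else 0) + i)) 0 =
      if Sum.inr (e, i + 1) ∈ S.rep v then 1 else 0 := by
  have h := getD_flatMap_finRange (fun e => (List.range (S.framework.len e)).map
      fun i => if Sum.inr (e, i + 1) ∈ S.rep v then 1 else 0) e (j := i) (by simpa using hi)
  simp only [List.length_map, List.length_range] at h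
  rw [vector, List.getD_append_right _ _ _ _ (by simp)]
  simp only [List.length_map, List.length_finRange, Nat.add_sub_cancel_left]
  rw [h]
  simp [List.getD_eq_getElem?_getD, hi]

theorem edges_le_length : m ≤ S.encode.length := by
  rw [length_encode]; simp; omega

/-- An edge forces `p > 0`, so every vertex of `G` contributes at least one word. This lets loops
over the input length reach all vertices and all positions up to `n`. -/
theorem vertices_lt_length (hm : 0 < m) : n < S.encode.length := by
  have hp : 0 < p := (S.framework.src ⟨0, hm⟩).pos
  rw [length_encode]
  simp only [Finset.sum_const, Finset.card_univ, Fintype.card_fin, smul_eq_mul]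
  have : n * 1 ≤ n * (p + ∑ e, S.framework.len e) := Nat.mul_le_mul_left _ (by omega)
  omega

theorem vertices_le_length (hm : 0 < m) : n ≤ S.encode.length := (S.vertices_lt_length hm).le

theorem block_le_length (v : Fin n) : 3 + (p + ∑ e, S.framework.len e) ≤ S.encode.length := by
  rw [length_encode]
  simp only [Finset.sum_const, Finset.card_univ, Fintype.card_fin, smul_eq_mul]
  have : 1 * (p + ∑ e, S.framework.len e) ≤ n * (p + ∑ e, S.framework.len e) :=
    Nat.mul_le_mul_right _ v.pos
  omega

/-- Loops can run along a path because its characteristic vector is part of the input. This requires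
a vertex `v`: without one, `len e` appears only as a single word. -/
theorem len_le_length (v : Fin n) (e : Fin m) : S.framework.len e + 3 ≤ S.encode.length := by
  have h1 := S.block_le_length v
  have h2 : S.framework.len e ≤ ∑ e, S.framework.len e :=
    Finset.single_le_sum (f := fun e => S.framework.len e) (fun _ _ => Nat.zero_le _) (Finset.mem_univ e)
  omega

end HRepresentation

/-! ### The algorithm -/

namespace ThinAlgorithm

open RAM RAM.Tm

def nT : Tm := input (const 0)
def pT : Tm := input (const 1)
def mT : Tm := input (const 2)

/-- The sum of `f` over the indices below `e`. -/
def sumBefore (k e : Tm) (f : Tm → Tm) : Tm := sumLt k fun x => ite (lt x e) (f x) (const 0)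

/-- Multiplication is not an operation of the machine, so the offset `3 * e` is a sum over the
preceding edges. -/
def edgeT (j : ℕ) (e : Tm) : Tm :=
  input (add (const 3) (add (sumBefore mT e fun _ => const 3) (const j)))

def lenT (e : Tm) : Tm := edgeT 2 e

def blockT : Tm := add pT (sumLt mT lenT)

def vectorT (v j : Tm) : Tm :=
  input (add (const 3) (add (sumLt mT fun _ => const 3) (add (sumBefore nT v fun _ => blockT) j)))

def pathT (v e i : Tm) : Tm :=
  ite (eq i (const 0)) (vectorT v (edgeT 0 e))
    (ite (le i (lenT e))
      (vectorT v (add pT (add (sumBefore mT e lenT) (sub i (const 1)))))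
      (vectorT v (edgeT 1 e)))

def sideT (s : Bool) (v e j : Tm) : Tm := pathT v e (if s then sub (add (lenT e) (const 1)) j else j)

def branchT (v : Tm) : Tm :=
  exLt mT fun e => or (sideT false v e (const 0)) (sideT true v e (const 0))

def runT (s : Bool) (v e : Tm) : Tm :=
  sumLt (lenT e) fun i =>
    ite (allLt (add i (const 2)) fun j => iff (sideT s v e j) (branchT v)) (const 1) (const 0)

def fullT (v e : Tm) : Tm := allLt (add (lenT e) (const 2)) fun j => iff (pathT v e j) (branchT v)

def sameTypeT (u v : Tm) : Tm :=
  allLt mT fun e => and (iff (sideT false u e (const 0)) (sideT false v e (const 0)))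
    (and (iff (sideT true u e (const 0)) (sideT true v e (const 0))) (iff (fullT u e) (fullT v e)))

def isFirstT (r v : Tm) : Tm :=
  and (sameTypeT r v) (allLt nT fun r' => imp (lt r' r) (not (sameTypeT r' v)))

def differsT (v e : Tm) : Tm :=
  exLt nT fun r => and (isFirstT r v) (or (not (eq (runT false v e) (runT false r e)))
    (not (eq (runT true v e) (runT true r e))))

def sameClassT (u v : Tm) : Tm :=
  and (sameTypeT u v) (imp (branchT u) (allLt mT fun e => iff (differsT u e) (differsT v e)))

def leadsT (r : Tm) : Tm := allLt nT fun r' => imp (lt r' r) (not (sameClassT r' r))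

def clsT (v : Tm) : Tm :=
  sumLt nT fun r => ite (and (leadsT r) (allLt nT fun r' => imp (le r' r) (not (sameClassT r' v))))
    (const 1) (const 0)

def variesT (s : Bool) (v e : Tm) : Tm :=
  exLt nT fun v' => and (sameClassT v' v) (not (eq (runT s v' e) (runT s v e)))

def rankT (s : Bool) (e : Tm) : Tm := add (add e e) (const (if s then 1 else 0))

def leadingT (s : Bool) (v e : Tm) : Tm :=
  and (variesT s v e) (allLt mT fun e' =>
    and (imp (lt (rankT false e') (rankT s e)) (not (variesT false v e')))
      (imp (lt (rankT true e') (rankT s e)) (not (variesT true v e'))))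

def degenerateT (v : Tm) : Tm := and (not (branchT v)) (allLt mT fun e => fullT v e)

def weightT (s : Bool) (v e : Tm) : Tm :=
  ite (leadingT s v e) (runT s v e) (sub (lenT e) (runT s v e))

def tagT (v : Tm) : Tm :=
  sumLt pT fun x => ite (vectorT v x) (add x (const 1)) (const 0)

def keyT (v : Tm) : Tm :=
  ite (degenerateT v) (tagT v) (sumLt mT fun e => add (weightT false v e) (weightT true v e))

def loT (u v : Tm) : Tm := or (lt (keyT u) (keyT v)) (and (eq (keyT u) (keyT v)) (lt u v))

def meetsT (u v : Tm) : Tm :=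
  exLt mT fun e => exLt (add (lenT e) (const 2)) fun i => and (pathT u e i) (pathT v e i)

def flipLeT (b x y : Tm) : Tm := or (and b (le y x)) (and (not b) (le x y))

def cutT (b u v : Tm) : Tm :=
  exLt nT fun u' => and (eq (clsT u') (clsT u)) (and (le (keyT u) (keyT u'))
    (exLt nT fun v' => and (eq (clsT v') (clsT v)) (and (flipLeT b (keyT v') (keyT v))
      (not (meetsT u' v')))))

def coCutT (b u v : Tm) : Tm :=
  exLt nT fun u' => and (eq (clsT u') (clsT u)) (and (le (keyT u') (keyT u))
    (exLt nT fun v' => and (eq (clsT v') (clsT v)) (and (flipLeT b (keyT v) (keyT v'))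
      (not (meetsT u' v')))))

def flipT (i j : Tm) : Tm :=
  exLt nT fun u => and (eq (clsT u) i) (exLt nT fun v => and (eq (clsT v) j)
    (and (cutT (const 0) u v) (and (coCutT (const 0) u v) (meetsT u v))))

def beforeT (i j u v : Tm) : Tm :=
  or (and (eq (clsT u) i) (and (eq (clsT v) i) (loT u v)))
    (or (and (eq (clsT u) i) (and (not (eq (clsT v) i)) (cutT (flipT i j) u v)))
      (or (and (not (eq (clsT u) i)) (and (eq (clsT v) i) (not (cutT (flipT i j) v u))))
        (and (not (eq (clsT u) i)) (and (not (eq (clsT v) i))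
          (or (and (flipT i j) (loT v u)) (and (not (flipT i j)) (loT u v)))))))

def inPairT (i j v : Tm) : Tm := or (eq (clsT v) i) (eq (clsT v) j)

def positionT (i j v : Tm) : Tm :=
  sumLt nT fun u => ite (and (inPairT i j u) (beforeT i j u v)) (const 1) (const 0)

def classesW : Wr := Wr.each fun v => Wr.guard (lt v nT) (Wr.emit (clsT v))

/-- Sorting by rank: for each `r` in turn, the vertex with exactly `r` predecessors is written. -/
def orderedW (i j : Tm) : Wr :=
  Wr.each fun r => Wr.each fun v => Wr.guard (lt v nT)
    (Wr.guard (and (inPairT i j v) (eq (positionT i j v) r)) (Wr.emit v))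

def nonemptyT (i : Tm) : Tm := exLt nT fun v => eq (clsT v) i

def recordW (i j : Tm) : Wr :=
  Wr.seq (Wr.emit i) (Wr.seq (Wr.emit j) (Wr.seq (Wr.emit (ite (eq i j) (const 1) (const 0)))
    (orderedW i j)))

/-- Class numbers are below `n`, so these loops reach every nonempty class without running up to the
exponential bound. -/
def recordsW : Wr :=
  Wr.each fun i => Wr.each fun j => Wr.guard (and (le i j) (and (nonemptyT i) (nonemptyT j)))
    (recordW i j)

/-- The program that writes a proper mixed-thin representation. -/
def mainW : Wr := Wr.seq classesW recordsW

variable {n p m : ℕ} {H : Graph (Fin p) (Fin m)} {G : SimpleGraph (Fin n)} {S : HRepresentation H G}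
  {w : World}

open Classical in
/-- The number of the isolated vertex that represents `v`. -/
noncomputable def tag (S : HRepresentation H G) (v : Fin n) : ℕ :=
  ∑ x : Fin p, if Sum.inl x ∈ S.rep v then (x : ℕ) + 1 else 0

/-- The path model of the input. -/
noncomputable def inputModel (S : HRepresentation H G) : PathModel n m := S.model id (tag S)

/-! ### Correctness of the terms on encoded inputs -/

theorem val_n : Val S.encode w nT n := val_input (val_const 0)

theorem val_p : Val S.encode w pT p := val_input (val_const 1)

theorem val_m : Val S.encode w mT m := val_input (val_const 2)

theorem val_sumBefore {inp : List ℕ} {k e : Tm} {b : ℕ} {i : Fin b} {f : Tm → Tm} {g : Fin b → ℕ}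
    (hk : Val inp w k b) (hb : b ≤ inp.length) (he : Val inp w e i)
    (h : ∀ w', w.Le w' → ∀ q (i : Fin b), Val inp w' q i → Val inp w' (f q) (g i)) :
    Val inp w (sumBefore k e f) (∑ i' : Fin b, if (i' : ℕ) < i then g i' else 0) :=
  val_sumFin hk hb fun w' hw q i' hq =>
    val_ite (holds_lt hq (he.mono hw)) (h w' hw q i' hq) (val_const 0)

theorem val_edge {e : Fin m} {t : Tm} (he : Val S.encode w t e) {j : ℕ} (hj : j < 3) :
    Val S.encode w (edgeT j t) ((S.edgeWords e).getD j 0) :=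
  (val_input (val_add (val_const 3) (val_add (val_sumBefore val_m S.edges_le_length he
    fun _ _ _ _ _ => val_const 3) (val_const j)))).congr (S.getD_edge e hj)

theorem val_len {e : Fin m} {t : Tm} (he : Val S.encode w t e) :
    Val S.encode w (lenT t) (S.framework.len e) := val_edge he (by omega)

theorem val_block : Val S.encode w blockT (p + ∑ e, S.framework.len e) :=
  val_add val_p (val_sumFin val_m S.edges_le_length fun _ _ _ _ hq => val_len hq)

theorem val_vector (hm : 0 < m) {v : Fin n} {t u : Tm} {j : ℕ} (hv : Val S.encode w t v)
    (hj : Val S.encode w u j) (hj' : j < p + ∑ e, S.framework.len e) :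
    Val S.encode w (vectorT t u) ((S.vector v).getD j 0) :=
  (val_input (val_add (val_const 3) (val_add
    (val_sumFin val_m S.edges_le_length fun _ _ _ _ _ => val_const 3)
    (val_add (val_sumBefore val_n (S.vertices_le_length hm) hv fun _ _ _ _ _ => val_block)
      hj)))).congr (S.getD_vector v hj')

theorem holds_vertex (hm : 0 < m) {v : Fin n} {x : Fin p} {t u : Tm} (hv : Val S.encode w t v)
    (hx : Val S.encode w u x) : Holds S.encode w (vectorT t u) (Sum.inl x ∈ S.rep v) := by
  refine (holds_of_val (val_vector hm hv hx (by omega))).congr ?_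
  rw [S.getD_vector_vertex]
  split_ifs <;> simp_all

/-- The branch for internal positions is meaningful only for `1 ≤ i ≤ len e`; otherwise it may read
an unrelated word. The conditionals are therefore evaluated case by case. -/
theorem holds_path (hm : 0 < m) {v : Fin n} {e : Fin m} {i : ℕ} {t u q : Tm}
    (hv : Val S.encode w t v) (he : Val S.encode w u e) (hi : Val S.encode w q i) :
    Holds S.encode w (pathT t u q) (S.framework.pathVertex e i ∈ S.rep v) := by
  classical
  have h0 := holds_vertex (S := S) hm hv (x := S.framework.src e) (val_edge he (j := 0) (by omega))
  have h1 := holds_vertex (S := S) hm hv (x := S.framework.tgt e) (val_edge he (j := 1) (by omega))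
  have hc0 := holds_eq hi (val_const (inp := S.encode) (w := w) 0)
  have hc1 := holds_le hi (val_len he)
  by_cases hi0 : i = 0
  · subst hi0
    obtain ⟨a, ha, hP⟩ := h0
    refine ⟨a, fun w' hw => ?_, hP⟩
    obtain ⟨c, hc, hcP⟩ := hc0
    have := hc w' hw
    have hne : c ≠ 0 := hcP.2 rfl
    simp only [pathT, Tm.ite, Term.eval]
    rw [this, if_pos hne]
    exact ha w' hw
  obtain ⟨c, hc, hcP⟩ := hc0
  obtain ⟨d, hd, hdP⟩ := hc1
  have hc' : c = 0 := by
    by_contra hne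
    exact hi0 (hcP.1 hne)
  by_cases hi1 : i ≤ S.framework.len e
  · have hlt := HRepresentation.sum_before_lt (fun e => S.framework.len e) e (i := i - 1) (by omega)
    have h2 := val_vector hm hv (val_add val_p (val_add (val_sumBefore val_m S.edges_le_length he
      fun _ _ _ _ hq => val_len hq) (val_sub hi (val_const 1)))) (by omega)
    rw [S.getD_vector_internal v e (by omega), Nat.sub_add_cancel (by omega)] at h2
    refine ⟨if Sum.inr (e, i) ∈ S.rep v then 1 else 0, fun w' hw => ?_, ?_⟩
    · simp only [pathT, Tm.ite, Term.eval]
      rw [hc w' hw, if_neg (not_not.2 hc'), hd w' hw, if_pos (hdP.2 hi1)]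
      exact h2 w' hw
    · rw [S.framework.pathVertex_interior (by omega) hi1]
      split_ifs <;> simp_all
  · have hd' : d = 0 := by
      by_contra hne
      exact hi1 (hdP.1 hne)
    obtain ⟨a, ha, hP⟩ := h1
    refine ⟨a, fun w' hw => ?_, ?_⟩
    · simp only [pathT, Tm.ite, Term.eval]
      rw [hc w' hw, if_neg (not_not.2 hc'), hd w' hw, if_neg (not_not.2 hd')]
      exact ha w' hw
    · rw [hP]
      simp [Graph.Subdivision.pathVertex, hi0, hi1]

section

variable {u v : Fin n} {e : Fin m} {tu tv te : Tm}

theorem holds_side (hm : 0 < m) (s : Bool) {j : ℕ} {tj : Tm} (hv : Val S.encode w tv v)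
    (he : Val S.encode w te e) (hj : Val S.encode w tj j) :
    Holds S.encode w (sideT s tv te tj) ((inputModel S).side v (e, s) j) := by
  refine holds_path hm hv he ?_
  cases s
  · exact hj
  · exact val_sub (val_add (val_len he) (val_const 1)) hj

theorem holds_branch (hm : 0 < m) (hv : Val S.encode w tv v) :
    Holds S.encode w (branchT tv) ((inputModel S).Branch v) :=
  holds_exFin val_m S.edges_le_length fun _ hw _ _ hq =>
    holds_or (holds_side hm false (hv.mono hw) hq (val_const 0))
      (holds_side hm true (hv.mono hw) hq (val_const 0))

theorem val_run (hm : 0 < m) (s : Bool) (hv : Val S.encode w tv v) (he : Val S.encode w te e) :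
    Val S.encode w (runT s tv te) ((inputModel S).run v (e, s)) := by
  classical
  have hl : (inputModel S).len e + 3 ≤ S.encode.length := S.len_le_length v e
  rw [PathModel.run, Finset.card_filter]
  refine val_sumLt (val_len he) (by dsimp; omega) fun w' hw q i hi hq =>
    val_ite (holds_allLt (val_add hq (val_const 2)) (by dsimp at hi; omega) fun w'' hw' q' j hj hq' => ?_)
      (val_const 1) (val_const 0)
  exact holds_iff (holds_side hm s (hv.mono (hw.trans hw')) (he.mono (hw.trans hw')) hq')
    (holds_branch hm (hv.mono (hw.trans hw')))

theorem holds_full (hm : 0 < m) (hv : Val S.encode w tv v) (he : Val S.encode w te e) :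
    Holds S.encode w (fullT tv te) ((inputModel S).Full v e) := by
  have hl : (inputModel S).len e + 3 ≤ S.encode.length := S.len_le_length v e
  exact holds_allLt (val_add (val_len he) (val_const 2)) (by omega) fun w' hw q j hj hq =>
    holds_iff (holds_path hm (hv.mono hw) (he.mono hw) hq) (holds_branch hm (hv.mono hw))

theorem holds_sameType (hm : 0 < m) (hu : Val S.encode w tu u) (hv : Val S.encode w tv v) :
    Holds S.encode w (sameTypeT tu tv) ((inputModel S).SameType u v) :=
  holds_allFin val_m S.edges_le_length fun _ hw _ _ hq =>
    holds_and (holds_iff (holds_side hm false (hu.mono hw) hq (val_const 0))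
        (holds_side hm false (hv.mono hw) hq (val_const 0)))
      (holds_and (holds_iff (holds_side hm true (hu.mono hw) hq (val_const 0))
          (holds_side hm true (hv.mono hw) hq (val_const 0)))
        (holds_iff (holds_full hm (hu.mono hw) hq) (holds_full hm (hv.mono hw) hq)))

theorem holds_isFirst (hm : 0 < m) (hu : Val S.encode w tu u) (hv : Val S.encode w tv v) :
    Holds S.encode w (isFirstT tu tv) ((inputModel S).IsFirst u v) :=
  holds_and (holds_sameType hm hu hv) (holds_allFin val_n (S.vertices_le_length hm)
    fun _ hw _ _ hq => holds_imp (holds_lt hq (hu.mono hw))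
      (holds_not (holds_sameType hm hq (hv.mono hw))))

theorem holds_differs (hm : 0 < m) (hv : Val S.encode w tv v) (he : Val S.encode w te e) :
    Holds S.encode w (differsT tv te) ((inputModel S).Differs v e) :=
  holds_exFin val_n (S.vertices_le_length hm) fun _ hw _ _ hq =>
    holds_and (holds_isFirst hm hq (hv.mono hw)) (holds_or
      (holds_not (holds_eq (val_run hm false (hv.mono hw) (he.mono hw)) (val_run hm false hq (he.mono hw))))
      (holds_not (holds_eq (val_run hm true (hv.mono hw) (he.mono hw)) (val_run hm true hq (he.mono hw)))))

theorem holds_sameClass (hm : 0 < m) (hu : Val S.encode w tu u) (hv : Val S.encode w tv v) :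
    Holds S.encode w (sameClassT tu tv) ((inputModel S).SameClass u v) :=
  holds_and (holds_sameType hm hu hv) (holds_imp (holds_branch hm hu)
    (holds_allFin val_m S.edges_le_length fun _ hw _ _ hq =>
      holds_iff (holds_differs hm (hu.mono hw) hq) (holds_differs hm (hv.mono hw) hq)))

theorem holds_leads (hm : 0 < m) (hv : Val S.encode w tv v) :
    Holds S.encode w (leadsT tv) ((inputModel S).Leads v) :=
  holds_allFin val_n (S.vertices_le_length hm) fun _ hw _ _ hq =>
    holds_imp (holds_lt hq (hv.mono hw)) (holds_not (holds_sameClass hm hq (hv.mono hw)))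

theorem val_cls (hm : 0 < m) (hv : Val S.encode w tv v) :
    Val S.encode w (clsT tv) ((inputModel S).cls v) := by
  classical
  rw [PathModel.cls, Finset.card_filter]
  exact val_sumFin val_n (S.vertices_le_length hm) fun _ hw _ _ hq =>
    val_ite (holds_and (holds_leads hm hq) (holds_allFin val_n (S.vertices_le_length hm)
      fun _ hw' _ _ hq' => holds_imp (holds_le hq' (hq.mono hw'))
        (holds_not (holds_sameClass hm hq' (hv.mono (hw.trans hw')))))) (val_const 1) (val_const 0)

theorem holds_varies (hm : 0 < m) (s : Bool) (hv : Val S.encode w tv v) (he : Val S.encode w te e) :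
    Holds S.encode w (variesT s tv te) ((inputModel S).Varies v (e, s)) :=
  holds_exFin val_n (S.vertices_le_length hm) fun _ hw _ _ hq =>
    holds_and (holds_sameClass hm hq (hv.mono hw))
      (holds_not (holds_eq (val_run hm s hq (he.mono hw)) (val_run hm s (hv.mono hw) (he.mono hw))))

theorem val_rank (s : Bool) (he : Val S.encode w te e) :
    Val S.encode w (rankT s te) (PathModel.rank (e, s)) :=
  val_add (val_add he he) (val_const _)

theorem holds_leading (hm : 0 < m) (s : Bool) (hv : Val S.encode w tv v) (he : Val S.encode w te e) :
    Holds S.encode w (leadingT s tv te) ((inputModel S).Leading v (e, s)) :=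
  holds_and (holds_varies hm s hv he) (holds_allFin val_m S.edges_le_length fun _ hw _ _ hq =>
    holds_and
      (holds_imp (holds_lt (val_rank false hq) (val_rank s (he.mono hw)))
        (holds_not (holds_varies hm false (hv.mono hw) hq)))
      (holds_imp (holds_lt (val_rank true hq) (val_rank s (he.mono hw)))
        (holds_not (holds_varies hm true (hv.mono hw) hq))))

theorem holds_degenerate (hm : 0 < m) (hv : Val S.encode w tv v) :
    Holds S.encode w (degenerateT tv) ((inputModel S).Degenerate v) :=
  holds_and (holds_not (holds_branch hm hv)) (holds_allFin val_m S.edges_le_length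
    fun _ hw _ _ hq => holds_full hm (hv.mono hw) hq)

theorem val_weight (hm : 0 < m) (s : Bool) (hv : Val S.encode w tv v) (he : Val S.encode w te e) :
    Val S.encode w (weightT s tv te) ((inputModel S).weight v (e, s)) :=
  val_ite (holds_leading hm s hv he) (val_run hm s hv he) (val_sub (val_len he) (val_run hm s hv he))

theorem val_tag (hm : 0 < m) (hv : Val S.encode w tv v) : Val S.encode w (tagT tv) (tag S v) := by
  have hl := S.block_le_length v
  exact val_sumFin val_p (by omega) fun _ hw _ _ hq =>
    val_ite (holds_vertex hm (hv.mono hw) hq) (val_add hq (val_const 1)) (val_const 0)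

theorem val_key (hm : 0 < m) (hv : Val S.encode w tv v) :
    Val S.encode w (keyT tv) ((inputModel S).key v) :=
  val_ite (holds_degenerate hm hv) (val_tag hm hv) (val_sumFin val_m S.edges_le_length
    fun _ hw _ _ hq => val_add (val_weight hm false (hv.mono hw) hq) (val_weight hm true (hv.mono hw) hq))

theorem holds_lo (hm : 0 < m) (hu : Val S.encode w tu u) (hv : Val S.encode w tv v) :
    Holds S.encode w (loT tu tv) ((inputModel S).Lo u v) :=
  holds_or (holds_lt (val_key hm hu) (val_key hm hv))
    (holds_and (holds_eq (val_key hm hu) (val_key hm hv)) (holds_lt hu hv))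

theorem holds_meets (hm : 0 < m) (hu : Val S.encode w tu u) (hv : Val S.encode w tv v) :
    Holds S.encode w (meetsT tu tv) ((inputModel S).Meets u v) :=
  holds_exFin val_m S.edges_le_length fun _ hw _ e he =>
    holds_exLt (val_add (val_len he) (val_const 2)) (Nat.le_of_succ_le (S.len_le_length v e))
      fun _ hw' _ _ _ hq => holds_and
        (holds_path hm (hu.mono (hw.trans hw')) (he.mono hw') hq)
        (holds_path hm (hv.mono (hw.trans hw')) (he.mono hw') hq)

theorem holds_flipLe {inp : List ℕ} {b x y : Tm} {P : Prop} {a c : ℕ} (hb : Holds inp w b P)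
    (hx : Val inp w x a) (hy : Val inp w y c) :
    Holds inp w (flipLeT b x y) (PathModel.FlipLe P a c) :=
  holds_or (holds_and hb (holds_le hy hx)) (holds_and (holds_not hb) (holds_le hx hy))

theorem holds_cut (hm : 0 < m) {tb : Tm} {b : Prop} (hb : Holds S.encode w tb b)
    (hu : Val S.encode w tu u) (hv : Val S.encode w tv v) :
    Holds S.encode w (cutT tb tu tv) ((inputModel S).Cut b u v) :=
  holds_exFin val_n (S.vertices_le_length hm) fun _ hw _ _ hq =>
    holds_and (holds_eq (val_cls hm hq) (val_cls hm (hu.mono hw)))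
      (holds_and (holds_le (val_key hm (hu.mono hw)) (val_key hm hq))
        (holds_exFin val_n (S.vertices_le_length hm) fun _ hw' _ _ hq' =>
          holds_and (holds_eq (val_cls hm hq') (val_cls hm (hv.mono (hw.trans hw'))))
            (holds_and (holds_flipLe (hb.mono (hw.trans hw')) (val_key hm hq')
                (val_key hm (hv.mono (hw.trans hw'))))
              (holds_not (holds_meets hm (hq.mono hw') hq')))))

theorem holds_coCut (hm : 0 < m) {tb : Tm} {b : Prop} (hb : Holds S.encode w tb b)
    (hu : Val S.encode w tu u) (hv : Val S.encode w tv v) :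
    Holds S.encode w (coCutT tb tu tv) ((inputModel S).CoCut b u v) :=
  holds_exFin val_n (S.vertices_le_length hm) fun _ hw _ _ hq =>
    holds_and (holds_eq (val_cls hm hq) (val_cls hm (hu.mono hw)))
      (holds_and (holds_le (val_key hm hq) (val_key hm (hu.mono hw)))
        (holds_exFin val_n (S.vertices_le_length hm) fun _ hw' _ _ hq' =>
          holds_and (holds_eq (val_cls hm hq') (val_cls hm (hv.mono (hw.trans hw'))))
            (holds_and (holds_flipLe (hb.mono (hw.trans hw')) (val_key hm (hv.mono (hw.trans hw')))
                (val_key hm hq'))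
              (holds_not (holds_meets hm (hq.mono hw') hq')))))

theorem holds_false {inp : List ℕ} : Holds inp w (const 0) False := ⟨0, val_const 0, by simp⟩

theorem holds_flip (hm : 0 < m) {i j : ℕ} {ti tj : Tm} (hi : Val S.encode w ti i)
    (hj : Val S.encode w tj j) : Holds S.encode w (flipT ti tj) ((inputModel S).Flip i j) :=
  holds_exFin val_n (S.vertices_le_length hm) fun _ hw _ _ hq =>
    holds_and (holds_eq (val_cls hm hq) (hi.mono hw))
      (holds_exFin val_n (S.vertices_le_length hm) fun _ hw' _ _ hq' =>
        holds_and (holds_eq (val_cls hm hq') (hj.mono (hw.trans hw')))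
          (holds_and (holds_cut hm holds_false (hq.mono hw') hq')
            (holds_and (holds_coCut hm holds_false (hq.mono hw') hq')
              (holds_meets hm (hq.mono hw') hq'))))

theorem holds_before (hm : 0 < m) {i j : ℕ} {ti tj : Tm} (hi : Val S.encode w ti i)
    (hj : Val S.encode w tj j) (hu : Val S.encode w tu u) (hv : Val S.encode w tv v) :
    Holds S.encode w (beforeT ti tj tu tv) ((inputModel S).Before i j u v) := by
  have hui := holds_eq (val_cls hm hu) hi
  have hvi := holds_eq (val_cls hm hv) hi
  have hf := holds_flip hm hi hj
  exact holds_or (holds_and hui (holds_and hvi (holds_lo hm hu hv)))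
    (holds_or (holds_and hui (holds_and (holds_not hvi) (holds_cut hm hf hu hv)))
      (holds_or (holds_and (holds_not hui) (holds_and hvi (holds_not (holds_cut hm hf hv hu))))
        (holds_and (holds_not hui) (holds_and (holds_not hvi)
          (holds_or (holds_and hf (holds_lo hm hv hu)) (holds_and (holds_not hf) (holds_lo hm hu hv)))))))

end

/-- `v` lies in one of the classes `i` and `j`. -/
def InPair (S : HRepresentation H G) (i j : ℕ) (v : Fin n) : Prop :=
  (inputModel S).cls v = i ∨ (inputModel S).cls v = j

open Classical in
/-- The position of `v` in the order on the union of the classes `i` and `j`. -/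
noncomputable def position (S : HRepresentation H G) (i j : ℕ) (v : Fin n) : ℕ :=
  (Finset.univ.filter fun u => InPair S i j u ∧ (inputModel S).Before i j u v).card

theorem val_position (hm : 0 < m) {i j : ℕ} {ti tj tv : Tm} {v : Fin n} (hi : Val S.encode w ti i)
    (hj : Val S.encode w tj j) (hv : Val S.encode w tv v) :
    Val S.encode w (positionT ti tj tv) (position S i j v) := by
  classical
  rw [position, Finset.card_filter]
  exact val_sumFin val_n (S.vertices_le_length hm) fun _ hw _ _ hq =>
    val_ite (holds_and (holds_or (holds_eq (val_cls hm hq) (hi.mono hw))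
      (holds_eq (val_cls hm hq) (hj.mono hw))) (holds_before hm (hi.mono hw) (hj.mono hw) hq (hv.mono hw)))
      (val_const 1) (val_const 0)

/-- Loops over the vertices. -/
theorem writes_eachFin {inp : List ℕ} {b : ℕ} {k : Tm} {f : Tm → Wr} {g : Fin b → List ℕ}
    (hk : Val inp w k b) (hb : b ≤ inp.length)
    (h : ∀ w', w.Le w' → ∀ q (i : Fin b), Val inp w' q i → Writes inp w' (f q) (g i)) :
    Writes inp w (Wr.each fun x => Wr.guard (lt x k) (f x)) ((List.finRange b).flatMap g) := by
  have h1 : Writes inp w (Wr.each fun x => Wr.guard (lt x k) (f x))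
      ((List.range inp.length).flatMap fun i => if i < b then (if hi : i < b then g ⟨i, hi⟩ else []) else []) := by
    refine writes_each fun w' hw q i _ hq => writes_guard (holds_lt hq (hk.mono hw)) fun hi => ?_
    rw [dif_pos hi]
    exact h w' hw q ⟨i, hi⟩ hq
  have h2 : ((List.range inp.length).flatMap fun i =>
      if i < b then (if hi : i < b then g ⟨i, hi⟩ else []) else []) = (List.finRange b).flatMap g := by
    obtain ⟨c, hc⟩ := Nat.exists_eq_add_of_le hb
    rw [hc, List.range_add, List.flatMap_append]
    have e1 : ((List.range b).flatMap fun i =>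
        if i < b then (if hi : i < b then g ⟨i, hi⟩ else []) else []) = (List.finRange b).flatMap g := by
      rw [← List.map_coe_finRange_eq_range, List.flatMap_map]
      exact List.flatMap_congr fun i _ => by simp
    rw [e1]
    simp
  rw [← h2]
  exact h1

open Classical in
/-- The vertices of the classes `i` and `j` in increasing order. -/
noncomputable def orderedList (S : HRepresentation H G) (i j : ℕ) : List (Fin n) :=
  (List.range S.encode.length).flatMap fun r =>
    (List.finRange n).flatMap fun v => if InPair S i j v ∧ position S i j v = r then [v] else []

theorem writes_ordered (hm : 0 < m) {i j : ℕ} {ti tj : Tm} (hi : Val S.encode w ti i)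
    (hj : Val S.encode w tj j) :
    Writes S.encode w (orderedW ti tj) ((orderedList S i j).map fun v : Fin n => (v : ℕ)) := by
  classical
  have h : Writes S.encode w (orderedW ti tj) ((List.range S.encode.length).flatMap fun r =>
      (List.finRange n).flatMap fun v => if InPair S i j v ∧ position S i j v = r then [(v : ℕ)] else []) :=
    writes_each fun w' hw q r _ hr => writes_eachFin val_n (S.vertices_le_length hm)
      fun w'' hw' q' v hv => writes_guard (holds_and
        (holds_or (holds_eq (val_cls hm hv) (hi.mono (hw.trans hw')))
          (holds_eq (val_cls hm hv) (hj.mono (hw.trans hw'))))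
        (holds_eq (val_position hm (hi.mono (hw.trans hw')) (hj.mono (hw.trans hw')) hv)
          (hr.mono hw'))) fun _ => writes_emit hv
  convert h using 1
  rw [orderedList, List.map_flatMap]
  refine List.flatMap_congr fun r _ => ?_
  rw [List.map_flatMap]
  refine List.flatMap_congr fun v _ => ?_
  split_ifs <;> rfl

end ThinAlgorithm

namespace ThinAlgorithm

open RAM RAM.Tm

variable {n p m : ℕ} {H : Graph (Fin p) (Fin m)} {G : SimpleGraph (Fin n)} {S : HRepresentation H G}
  {w : World}

theorem inputModel_represents (hS : S.IsNonCrossing) : (inputModel S).Represents G := by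
  classical
  refine HRepresentation.model_represents hS (fun _ _ h => h) (fun b _ => ⟨b, rfl⟩)
    (g := fun x : Fin p => (x : ℕ)) (fun _ _ _ _ h => Fin.ext h) (fun v hv => ?_) fun v x hv => ?_
  · simp [tag, hv]
  · simp [tag, hv]

/-! ### The written lists -/

theorem position_lt {i j : ℕ} {u v : Fin n} (hu : InPair S i j u) (hv : InPair S i j v)
    (h : (inputModel S).Before i j u v) : position S i j u < position S i j v := by
  classical
  have hlin := PathModel.isStrictLinearOrderOn_before (D := inputModel S) i j
  refine Finset.card_lt_card ?_
  rw [Finset.ssubset_iff_of_subset]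
  · exact ⟨u, by simp [hu, h], by simpa using fun _ => hlin.1 u hu⟩
  · intro x
    simp only [Finset.mem_filter, Finset.mem_univ, true_and]
    exact fun hx => ⟨hx.1, hlin.2.1 x hx.1 u hu v hv hx.2 h⟩

theorem before_of_position_lt {i j : ℕ} {u v : Fin n} (hu : InPair S i j u) (hv : InPair S i j v)
    (h : position S i j u < position S i j v) : (inputModel S).Before i j u v := by
  have hlin := PathModel.isStrictLinearOrderOn_before (D := inputModel S) i j
  refine (hlin.2.2 u hu v hv (by rintro rfl; omega)).resolve_right fun hc => ?_
  have := position_lt hv hu hc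
  omega

theorem mem_orderedList (hm : 0 < m) {i j : ℕ} {v : Fin n} : v ∈ orderedList S i j ↔ InPair S i j v := by
  classical
  have hpos : position S i j v ≤ n := (Finset.card_filter_le _ _).trans (by simp)
  have hn := S.vertices_lt_length hm
  constructor
  · intro h
    simp only [orderedList, List.mem_flatMap] at h
    obtain ⟨r, -, v', -, h⟩ := h
    split_ifs at h with hc
    · rw [List.mem_singleton] at h
      exact h ▸ hc.1
    · simp at h
  · intro h
    simp only [orderedList, List.mem_flatMap]
    exact ⟨position S i j v, List.mem_range.2 (by omega), v, List.mem_finRange v, by simp [h]⟩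

theorem pairwise_orderedList (i j : ℕ) : (orderedList S i j).Pairwise ((inputModel S).Before i j) := by
  classical
  have hlin := PathModel.isStrictLinearOrderOn_before (D := inputModel S) i j
  have mem : ∀ {r : ℕ} {v x : Fin n}, x ∈ (if InPair S i j v ∧ position S i j v = r then [v] else []) →
      x = v ∧ InPair S i j x ∧ position S i j x = r := by
    intro r v x hx
    split_ifs at hx with hc
    · rw [List.mem_singleton] at hx
      subst hx
      exact ⟨rfl, hc⟩
    · simp at hx
  rw [orderedList, List.pairwise_flatMap]
  refine ⟨fun r _ => ?_, List.pairwise_lt_range.imp ?_⟩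
  · rw [List.pairwise_flatMap]
    refine ⟨fun v _ => by split_ifs <;> simp, (List.nodup_finRange n).imp ?_⟩
    intro a b hab x hx y hy
    obtain ⟨rfl, hx, hxr⟩ := mem hx
    obtain ⟨rfl, hy, hyr⟩ := mem hy
    rcases hlin.2.2 x hx y hy hab with h | h
    · exact h
    · have := position_lt hy hx h
      omega
  · intro r r' hr x hx y hy
    rw [List.mem_flatMap] at hx hy
    obtain ⟨a, -, hx⟩ := hx
    obtain ⟨b, -, hy⟩ := hy
    obtain ⟨-, hx, hxr⟩ := mem hx
    obtain ⟨-, hy, hyr⟩ := mem hy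
    exact before_of_position_lt hx hy (by omega)

/-- The classes `i ≤ j` are nonempty. -/
def IsPair (S : HRepresentation H G) (i j : ℕ) : Prop :=
  i ≤ j ∧ (∃ v, (inputModel S).cls v = i) ∧ ∃ v, (inputModel S).cls v = j

theorem holds_nonempty (hm : 0 < m) {i : ℕ} {ti : Tm} (hi : Val S.encode w ti i) :
    Holds S.encode w (nonemptyT ti) (∃ v, (inputModel S).cls v = i) :=
  holds_exFin val_n (S.vertices_le_length hm) fun _ hw _ _ hq =>
    holds_eq (val_cls hm hq) (hi.mono hw)

/-- The words written for a pair of classes. -/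
noncomputable def record (S : HRepresentation H G) (i j : ℕ) : List ℕ :=
  [i] ++ ([j] ++ ([if i = j then 1 else 0] ++ (orderedList S i j).map fun v : Fin n => (v : ℕ)))

open Classical in
/-- The output of the program. -/
theorem writes_main (hm : 0 < m) : Writes S.encode w mainW
    ((List.finRange n).flatMap (fun v => [(inputModel S).cls v]) ++
      (List.range S.encode.length).flatMap fun i => (List.range S.encode.length).flatMap fun j =>
        if IsPair S i j then record S i j else []) := by
  refine writes_seq (writes_eachFin val_n (S.vertices_le_length hm)
    fun _ _ _ _ hq => writes_emit (val_cls hm hq)) ?_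
  refine writes_each fun w₁ _ _ i _ hi => writes_each fun w₂ hw _ j _ hj => ?_
  have hi := hi.mono hw
  exact writes_guard (holds_and (holds_le hi hj) (holds_and (holds_nonempty hm hi) (holds_nonempty hm hj)))
    fun _ => writes_seq (writes_emit hi) (writes_seq (writes_emit hj)
      (writes_seq (writes_emit (val_ite (holds_eq hi hj) (val_const 1) (val_const 0)))
        (writes_ordered hm hi hj)))

-- Two bounds on class numbers meet here: below the input length, so that the loops miss no pair,
-- and below the thinness bound, so that the numbers are indices of classes.
open Classical in
theorem isEncodedBy (hm : 0 < m) (hS : S.IsNonCrossing) :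
    ((inputModel_represents hS).rep hm).IsEncodedBy
      ((List.finRange n).flatMap (fun v => [(inputModel S).cls v]) ++
        (List.range S.encode.length).flatMap fun i => (List.range S.encode.length).flatMap fun j =>
          if IsPair S i j then record S i j else []) := by
  have hD := inputModel_represents hS
  have hlt : ∀ {i : ℕ}, (∃ v, (inputModel S).cls v = i) → i < thinnessBound m := by
    rintro _ ⟨v, rfl⟩
    exact hD.cls_lt_thinnessBound hm v
  have hlt' : ∀ {i : ℕ}, (∃ v, (inputModel S).cls v = i) → i < S.encode.length := by
    rintro _ ⟨v, rfl⟩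
    exact (PathModel.cls_lt_card v).trans_le (S.vertices_le_length hm)
  let one : ℕ → ℕ → List (Fin (thinnessBound m) × Fin (thinnessBound m)) := fun i j =>
    if h : IsPair S i j then [(⟨i, hlt h.2.1⟩, ⟨j, hlt h.2.2⟩)] else []
  have mem_one : ∀ {i j : ℕ} {q}, q ∈ one i j → (q.1 : ℕ) = i ∧ (q.2 : ℕ) = j ∧ IsPair S i j := by
    intro i j q hq
    by_cases h : IsPair S i j
    · simp only [one, dif_pos h, List.mem_singleton] at hq
      subst hq
      exact ⟨rfl, rfl, h⟩
    · simp [one, dif_neg h] at hq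
  refine ⟨(List.range S.encode.length).flatMap fun i => (List.range S.encode.length).flatMap fun j => one i j,
    fun q => orderedList S q.1 q.2, ?_, ?_, ?_, ?_⟩
  · rw [List.Nodup, List.pairwise_flatMap]
    refine ⟨fun i _ => ?_, List.pairwise_lt_range.imp ?_⟩
    · rw [List.pairwise_flatMap]
      refine ⟨fun j _ => ?_, List.pairwise_lt_range.imp ?_⟩
      · simp only [one]
        split_ifs <;> simp
      · rintro j j' hj x hx y hy rfl
        have h1 := mem_one hx
        have h2 := mem_one hy
        omega
    · rintro i i' hi x hx y hy rfl
      rw [List.mem_flatMap] at hx hy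
      obtain ⟨j, -, hx⟩ := hx
      obtain ⟨j', -, hy⟩ := hy
      have h1 := mem_one hx
      have h2 := mem_one hy
      omega
  · intro i j
    have hcls : ∀ i : Fin (thinnessBound m), (∃ v, (hD.rep hm).cls v = i) ↔
        ∃ v, (inputModel S).cls v = i := fun i => by
      simp [PathModel.Represents.rep, Fin.ext_iff]
    rw [hcls, hcls]
    constructor
    · intro h
      simp only [List.mem_flatMap] at h
      obtain ⟨a, -, b, -, h⟩ := h
      obtain ⟨h1, h2, h3⟩ := mem_one h
      simp only at h1 h2
      rw [← h1, ← h2] at h3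
      exact h3
    · intro h
      simp only [List.mem_flatMap]
      refine ⟨i, List.mem_range.2 (hlt' h.2.1), j, List.mem_range.2 (hlt' h.2.2), ?_⟩
      have h' : IsPair S i j := h
      simp [one, dif_pos h']
  · intro i j _
    refine ⟨fun v => ?_, pairwise_orderedList i j⟩
    rw [mem_orderedList hm]
    simp [PathModel.Represents.rep, Fin.ext_iff, InPair]
  · congr 1
    · simp [PathModel.Represents.rep, List.map_eq_flatMap]
    · rw [List.flatMap_assoc]
      refine List.flatMap_congr fun i _ => ?_
      rw [List.flatMap_assoc]
      refine List.flatMap_congr fun j _ => ?_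
      by_cases h : IsPair S i j
      · simp only [one, dif_pos h, if_pos h, List.flatMap_singleton, record]
        simp [PathModel.Represents.rep, Fin.ext_iff, List.map_eq_flatMap]
      · simp only [one, dif_neg h, if_neg h, List.flatMap_nil]

end ThinAlgorithm

/-! ### Proper mixed-thinness -/

/-- Proper mixed-thin representations restrict to induced subgraphs. -/
def ProperMixedThinRep.comap {V W : Type*} {G : SimpleGraph V} {G' : SimpleGraph W} {k : ℕ}
    (R : ProperMixedThinRep G' k) (f : V → W) (hf : Function.Injective f)
    (hadj : ∀ u v, G'.Adj (f u) (f v) ↔ G.Adj u v) : ProperMixedThinRep G k :=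
  have hs : ∀ s u v, SignedAdj G' s (f u) (f v) ↔ SignedAdj G s u v := by
    intro s u v
    cases s <;> simp [SignedAdj, hadj, hf.ne_iff]
  { cls := fun v => R.cls (f v)
    lt := fun i j u v => R.lt i j (f u) (f v)
    sign := R.sign
    linear := fun i j hij => ⟨fun u hu => (R.linear i j hij).1 _ hu,
      fun u hu v hv w hw => (R.linear i j hij).2.1 _ hu _ hv _ hw,
      fun u hu v hv hne => (R.linear i j hij).2.2 _ hu _ hv (hf.ne hne)⟩
    al_left := fun i j hij => (R.al_left i j hij).imp (fun h u hu v hv => h _ hu _ hv)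
      fun h u hu v hv => h _ hu _ hv
    al_right := fun i j hij => (R.al_right i j hij).imp (fun h u hu v hv => h _ hu _ hv)
      fun h u hu v hv => h _ hu _ hv
    co := fun i j hij u v w h h1 h2 h3 =>
      (hs _ _ _).1 (R.co i j hij _ _ _ h h1 h2 ((hs _ _ _).2 h3))
    sc := fun i j hij u v w h h1 h2 h3 =>
      (hs _ _ _).1 (R.sc i j hij _ _ _ h h1 h2 ((hs _ _ _).2 h3)) }

/-- Restriction of a representation to an induced subgraph. -/
def HRepresentation.comap {α β V W : Type*} {H : Graph α β} {G : SimpleGraph V}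
    (S : HRepresentation H G) (f : W → V) (hf : Function.Injective f) :
    HRepresentation H (G.comap f) where
  framework := S.framework
  rep v := S.rep (f v)
  connected v := S.connected (f v)
  adj_iff u v huv := S.adj_iff (f u) (f v) (hf.ne huv)

/-- The vertices of `G` and the edges of `H` are numbered, and the representation obtained from the
path model is carried back along the numbering. -/
theorem nonempty_properMixedThinRep {α β V : Type*} [Finite V] {H : Graph α β} {G : SimpleGraph V}
    (hV : H.vertexSet.Finite) (hE : H.edgeSet.Finite) (hpos : 0 < H.size)
    (hG : IsNonCrossingHGraph H G) : Nonempty (ProperMixedThinRep G (thinnessBound H.size)) := by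
  classical
  obtain ⟨S, hS⟩ := hG
  obtain ⟨n, ⟨f⟩⟩ := Finite.exists_equiv_fin V
  have := hE.to_subtype
  let ε : Fin H.size ≃ H.edgeSet := (Finite.equivFinOfCardEq (Nat.card_coe_set_eq H.edgeSet)).symm
  obtain ⟨g, hg⟩ := Set.countable_iff_exists_injOn.1 hV.countable
  let S' := S.comap f.symm f.symm.injective
  -- The value `0` is reserved for the empty set, hence the shift by one.
  let tag : Fin n → ℕ := fun v => if h : ∃ x, S'.rep v = {Sum.inl x} then g h.choose + 1 else 0
  have hD : (S'.model (fun e => (ε e : β)) tag).Represents (G.comap f.symm) := by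
    refine HRepresentation.model_represents (g := g) (fun u v => hS (f.symm u) (f.symm v))
      (fun a b h => ε.injective (Subtype.ext h)) (fun b hb => ⟨ε.symm ⟨b, hb⟩, by simp⟩) hg ?_ ?_
    · intro v hv
      simp [tag, hv, eq_comm (a := (∅ : Set (α ⊕ β × ℕ)))]
    · intro v x hx
      have hex : ∃ x, S'.rep v = {Sum.inl x} := ⟨x, hx⟩
      have : hex.choose = x :=
        (Sum.inl_injective (Set.singleton_injective (hx.symm.trans hex.choose_spec))).symm
      simp only [tag, dif_pos hex, this]
  exact ⟨(hD.rep hpos).comap f f.injective fun u v => by simp⟩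

theorem theorem4 :
    (∀ (α : Type*) (β : Type*) (V : Type*) [Finite V] (H : Graph α β) (G : SimpleGraph V),
      H.vertexSet.Finite → H.edgeSet.Finite → 0 < H.size → IsNonCrossingHGraph H G →
        properMixedThinness G ≤ (thinnessBound H.size : ℕ∞)) ∧
    (∃ (prog : RAM.Prog) (time : Polynomial ℕ),
      ∀ (n p m : ℕ) (H : Graph (Fin p) (Fin m)) (G : SimpleGraph (Fin n))
        (S : HRepresentation H G),
        H.vertexSet = Set.univ → H.edgeSet = Set.univ → 0 < m → S.IsNonCrossing →
          ∃ (s : RAM.State) (T : ℕ), RAM.Exec S.encode prog RAM.State.init s T ∧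
            T ≤ time.eval (RAM.bitSize S.encode) ∧
            ∃ R : ProperMixedThinRep G (thinnessBound H.size), R.IsEncodedBy s.out) := by
  refine ⟨fun α β V _ H G hV hE hpos hG => ?_, (ThinAlgorithm.mainW 0).code 0,
    (ThinAlgorithm.mainW 0).time, fun n p m H G S _ hE hm hS => ?_⟩
  · refine iInf₂_le (thinnessBound H.size) ⟨?_, nonempty_properMixedThinRep hV hE hpos hG⟩
    -- The summand `‖H‖` alone makes the bound positive.
    exact hpos.trans_le (Nat.le_add_left _ _)
  · obtain ⟨s, T, hex, hT, hout⟩ := (ThinAlgorithm.mainW 0).exec_init S.encode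
    refine ⟨s, T, hex, hT, ?_⟩
    have hsize : H.size = m := by simp [Graph.size, hE]
    rw [hsize, hout, ThinAlgorithm.writes_main (w := (fun _ => 0, 0)) hm (fun _ => 0, 0) (.refl _)]
    exact ⟨_, ThinAlgorithm.isEncodedBy hm hS⟩
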